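/- **Conventions.** For $c>0$ let $\mathbb S^{d}(c)=\{X\in\mathbb R^{d+1}:\langle X,X\rangle=1/c\}$ and let $\mathbb H^{m}(-c)$ be one sheet of $\{X\in\mathbb L^{m+1}:\langle X,X\rangle=-1/c\}$, where $\mathbb L^{m+1}$ is $\mathbb R^{m+1}$ with the Lorentz product of signature $(+,\dots,+,-)$. Put $\mathbb Q^N_c=\mathbb S^N(c)\subset\mathbb R^{N+1}$ for $c>0$ and $\mathbb Q^N_0=\mathbb R^N$; let $\epsilon=1$ if $c>0$ and $\epsilon=0$ if $c=0$. *Extrinsic products.* Let $\mathbb R^{d}=\bigoplus_{i\in I}\mathbb R^{m_i}\oplus\mathbb R^{m'}$ ($I$ finite) be an orthogonal decomposition, the last summand possibly trivial, let each $N_i$ be either $\mathbb R^{m_i}$ or a sphere $\mathbb S^{m_i-1}(c_i)\subset\mathbb R^{m_i}$ with $m_i\ge 2$, $c_i>0$, and let $v\in\mathbb R^{m'}$ be a constant vector. The map $\Psi\colon\prod_{i\in I} N_i\to\mathbb R^d$, $\Psi((x_i)_i)=((x_i)_i,v)$, is called an extrinsic product of the $N_i$. If all $N_i$ are spheres, $\Psi$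 takes values in $\mathbb S^{d-1}(c)$ with $1/c=\sum_i 1/c_i+\langle v,v\rangle$. *Stereographic projections.* A stereographic projection of the unit sphere $\mathbb S^N\subset\mathbb R^{N+1}$ onto $\mathbb R^N$ is the central projection of $\mathbb S^N\setminus\{e\}$ from a pole $e\in\mathbb S^N$ onto a hyperplane orthogonal to $e$ that does not contain $e$, this hyperplane being identified with $\mathbb R^N$ by an isometry. *The maps $\Theta$.* Let $p_0,w\in\mathbb L^{N+2}$ be light-like with $\langle p_0,w\rangle=1$ and let $A\colon\mathbb R^N\to\{p_0,w\}^\perp$ be a linear isometry; then $E(x)=p_0+A(x)-\frac12\|x\|^2w$ is an isometry of $\mathbb R^N$ onto $\{p\in\mathbb L^{N+2}:\langle p,p\rangle=0,\ \langle p,w\rangle=1\}$. Let $1\le m\le N-1$, let $\mathbb L^{N+2}=V\oplus W$ be an orthogonal decomposition with $V$ time-like and let $C\colon\mathbb L^{m+1}\to V$, $D\colon\mathbb R^{N-m+1}\to W$ be linear isometries. These data define $\Theta\colon\mathbb H^m(-c)\times\mathbb S^{N-m}(c)\to\mathbb R^N$ by $$E(\Theta(X,Y))=\frac{C(X)+D(Y)}{\langle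 C(X)+D(Y),w\rangle},$$ wherever the denominator is not zero (that is, outside of at most one point). $\Theta$ is a conformal diffeomorphism onto the complement of $E^{-1}(V)$ (an $(m-1)$-dimensional sphere or affine subspace); we call such a $\Theta$ a standard conformal diffeomorphism. **Theorem.** Let $k\ge2$ and let $M_1,\dots,M_k$ be connected Riemannian manifolds of dimensions $n_i\ge1$ with $n=n_1+\dots+n_k\ge3$. Let $f\colon M=\prod_{i=1}^kM_i\to\mathbb R^N$ be a conformal immersion of the Riemannian product whose second fundamental form is adapted to the product net, i.e. for each $i$ the subbundle $E_i\subset TM$ of the vectors tangent to the $i$-th factor is invariant under all shape operators of $f$. Then one of the following holds. (i) There are $c\ge0$, an extrinsic product $\Psi\colon\prod_{i=1}^kN_i\to\mathbb Q^N_c\subset\mathbb R^{N+\epsilon}$ (all $N_i$ being spheres if $c>0$) and isometric immersions $f_i\colon M_i\to N_i$ such that $$f=\mathcal P\circ H\circ\Psi\circ(f_1\times\dots\times f_k),$$ where $H$ is a homothety of $\mathbb R^{N+\epsilon}$ and $\mathcal P$ is, if $c>0$, a stereographic projection of $H(\mathbb Q^N_c)=\mathbb S^N$ onto $\mathbb R^N$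 and, if $c=0$, either the identity or an inversion of $\mathbb R^N$ with respect to a sphere of unit radius. (The image of $H\circ\Psi\circ(f_1\times\dots\times f_k)$ does not contain the pole of the projection or the center of the inversion.) (ii) For exactly one $j\in\{1,\dots,k\}$ there are $m$ with $1\le m\le N-1$, $c>0$, an extrinsic product of spheres $\Psi\colon\prod_{i\ne j}N_i\to\mathbb S^{N-m}(c)$, isometric immersions $f_j\colon M_j\to\mathbb H^m(-c)$ and $f_i\colon M_i\to N_i$ for $i\neq j$, and a standard conformal diffeomorphism $\Theta\colon\mathbb H^m(-c)\times\mathbb S^{N-m}(c)\to\mathbb R^N$, defined on the image of $f_j\times(\Psi\circ\prod_{i\ne j}f_i)$, such that $$f=\Theta\circ\Big(f_j\times\big(\Psi\circ\textstyle\prod_{i\neq j}f_i\big)\Big)\circ T_j,\qquad T_j(p_1,\dots,p_k)=\big(p_j,(p_i)_{i\ne j}\big).$$ -/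

import Mathlib

open scoped Manifold ContDiff

noncomputable section

/-- Euclidean space `ℝⁿ`. -/
abbrev Euc (n : ℕ) : Type := EuclideanSpace ℝ (Fin n)

/-- A smooth Riemannian metric on a manifold modelled on `ℝⁿ`. -/
abbrev RiemMetric (n : ℕ) (M : Type*) [TopologicalSpace M] [ChartedSpace (Euc n) M]
    [IsManifold (𝓡 n) ∞ M] :=
  Bundle.ContMDiffRiemannianMetric (𝓡 n) ∞ (Euc n) (fun p : M => TangentSpace (𝓡 n) p)

/-! ### Model spaces -/

/-- The Lorentz vector space `𝕃^{d+1} = ℝ^d × ℝ`, whose last coordinate is the time coordinate. -/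
abbrev Mink (d : ℕ) : Type := Euc d × ℝ

/-- The Lorentz product of signature `(+, …, +, -)`. -/
def lor {d : ℕ} (X Y : Mink d) : ℝ := inner ℝ X.1 Y.1 - X.2 * Y.2

/-- The sphere `𝕊^{d-1}(c) = {X ∈ ℝ^d : ⟨X, X⟩ = 1 / c}`. -/
def sphereCurv (d : ℕ) (c : ℝ) : Set (Euc d) := {X | inner ℝ X X = 1 / c}

/-- Hyperbolic space `ℍ^m(-c)`: one sheet of `{X ∈ 𝕃^{m+1} : ⟨X, X⟩ = -1 / c}`. -/
def hypCurv (m : ℕ) (c : ℝ) : Set (Mink m) := {X | lor X X = -1 / c ∧ 0 < X.2}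

/-! ### Isometric immersions -/

/-- `f : M → F` is an isometric immersion of the Riemannian manifold `(M, g)` into the vector space
`F` with the scalar product `B`. An isometric immersion into a submanifold `S` of `F` is such an `f`
with values in `S`. -/
def IsIsometricImmersion {n : ℕ} {M : Type*} [TopologicalSpace M] [ChartedSpace (Euc n) M]
    [IsManifold (𝓡 n) ∞ M] (g : RiemMetric n M)
    {F : Type*} [NormedAddCommGroup F] [NormedSpace ℝ F] (B : F → F → ℝ) (f : M → F) : Prop :=
  ContMDiff (𝓡 n) 𝓘(ℝ, F) ∞ f ∧
    ∀ (p : M) (u v : TangentSpace (𝓡 n) p),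
      B (mfderiv (𝓡 n) 𝓘(ℝ, F) f p u) (mfderiv (𝓡 n) 𝓘(ℝ, F) f p v) = g.inner p u v

/-! ### Conformal immersions of a Riemannian product and their second fundamental form -/

/-- The model of the product manifold `∏ i, M i`, where `M i` has dimension `n i`. The tangent space
at `p` of the product is `∏ i, T_{p i} (M i)`. -/
abbrev prodModel {k : ℕ} (n : Fin k → ℕ) :
    ModelWithCorners ℝ (∀ i, Euc (n i)) (ModelPi fun i => Euc (n i)) :=
  ModelWithCorners.pi fun i => 𝓡 (n i)

section Product

variable {k : ℕ} {n : Fin k → ℕ} {M : Fin k → Type*} [∀ i, TopologicalSpace (M i)]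
  [∀ i, ChartedSpace (Euc (n i)) (M i)]

/-- The differential of a map of the product manifold into `ℝ^N`. -/
def prodDeriv {N : ℕ} (f : (∀ i, M i) → Euc N) (p : ∀ i, M i) :
    (∀ i, TangentSpace (𝓡 (n i)) (p i)) →ₗ[ℝ] Euc N :=
  (mfderiv (prodModel n) 𝓘(ℝ, Euc N) f p :
    TangentSpace (prodModel n) p →L[ℝ] TangentSpace 𝓘(ℝ, Euc N) (f p)).toLinearMap

/-- The Riemannian product metric. -/
def prodMetric [∀ i, IsManifold (𝓡 (n i)) ∞ (M i)] (g : ∀ i, RiemMetric (n i) (M i))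
    (p : ∀ i, M i) (X Y : ∀ i, TangentSpace (𝓡 (n i)) (p i)) : ℝ :=
  ∑ i, (g i).inner (p i) (X i) (Y i)

/-- `f` is a conformal immersion of the Riemannian product `∏ i, (M i, g i)` into `ℝ^N`: the metric
it induces is `φ²` times the product metric, for a positive smooth conformal factor `φ`. -/
def IsConformalImmersion [∀ i, IsManifold (𝓡 (n i)) ∞ (M i)] (g : ∀ i, RiemMetric (n i) (M i))
    {N : ℕ} (f : (∀ i, M i) → Euc N) : Prop :=
  ContMDiff (prodModel n) 𝓘(ℝ, Euc N) ∞ f ∧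
    ∃ φ : (∀ i, M i) → ℝ, ContMDiff (prodModel n) 𝓘(ℝ, ℝ) ∞ φ ∧ (∀ p, 0 < φ p) ∧
      ∀ (p : ∀ i, M i) (X Y : ∀ i, TangentSpace (𝓡 (n i)) (p i)),
        inner ℝ (prodDeriv f p X) (prodDeriv f p Y) = φ p ^ 2 * prodMetric g p X Y

/-- The normal space of `f` at `p`. -/
def normalSpace {N : ℕ} (f : (∀ i, M i) → Euc N) (p : ∀ i, M i) : Submodule ℝ (Euc N) :=
  (LinearMap.range (prodDeriv (n := n) f p))ᗮ

/-- The second fundamental form of `f` at `p`: the normal component of the second derivative of `f`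
in the direction of the tangent vectors `X` and `Y`. The second derivative is taken in the chart at
`p`; that of another chart has the same normal component. -/
def secondFundamentalForm {N : ℕ} (f : (∀ i, M i) → Euc N) (p : ∀ i, M i)
    (X Y : ∀ i, TangentSpace (𝓡 (n i)) (p i)) : Euc N :=
  (normalSpace (n := n) f p).starProjection
    (fderiv ℝ (fderiv ℝ (f ∘ (extChartAt (prodModel n) p).symm)) (extChartAt (prodModel n) p p) X Y)

/-- The subspace `E_i(p)` of the product net: the vectors tangent to the `i`-th factor. -/
def productNet (p : ∀ i, M i) (i : Fin k) :
    Submodule ℝ (∀ i, TangentSpace (𝓡 (n i)) (p i)) where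
  carrier := {X | ∀ j, j ≠ i → X j = 0}
  add_mem' := fun {X Y} hX hY j hj => by simp [hX j hj, hY j hj]
  zero_mem' := fun _ _ => rfl
  smul_mem' := fun a X hX j hj => by simp [hX j hj]

/-- `Z = A_ξ X`, where `A_ξ` is the shape operator of `f` at `p` in the normal direction `ξ`, that
is, `⟨A_ξ X, Y⟩ = ⟨α(X, Y), ξ⟩` for all `Y`, in the metric induced by `f`. -/
def IsShapeOperatorValue {N : ℕ} (f : (∀ i, M i) → Euc N) (p : ∀ i, M i) (ξ : Euc N)
    (X Z : ∀ i, TangentSpace (𝓡 (n i)) (p i)) : Prop :=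
  ∀ Y : ∀ i, TangentSpace (𝓡 (n i)) (p i),
    inner ℝ (prodDeriv f p Z) (prodDeriv f p Y) = inner ℝ (secondFundamentalForm f p X Y) ξ

/-- The second fundamental form of `f` is adapted to the product net: every `E_i` is invariant under
all shape operators. -/
def IsAdaptedToProductNet {N : ℕ} (n : Fin k → ℕ) [∀ i, ChartedSpace (Euc (n i)) (M i)]
    (f : (∀ i, M i) → Euc N) : Prop :=
  ∀ (p : ∀ i, M i) (i : Fin k), ∀ ξ ∈ normalSpace (n := n) f p,
    ∀ X ∈ productNet (n := n) p i, ∃ Z ∈ productNet (n := n) p i, IsShapeOperatorValue f p ξ X Z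

end Product

/-! ### Extrinsic products -/

/-- An extrinsic product `Ψ : ∏ i, N i → ℝ^d`, `Ψ x = ∑ i, L i (x i) + v`. The orthogonal
decomposition of `ℝ^d` is given by isometric embeddings `L i : ℝ^{m i} → ℝ^d` with mutually
orthogonal images; the last summand, in which the constant vector `v` lies, is the orthogonal
complement of these images. Each `N i` is either `ℝ^{m i}` or a sphere in `ℝ^{m i}`, `m i ≥ 2`. -/
structure ExtrinsicProduct (ι : Type) (d : ℕ) where
  m : ι → ℕ
  L : ∀ i, Euc (m i) →ₗᵢ[ℝ] Euc d
  orth : ∀ i j, i ≠ j → ∀ x y, inner ℝ (L i x) (L j y) = 0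
  v : Euc d
  v_orth : ∀ i x, inner ℝ (L i x) v = 0
  N : ∀ i, Set (Euc (m i))
  N_eq : ∀ i, N i = Set.univ ∨ (2 ≤ m i ∧ ∃ c : ℝ, 0 < c ∧ N i = sphereCurv (m i) c)

/-- The map `Ψ`; only its values on `∏ i, N i` matter. -/
def ExtrinsicProduct.map {ι : Type} [Fintype ι] {d : ℕ} (Ψ : ExtrinsicProduct ι d)
    (x : ∀ i, Euc (Ψ.m i)) : Euc d :=
  ∑ i, Ψ.L i (x i) + Ψ.v

/-- `Ψ` is an extrinsic product of spheres with values in `𝕊^{d-1}(c)`. -/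
def ExtrinsicProduct.IsSpherical {ι : Type} [Fintype ι] {d : ℕ} (Ψ : ExtrinsicProduct ι d)
    (c : ℝ) : Prop :=
  (∀ i, 2 ≤ Ψ.m i ∧ ∃ c' : ℝ, 0 < c' ∧ Ψ.N i = sphereCurv (Ψ.m i) c') ∧
    ∀ x : ∀ i, Euc (Ψ.m i), (∀ i, x i ∈ Ψ.N i) → Ψ.map x ∈ sphereCurv d c

/-! ### Stereographic projections -/

/-- `P` is the stereographic projection of the unit sphere of `ℝ^{N+1}`, with pole `e`, onto a
hyperplane `{y : ⟨y, e⟩ = t}`, `t ≠ 1`, which is identified with `ℝ^N` by an affine isometry `J`.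
The image of `x ≠ e` is the point of the hyperplane on the line through `e` and `x`. -/
def IsStereographicProjection {N : ℕ} (e : Euc (N + 1)) (P : Euc (N + 1) → Euc N) : Prop :=
  ‖e‖ = 1 ∧ ∃ (t : ℝ) (J : Euc N →ᵃⁱ[ℝ] Euc (N + 1)), t ≠ 1 ∧
    Set.range J = {y | inner ℝ y e = t} ∧
    ∀ x : Euc (N + 1), ‖x‖ = 1 → x ≠ e →
      ∃ s : ℝ, J (P x) = AffineMap.lineMap e x s

/-! ### The conformal diffeomorphism `Θ` through the light cone -/

/-- A triple `(p₀, w, A)`: two light-like vectors of `𝕃^{N+2}` with `⟨p₀, w⟩ = 1` and a linear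
isometry `A` of `ℝ^N` onto the orthogonal complement of their span. -/
structure ConeTriple (N : ℕ) where
  p₀ : Mink (N + 1)
  w : Mink (N + 1)
  A : Euc N →ₗ[ℝ] Mink (N + 1)
  p₀_null : lor p₀ p₀ = 0
  w_null : lor w w = 0
  p₀_w : lor p₀ w = 1
  A_isom : ∀ x y, lor (A x) (A y) = inner ℝ x y
  A_p₀ : ∀ x, lor (A x) p₀ = 0
  A_w : ∀ x, lor (A x) w = 0

/-- The isometry `x ↦ p₀ + A x - ‖x‖² / 2 • w` of `ℝ^N` onto the umbilical hypersurface
`{p : ⟨p, p⟩ = 0, ⟨p, w⟩ = 1}` of the light cone. -/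
def ConeTriple.embed {N : ℕ} (τ : ConeTriple N) (x : Euc N) : Mink (N + 1) :=
  τ.p₀ + τ.A x - (‖x‖ ^ 2 / 2) • τ.w

/-- `Θ` is a standard conformal diffeomorphism `ℍ^m(-c) × 𝕊^l(c) → ℝ^N`, `m + l = N`. For an
orthogonal decomposition of `𝕃^{N+2}` given by linear isometries `C` of `𝕃^{m+1}` and `D` of
`ℝ^{l+1}` into `𝕃^{N+2}` with orthogonal images, `(X, Y) ↦ C X + D Y` takes values in the light
cone; `Θ` is its projection to `{p : ⟨p, p⟩ = 0, ⟨p, w⟩ = 1}`, followed by the identification of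
this hypersurface with `ℝ^N`. The set `dom` on which `Θ` is defined, where `⟨C X + D Y, w⟩ ≠ 0`, is
`ℍ^m(-c) × 𝕊^l(c)`, with at most one point removed (that is sent to infinity). -/
def IsTheta {N m l : ℕ} (c : ℝ) (dom : Set (Mink m × Euc (l + 1)))
    (Θ : Mink m × Euc (l + 1) → Euc N) : Prop :=
  ∃ (τ : ConeTriple N) (C : Mink m →ₗ[ℝ] Mink (N + 1)) (D : Euc (l + 1) →ₗ[ℝ] Mink (N + 1)),
    (∀ X X', lor (C X) (C X') = lor X X') ∧
    (∀ Y Y', lor (D Y) (D Y') = inner ℝ Y Y') ∧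
    (∀ X Y, lor (C X) (D Y) = 0) ∧
    dom = {Z | Z.1 ∈ hypCurv m c ∧ Z.2 ∈ sphereCurv (l + 1) c ∧ lor (C Z.1 + D Z.2) τ.w ≠ 0} ∧
    ∀ Z ∈ dom, τ.embed (Θ Z) = (lor (C Z.1 + D Z.2) τ.w)⁻¹ • (C Z.1 + D Z.2)

/-! ### The two cases of the classification -/

section Cases

variable {k N : ℕ} {n : Fin k → ℕ} {M : Fin k → Type*} [∀ i, TopologicalSpace (M i)]
  [∀ i, ChartedSpace (Euc (n i)) (M i)] [∀ i, IsManifold (𝓡 (n i)) ∞ (M i)]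

/-- `f = P ∘ H ∘ Ψ ∘ (f_1 × ⋯ × f_k)` with `Ψ : ∏ i, N i → 𝕊^N(c) ⊆ ℝ^{N+1}` an extrinsic product of
spheres, `f_i : M_i → N_i` isometric immersions, `H` a homothety of `ℝ^{N+1}` that takes `𝕊^N(c)` to
the unit sphere and `P` a stereographic projection of the unit sphere. -/
def CaseSphere (g : ∀ i, RiemMetric (n i) (M i)) (f : (∀ i, M i) → Euc N) : Prop :=
  ∃ (c : ℝ) (Ψ : ExtrinsicProduct (Fin k) (N + 1)) (h : ∀ i, M i → Euc (Ψ.m i))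
    (a : Euc (N + 1)) (r : ℝ) (e : Euc (N + 1)) (P : Euc (N + 1) → Euc N),
    0 < c ∧ Ψ.IsSpherical c ∧
    (∀ i, IsIsometricImmersion (g i) (inner ℝ) (h i) ∧ ∀ q, h i q ∈ Ψ.N i) ∧
    0 < r ∧ AffineMap.homothety a r '' sphereCurv (N + 1) c = Metric.sphere 0 1 ∧
    IsStereographicProjection e P ∧
    ∀ p, AffineMap.homothety a r (Ψ.map fun i => h i (p i)) ≠ e ∧
      f p = P (AffineMap.homothety a r (Ψ.map fun i => h i (p i)))

/-- `f = P ∘ H ∘ Ψ ∘ (f_1 × ⋯ × f_k)` with `Ψ : ∏ i, N i → ℝ^N` an extrinsic product,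
`f_i : M_i → N_i` isometric immersions, `H` a homothety of `ℝ^N` and `P` either the identity or the
inversion in a sphere of unit radius, with center `q`. -/
def CaseFlat (g : ∀ i, RiemMetric (n i) (M i)) (f : (∀ i, M i) → Euc N) : Prop :=
  ∃ (Ψ : ExtrinsicProduct (Fin k) N) (h : ∀ i, M i → Euc (Ψ.m i)) (a : Euc N) (r : ℝ),
    (∀ i, IsIsometricImmersion (g i) (inner ℝ) (h i) ∧ ∀ q, h i q ∈ Ψ.N i) ∧
    0 < r ∧
    ((∀ p, f p = AffineMap.homothety a r (Ψ.map fun i => h i (p i))) ∨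
      ∃ q : Euc N, ∀ p, AffineMap.homothety a r (Ψ.map fun i => h i (p i)) ≠ q ∧
        f p = EuclideanGeometry.inversion q 1
          (AffineMap.homothety a r (Ψ.map fun i => h i (p i))))

/-- `f = Θ ∘ (f_j × (Ψ ∘ (f_1 × ⋯ × f̂_j × ⋯ × f_k))) ∘ T_j` with `f_j : M_j → ℍ^m(-c)` and
`f_i : M_i → N_i`, `i ≠ j`, isometric immersions, `Ψ : ∏_{i ≠ j} N_i → 𝕊^l(c)`, `l = N - m`, an
extrinsic product of spheres and `Θ : ℍ^m(-c) × 𝕊^l(c) → ℝ^N` a standard conformal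
diffeomorphism. -/
def CaseTheta (g : ∀ i, RiemMetric (n i) (M i)) (f : (∀ i, M i) → Euc N) (j : Fin k) : Prop :=
  ∃ (m l : ℕ) (c : ℝ) (Ψ : ExtrinsicProduct {i : Fin k // i ≠ j} (l + 1))
    (hj : M j → Mink m) (h : ∀ i : {i : Fin k // i ≠ j}, M i → Euc (Ψ.m i))
    (dom : Set (Mink m × Euc (l + 1))) (Θ : Mink m × Euc (l + 1) → Euc N),
    1 ≤ m ∧ 1 ≤ l ∧ m + l = N ∧ 0 < c ∧ Ψ.IsSpherical c ∧
    (IsIsometricImmersion (g j) lor hj ∧ ∀ q, hj q ∈ hypCurv m c) ∧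
    (∀ i : {i : Fin k // i ≠ j},
      IsIsometricImmersion (g i) (inner ℝ) (h i) ∧ ∀ q, h i q ∈ Ψ.N i) ∧
    IsTheta c dom Θ ∧
    ∀ p, (hj (p j), Ψ.map fun i => h i (p i)) ∈ dom ∧
      f p = Θ (hj (p j), Ψ.map fun i => h i (p i))

end Cases

end

/-
Lift `f`, with conformal factor `φ`, to the light cone of `𝕃^{N+2}` by `F = φ⁻¹ • E ∘ f`. This is an
isometric immersion of the Riemannian product into a vector space with a scalar product, and
adaptedness of `f` says that a mixed second derivative of `F` is the sum of a multiple of `F` and a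
tangent vector. With a third direction at hand, the symmetry of the third derivatives forces all
mixed second derivatives to vanish. As the factors are connected, `F p = F o + ∑ i, G i (p i)` with
isometric immersions `G i` of the factors into mutually orthogonal subspaces `V i` of `𝕃^{N+2}`.

If all `V i` are space-like, some time-like vector is orthogonal to all of them and `F` takes values
in an affine section of the light cone that is a sphere. If no `V i` is time-like but `V j` is
degenerate, the light-like vector of its radical is orthogonal to all `V i`, so that the section is
a Euclidean space. If `V j` is time-like, its orthogonal complement contains the other `V i`, and
`F` is the sum of a map into a hyperbolic space in `V j` and a map into a sphere in the complement.
In this case `j` is unique: an isometric lift of `f` is determined up to sign and a Lorentz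
isometry, and in case (ii) the factors other than the hyperbolic one span space-like subspaces.
-/

open Filter Topology

section LocalSplitting

variable {V L : Type*} [NormedAddCommGroup V] [NormedSpace ℝ V]
  [NormedAddCommGroup L] [NormedSpace ℝ L]

theorem hasFDerivAt_fderiv_apply {U : V → L} {y : V} (hU : ContDiffAt ℝ 2 U y) (a : V) :
    HasFDerivAt (fun z => fderiv ℝ U z a) ((fderiv ℝ (fderiv ℝ U) y).flip a) y := by
  have h : DifferentiableAt ℝ (fderiv ℝ U) y :=
    (hU.fderiv_right (m := 1) (by norm_num)).differentiableAt (by norm_num)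
  simpa using h.hasFDerivAt.clm_apply (hasFDerivAt_const a y)

theorem hasFDerivAt_fderiv_fderiv_apply {U : V → L} {y : V} (hU : ContDiffAt ℝ 3 U y) (a b : V) :
    HasFDerivAt (fun z => fderiv ℝ (fderiv ℝ U) z a b)
      (((fderiv ℝ (fderiv ℝ (fderiv ℝ U)) y).flip a).flip b) y := by
  have h : ContDiffAt ℝ 2 (fderiv ℝ U) y := hU.fderiv_right (by norm_num)
  simpa using (hasFDerivAt_fderiv_apply h a).clm_apply (hasFDerivAt_const b y)

theorem fderiv_fderiv_comm {U : V → L} {y : V} (hU : ContDiffAt ℝ 2 U y) (a b : V) :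
    fderiv ℝ (fderiv ℝ U) y a b = fderiv ℝ (fderiv ℝ U) y b a :=
  (hU.isSymmSndFDerivAt (by simp)) a b

theorem fderiv_apply_eq_zero_of_eventually_const {K : V → L} {y v : V}
    (h : ∀ᶠ t : ℝ in 𝓝 0, K (y + t • v) = K y) : fderiv ℝ K y v = 0 := by
  by_cases hK : DifferentiableAt ℝ K y
  · have hline : HasDerivAt (fun t : ℝ => K (y + t • v)) (fderiv ℝ K y v) 0 := by
      simpa [HasLineDerivAt] using hK.hasFDerivAt.hasLineDerivAt v
    exact hline.unique ((hasDerivAt_const (0 : ℝ) (K y)).congr_of_eventuallyEq h)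
  · rw [fderiv_zero_of_not_differentiableAt hK, zero_apply]

variable {B : L →L[ℝ] L →L[ℝ] ℝ}

theorem bilin_leibniz_eq_zero {P Q : V → L} {P' Q' : V →L[ℝ] L} {y : V}
    (hP : HasFDerivAt P P' y) (hQ : HasFDerivAt Q Q' y)
    (h : ∀ᶠ z in 𝓝 y, B (P z) (Q z) = 0) (v : V) : B (P y) (Q' v) + B (P' v) (Q y) = 0 := by
  have hconst : HasFDerivAt (fun z => B (P z) (Q z)) (0 : V →L[ℝ] ℝ) y :=
    (hasFDerivAt_const (0 : ℝ) y).congr_of_eventuallyEq h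
  simpa using DFunLike.congr_fun ((B.hasFDerivAt_of_bilinear hP hQ).unique hconst) v

theorem fderiv_bilin_fderiv_fderiv {U : V → L} {y : V} (hU : ContDiffAt ℝ 2 U y) (a b v : V) :
    fderiv ℝ (fun z => B (fderiv ℝ U z a) (fderiv ℝ U z b)) y v =
      B (fderiv ℝ U y a) (fderiv ℝ (fderiv ℝ U) y v b) +
        B (fderiv ℝ (fderiv ℝ U) y v a) (fderiv ℝ U y b) := by
  rw [(B.hasFDerivAt_of_bilinear (hasFDerivAt_fderiv_apply hU a)
    (hasFDerivAt_fderiv_apply hU b)).fderiv]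
  simp

theorem koszul_eq_zero (hB : ∀ x y, B x y = B y x) {U : V → L} {y : V}
    (hU : ContDiffAt ℝ 2 U y) {a b d : V}
    (ha : fderiv ℝ (fun z => B (fderiv ℝ U z b) (fderiv ℝ U z d)) y a = 0)
    (hb : fderiv ℝ (fun z => B (fderiv ℝ U z a) (fderiv ℝ U z d)) y b = 0)
    (hd : fderiv ℝ (fun z => B (fderiv ℝ U z a) (fderiv ℝ U z b)) y d = 0) :
    B (fderiv ℝ (fderiv ℝ U) y a b) (fderiv ℝ U y d) = 0 := by
  rw [fderiv_bilin_fderiv_fderiv hU] at ha hb hd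
  have hsymm := fderiv_fderiv_comm hU
  rw [hsymm b a] at hb
  rw [hsymm d b, hsymm d a, hB _ (fderiv ℝ U y b)] at hd
  linarith

theorem bilin_fderiv_eq_zero_of_null (hB : ∀ x y, B x y = B y x) {U : V → L} {y : V}
    (hU : DifferentiableAt ℝ U y) (null : ∀ᶠ z in 𝓝 y, B (U z) (U z) = 0) (v : V) :
    B (U y) (fderiv ℝ U y v) = 0 := by
  have h := bilin_leibniz_eq_zero hU.hasFDerivAt hU.hasFDerivAt null v
  rw [hB (fderiv ℝ U y v)] at h
  linarith

theorem bilin_fderiv_fderiv_of_null (hB : ∀ x y, B x y = B y x) {U : V → L} {y : V}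
    (hU : ContDiffAt ℝ 2 U y) (null : ∀ᶠ z in 𝓝 y, B (U z) (U z) = 0) (v w : V) :
    B (U y) (fderiv ℝ (fderiv ℝ U) y v w) = -B (fderiv ℝ U y v) (fderiv ℝ U y w) := by
  have horth : ∀ᶠ z in 𝓝 y, B (U z) (fderiv ℝ U z w) = 0 := by
    filter_upwards [null.eventually_nhds, hU.eventually (by simp)] with z hz hUz
    exact bilin_fderiv_eq_zero_of_null hB (hUz.differentiableAt (by norm_num)) hz w
  have h := bilin_leibniz_eq_zero (hU.differentiableAt (by norm_num)).hasFDerivAt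
    (hasFDerivAt_fderiv_apply hU w) horth v
  rw [ContinuousLinearMap.flip_apply] at h
  linarith

variable {ι : Type*} {E : ι → Type*} [∀ i, NormedAddCommGroup (E i)]
  [∀ i, NormedSpace ℝ (E i)] [DecidableEq ι]

/-- The form that `U` pulls back from `B` is, near `c`, a product metric: different factors are
orthogonal, and the form on the `i`-th factor depends only on the `i`-th coordinate. -/
structure InducesProductMetricAt (B : L →L[ℝ] L →L[ℝ] ℝ) (U : (∀ i, E i) → L) (c : ∀ i, E i) :
    Prop where
  orth : ∀ᶠ y in 𝓝 c, ∀ i j, i ≠ j → ∀ a b,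
    B (fderiv ℝ U y (Pi.single i a)) (fderiv ℝ U y (Pi.single j b)) = 0
  diag : ∀ i, ∃ h : E i → E i → E i → ℝ, ∀ᶠ y in 𝓝 c, ∀ a b,
    B (fderiv ℝ U y (Pi.single i a)) (fderiv ℝ U y (Pi.single i b)) = h (y i) a b

namespace InducesProductMetricAt

variable {U : (∀ i, E i) → L} {c : ∀ i, E i} (h : InducesProductMetricAt B U c)
include h

theorem eventually_nhds [Finite ι] : ∀ᶠ y in 𝓝 c, InducesProductMetricAt B U y := by
  choose H hH using h.diag
  filter_upwards [h.orth.eventually_nhds, (eventually_all.2 hH).eventually_nhds] with y ho hd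
  exact ⟨ho, fun i => ⟨H i, hd.mono fun z hz => hz i⟩⟩

theorem fderiv_metric_eq_zero [Finite ι] {p q r : ι} (hpqr : p ≠ q ∨ r ≠ p) (x : E p) (y : E q)
    (z : E r) :
    fderiv ℝ (fun w => B (fderiv ℝ U w (Pi.single p x)) (fderiv ℝ U w (Pi.single q y))) c
      (Pi.single r z) = 0 := by
  cases nonempty_fintype ι
  have htendsto : Tendsto (fun t : ℝ => c + t • Pi.single r z) (𝓝 0) (𝓝 c) := by
    have hcont : Continuous fun t : ℝ => c + t • Pi.single r z := by fun_prop
    simpa using hcont.tendsto 0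
  apply fderiv_apply_eq_zero_of_eventually_const
  by_cases hpq : p = q
  · subst hpq
    have hrp : p ≠ r := by tauto
    obtain ⟨H, hH⟩ := h.diag p
    filter_upwards [htendsto.eventually hH] with t ht
    simp only [ht, hH.self_of_nhds, Pi.add_apply, Pi.smul_apply, Pi.single_eq_of_ne hrp,
      smul_zero, add_zero]
  · filter_upwards [htendsto.eventually h.orth] with t ht
    rw [ht p q hpq, h.orth.self_of_nhds p q hpq]

variable [Fintype ι] (hB : ∀ x y, B x y = B y x)
include hB

theorem bilin_mixed_fderiv_tangent (hU : ContDiffAt ℝ 2 U c) {i j : ι} (hij : i ≠ j) (a : E i)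
    (b : E j) (d : ∀ i, E i) :
    B (fderiv ℝ (fderiv ℝ U) c (Pi.single i a) (Pi.single j b)) (fderiv ℝ U c d) = 0 := by
  rw [← Finset.univ_sum_single d, map_sum, map_sum]
  refine Finset.sum_eq_zero fun l _ => koszul_eq_zero hB hU ?_ ?_ ?_
  · exact h.fderiv_metric_eq_zero (Or.inr hij) _ _ _
  · exact h.fderiv_metric_eq_zero (Or.inr hij.symm) _ _ _
  · exact h.fderiv_metric_eq_zero (Or.inl hij) _ _ _

theorem bilin_third_fderiv_tangent (hU : ContDiffAt ℝ 3 U c) {i j : ι} (hij : i ≠ j) (a : E i)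
    (b : E j) (e d : ∀ i, E i) :
    B (fderiv ℝ (fderiv ℝ (fderiv ℝ U)) c e (Pi.single i a) (Pi.single j b)) (fderiv ℝ U c d) =
      -B (fderiv ℝ (fderiv ℝ U) c (Pi.single i a) (Pi.single j b))
        (fderiv ℝ (fderiv ℝ U) c e d) := by
  have hU2 : ContDiffAt ℝ 2 U c := hU.of_le (by norm_num)
  have horth : ∀ᶠ y in 𝓝 c,
      B (fderiv ℝ (fderiv ℝ U) y (Pi.single i a) (Pi.single j b)) (fderiv ℝ U y d) = 0 := by
    filter_upwards [h.eventually_nhds, hU2.eventually (by simp)] with y hy hUy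
    exact hy.bilin_mixed_fderiv_tangent hB hUy hij a b d
  have hleibniz := bilin_leibniz_eq_zero (hasFDerivAt_fderiv_fderiv_apply hU _ _)
    (hasFDerivAt_fderiv_apply hU2 d) horth e
  simp only [ContinuousLinearMap.flip_apply] at hleibniz
  linarith

variable (null : ∀ᶠ y in 𝓝 c, B (U y) (U y) = 0)
  (pos : ∀ v, v ≠ 0 → 0 < B (fderiv ℝ U c v) (fderiv ℝ U c v))
  (mix : ∀ i j, i ≠ j → ∀ (a : E i) (b : E j), ∃ (s : ℝ) (Z : ∀ i, E i),
    fderiv ℝ (fderiv ℝ U) c (Pi.single i a) (Pi.single j b) = s • U c + fderiv ℝ U c Z)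
include null pos mix

theorem exists_mixed_fderiv_eq_smul (hU : ContDiffAt ℝ 2 U c) {i j : ι} (hij : i ≠ j) (a : E i)
    (b : E j) :
    ∃ s : ℝ, fderiv ℝ (fderiv ℝ U) c (Pi.single i a) (Pi.single j b) = s • U c := by
  obtain ⟨s, Z, hZ⟩ := mix i j hij a b
  have horth := h.bilin_mixed_fderiv_tangent hB hU hij a b Z
  simp only [hZ, map_add, map_smul, add_apply, smul_apply,
    bilin_fderiv_eq_zero_of_null hB (hU.differentiableAt (by norm_num)) null, smul_zero,
    zero_add] at horth
  have hZ0 : Z = 0 := by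
    by_contra hne
    exact (pos Z hne).ne' horth
  exact ⟨s, by rw [hZ, hZ0, map_zero, add_zero]⟩

/-- With `∂ₐ∂_b U = s U` and `∂ₑ∂_b U = t U`, symmetry of the third derivative in the form
`⟨∂ₑ∂ₐ∂_b U, ∂ₑ U⟩ = ⟨∂ₐ∂ₑ∂_b U, ∂ₑ U⟩` reads `s ⟨∂ₑ U, ∂ₑ U⟩ = t ⟨∂ₐ U, ∂ₑ U⟩`. -/
theorem mixed_fderiv_eq_zero_of_orthogonal (hU : ContDiffAt ℝ 3 U c) {i l j : ι} (hij : i ≠ j)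
    (hlj : l ≠ j) (a : E i) (b : E j) {e : E l} (he : e ≠ 0)
    (hae : B (fderiv ℝ U c (Pi.single i a)) (fderiv ℝ U c (Pi.single l e)) = 0) :
    fderiv ℝ (fderiv ℝ U) c (Pi.single i a) (Pi.single j b) = 0 := by
  have hU2 : ContDiffAt ℝ 2 U c := hU.of_le (by norm_num)
  have hU' : ContDiffAt ℝ 2 (fderiv ℝ U) c := hU.fderiv_right (by norm_num)
  obtain ⟨s, hs⟩ := h.exists_mixed_fderiv_eq_smul hB null pos mix hU2 hij a b
  obtain ⟨t, ht⟩ := h.exists_mixed_fderiv_eq_smul hB null pos mix hU2 hlj e b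
  have hthird := h.bilin_third_fderiv_tangent hB hU hij a b (Pi.single l e) (Pi.single l e)
  rw [fderiv_fderiv_comm hU', h.bilin_third_fderiv_tangent hB hU hlj e b, hs, ht] at hthird
  simp only [map_smul, smul_apply, bilin_fderiv_fderiv_of_null hB hU2 null, hae, smul_eq_mul,
    neg_zero, mul_zero] at hthird
  have hpos := pos (Pi.single l e) (by simpa using he)
  have hs0 : s = 0 := by
    refine (mul_eq_zero.1 (?_ : s * B (fderiv ℝ U c (Pi.single l e))
      (fderiv ℝ U c (Pi.single l e)) = 0)).resolve_right hpos.ne'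
    linarith
  rw [hs, hs0, zero_smul]

theorem mixed_fderiv_eq_zero (hU : ContDiffAt ℝ 3 U c) {i j : ι} (hij : i ≠ j)
    (dim : (∃ l, l ≠ i ∧ l ≠ j ∧ Nontrivial (E l)) ∨
      (∀ a : E i, ∃ e : E i, e ≠ 0 ∧
        B (fderiv ℝ U c (Pi.single i a)) (fderiv ℝ U c (Pi.single i e)) = 0) ∨
      (∀ a : E j, ∃ e : E j, e ≠ 0 ∧
        B (fderiv ℝ U c (Pi.single j a)) (fderiv ℝ U c (Pi.single j e)) = 0))
    (a : E i) (b : E j) :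
    fderiv ℝ (fderiv ℝ U) c (Pi.single i a) (Pi.single j b) = 0 := by
  rcases dim with ⟨l, hli, hlj, hl⟩ | hi | hj
  · obtain ⟨e, he⟩ := exists_ne (0 : E l)
    exact h.mixed_fderiv_eq_zero_of_orthogonal hB null pos mix hU hij hlj a b he
      (h.orth.self_of_nhds i l hli.symm a e)
  · obtain ⟨e, he, hae⟩ := hi a
    exact h.mixed_fderiv_eq_zero_of_orthogonal hB null pos mix hU hij hij a b he hae
  · obtain ⟨e, he, hbe⟩ := hj b
    rw [fderiv_fderiv_comm (hU.of_le (by norm_num))]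
    exact h.mixed_fderiv_eq_zero_of_orthogonal hB null pos mix hU hij.symm hij.symm b a he hbe

end InducesProductMetricAt

end LocalSplitting

section Charts

variable {V : Type*} [NormedAddCommGroup V] [NormedSpace ℝ V]

theorem eq_of_hasMFDerivAt_zero {E H M : Type*} [NormedAddCommGroup E] [NormedSpace ℝ E]
    [TopologicalSpace H] {I : ModelWithCorners ℝ E H} [I.Boundaryless] [TopologicalSpace M]
    [ChartedSpace H M] [IsManifold I 1 M] [PreconnectedSpace M] {g : M → V}
    (hg : ∀ x, HasMFDerivAt I 𝓘(ℝ, V) g x 0) (x y : M) : g x = g y := by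
  suffices h : IsLocallyConstant g from
    h.apply_eq_of_isPreconnected isPreconnected_univ trivial trivial
  rw [IsLocallyConstant.iff_eventually_eq]
  intro x
  set e := extChartAt I x
  have hopen : IsOpen e.target := isOpen_extChartAt_target x
  obtain ⟨r, hr, hball⟩ := Metric.isOpen_iff.1 hopen (e x) (mem_extChartAt_target x)
  have hder : ∀ z ∈ Metric.ball (e x) r, HasFDerivAt (g ∘ e.symm) (0 : E →L[ℝ] V) z := by
    intro z hz
    have hsymm : MDifferentiableAt 𝓘(ℝ, E) I e.symm z :=
      ((contMDiffOn_extChartAt_symm (n := 1) x).contMDiffAt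
        (hopen.mem_nhds (hball hz))).mdifferentiableAt one_ne_zero
    have hcomp := (hg (e.symm z)).comp z hsymm.hasMFDerivAt
    rw [hasMFDerivAt_iff_hasFDerivAt] at hcomp
    exact HasFDerivAt.congr_fderiv hcomp (ContinuousLinearMap.zero_comp _)
  have hconst : ∀ z ∈ Metric.ball (e x) r, (g ∘ e.symm) z = (g ∘ e.symm) (e x) := fun z hz =>
    Metric.isOpen_ball.is_const_of_fderiv_eq_zero (𝕜 := ℝ) (convex_ball (e x) r).isPreconnected
      (fun w hw => (hder w hw).differentiableAt.differentiableWithinAt)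
      (fun w hw => (hder w hw).fderiv) hz (Metric.mem_ball_self hr)
  filter_upwards [continuousAt_extChartAt (I := I) x (Metric.ball_mem_nhds (e x) hr),
    extChartAt_source_mem_nhds (I := I) x] with y hy hys
  simpa only [Function.comp, e.left_inv hys, e.left_inv (mem_extChartAt_source x)]
    using hconst (e y) hy

variable {n : ℕ} {M : Type*} [TopologicalSpace M] [ChartedSpace (Euc n) M]

theorem mdifferentiableAt_extChartAt_symm [IsManifold (𝓡 n) ∞ M] {x : M} {z : Euc n}
    (hz : z ∈ (extChartAt (𝓡 n) x).target) :
    MDifferentiableAt 𝓘(ℝ, Euc n) (𝓡 n) (extChartAt (𝓡 n) x).symm z :=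
  ((contMDiffOn_extChartAt_symm (n := ∞) x).contMDiffAt
    ((isOpen_extChartAt_target x).mem_nhds hz)).mdifferentiableAt (by simp)

theorem hasMFDerivAt_comp_extChartAt_zero {K : Euc n → V} {x : M}
    (hK : HasFDerivAt K (0 : Euc n →L[ℝ] V) (extChartAt (𝓡 n) x x)) :
    HasMFDerivAt (𝓡 n) 𝓘(ℝ, V) (K ∘ extChartAt (𝓡 n) x) x 0 := by
  have hchart : MDifferentiableAt (𝓡 n) 𝓘(ℝ, Euc n) (extChartAt (𝓡 n) x) x :=
    (contMDiffAt_extChartAt (n := ∞)).mdifferentiableAt (by simp)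
  exact (HasMFDerivAt.comp x hK.hasMFDerivAt hchart.hasMFDerivAt).congr_mfderiv
    (ContinuousLinearMap.zero_comp _)

/-- The differential of `g` at `x`, computed in the preferred chart at `x`; the tangent space at `x`
is identified with `ℝⁿ` by this chart. -/
noncomputable def chartDeriv (n : ℕ) [ChartedSpace (Euc n) M] (g : M → V) (x : M) :
    Euc n →L[ℝ] V :=
  fderiv ℝ (g ∘ (extChartAt (𝓡 n) x).symm) (extChartAt (𝓡 n) x x)

theorem chartDeriv_eq {g : M → V} {x : M} {D : Euc n →L[ℝ] V}
    (hg : HasMFDerivAt (𝓡 n) 𝓘(ℝ, V) g x D) : chartDeriv n g x = D := by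
  have h : HasFDerivWithinAt (g ∘ (extChartAt (𝓡 n) x).symm) D (Set.range (𝓡 n))
      (extChartAt (𝓡 n) x x) := hg.2
  rw [ModelWithCorners.range_eq_univ, hasFDerivWithinAt_univ] at h
  exact h.fderiv

theorem hasMFDerivAt_chartDeriv {g : M → V} {x : M} (hg : MDifferentiableAt (𝓡 n) 𝓘(ℝ, V) g x) :
    HasMFDerivAt (𝓡 n) 𝓘(ℝ, V) g x (chartDeriv (V := V) n g x) := by
  rw [chartDeriv_eq (D := show Euc n →L[ℝ] V from mfderiv (𝓡 n) 𝓘(ℝ, V) g x) hg.hasMFDerivAt]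
  exact hg.hasMFDerivAt

theorem mfderiv_apply_eq_chartDeriv {g : M → V} {x : M}
    (hg : MDifferentiableAt (𝓡 n) 𝓘(ℝ, V) g x) (X : TangentSpace (𝓡 n) x) :
    mfderiv (𝓡 n) 𝓘(ℝ, V) g x X = chartDeriv n g x X :=
  congrArg (fun D : Euc n →L[ℝ] V => D X) (hasMFDerivAt_chartDeriv hg).mfderiv

/-- The differential at `z` of the inverse of the preferred chart at `x`. It takes coordinate
vectors to tangent vectors, which are identified with `ℝⁿ` by the preferred chart at their
foot. -/
noncomputable def chartFrame (n : ℕ) [ChartedSpace (Euc n) M] (x : M) (z : Euc n) :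
    Euc n →L[ℝ] Euc n :=
  show Euc n →L[ℝ] Euc n from mfderiv 𝓘(ℝ, Euc n) (𝓡 n) (extChartAt (𝓡 n) x).symm z

theorem fderiv_comp_extChartAt_symm [IsManifold (𝓡 n) ∞ M] {G : M → V} {x : M} {z : Euc n}
    (hz : z ∈ (extChartAt (𝓡 n) x).target)
    (hG : MDifferentiableAt (𝓡 n) 𝓘(ℝ, V) G ((extChartAt (𝓡 n) x).symm z)) :
    fderiv ℝ (G ∘ (extChartAt (𝓡 n) x).symm) z =
      (chartDeriv n G ((extChartAt (𝓡 n) x).symm z)).comp (chartFrame n x z) := by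
  have h := HasMFDerivAt.comp z (hasMFDerivAt_chartDeriv hG)
    (mdifferentiableAt_extChartAt_symm hz).hasMFDerivAt
  rw [hasMFDerivAt_iff_hasFDerivAt] at h
  exact HasFDerivAt.fderiv h

end Charts

section ProductCharts

theorem hasFDerivAt_comp_update {ι : Type*} [Finite ι] [DecidableEq ι] {E : ι → Type*}
    [∀ i, NormedAddCommGroup (E i)] [∀ i, NormedSpace ℝ (E i)] {V : Type*} [NormedAddCommGroup V]
    [NormedSpace ℝ V] {G : (∀ i, E i) → V} {y : ∀ i, E i} (hG : DifferentiableAt ℝ G y) (i : ι) :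
    HasFDerivAt (G ∘ Function.update y i)
      ((fderiv ℝ G y).comp (ContinuousLinearMap.single ℝ E i)) (y i) := by
  cases nonempty_fintype ι
  have hupdate : HasFDerivAt (Function.update y i) (ContinuousLinearMap.single ℝ E i) (y i) := by
    refine (hasFDerivAt_update y (y i)).congr_fderiv (ContinuousLinearMap.ext fun v => ?_)
    ext j
    by_cases h : j = i
    · subst h; simp
    · simp [h]
  refine HasFDerivAt.comp (y i) ?_ hupdate
  rw [Function.update_eq_self]
  exact hG.hasFDerivAt

section Slice

variable {ι : Type*} [DecidableEq ι] {M : ι → Type*} {V : Type*}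

/-- The restriction of a map of a product to the `i`-th factor through `p`. -/
def slice (F : (∀ i, M i) → V) (p : ∀ i, M i) (i : ι) : M i → V :=
  fun x => F (Function.update p i x)

theorem slice_self (F : (∀ i, M i) → V) (p : ∀ i, M i) (i : ι) : slice F p i (p i) = F p := by
  rw [slice, Function.update_eq_self]

theorem slice_update (F : (∀ i, M i) → V) (p : ∀ i, M i) (i : ι) (x : M i) :
    slice F (Function.update p i x) i = slice F p i := by
  funext y
  simp [slice]

end Slice

variable {k : ℕ} {n : Fin k → ℕ} {M : Fin k → Type*} [∀ i, TopologicalSpace (M i)]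
  [∀ i, ChartedSpace (Euc (n i)) (M i)] {V : Type*}

/-- The inverse of the product of the preferred charts at the components of `p`. -/
noncomputable def coordMap (p : ∀ i, M i) (y : ∀ i, Euc (n i)) : ∀ i, M i :=
  fun i => (extChartAt (𝓡 (n i)) (p i)).symm (y i)

/-- The coordinates of `p` in the product of the preferred charts at its components. -/
noncomputable def coordCenter (p : ∀ i, M i) : ∀ i, Euc (n i) :=
  fun i => extChartAt (𝓡 (n i)) (p i) (p i)

theorem coordMap_coordCenter (p : ∀ i, M i) : coordMap (n := n) p (coordCenter p) = p :=
  funext fun i => extChartAt_to_inv (p i)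

theorem coordMap_update (p : ∀ i, M i) (y : ∀ i, Euc (n i)) (i : Fin k) (t : Euc (n i)) :
    coordMap p (Function.update y i t) =
      Function.update (coordMap p y) i ((extChartAt (𝓡 (n i)) (p i)).symm t) := by
  funext j
  by_cases h : j = i
  · subst h; simp [coordMap]
  · simp [coordMap, h]

theorem coordMap_update_coordCenter {p : ∀ i, M i} {i : Fin k} {x : M i}
    (hx : x ∈ (extChartAt (𝓡 (n i)) (p i)).source) :
    coordMap p (Function.update (coordCenter (n := n) p) i (extChartAt (𝓡 (n i)) (p i) x)) =
      Function.update p i x := by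
  rw [coordMap_update, coordMap_coordCenter, (extChartAt (𝓡 (n i)) (p i)).left_inv hx]

theorem eventually_mem_extChartAt_target (p : ∀ i, M i) :
    ∀ᶠ y in 𝓝 (coordCenter (n := n) p), ∀ i, y i ∈ (extChartAt (𝓡 (n i)) (p i)).target :=
  eventually_all.2 fun i =>
    (continuous_apply i).continuousAt.eventually (extChartAt_target_mem_nhds (p i))

theorem slice_comp_extChartAt_symm (F : (∀ i, M i) → V) (p : ∀ i, M i) (y : ∀ i, Euc (n i))
    (i : Fin k) :
    slice F (coordMap p y) i ∘ (extChartAt (𝓡 (n i)) (p i)).symm =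
      (F ∘ coordMap p) ∘ Function.update y i := by
  funext t
  simp only [slice, Function.comp, coordMap_update]

variable [NormedAddCommGroup V] [NormedSpace ℝ V]

/-- Smoothness at the centres of the product charts. -/
def SmoothInCharts (n : Fin k → ℕ) [∀ i, ChartedSpace (Euc (n i)) (M i)]
    (F : (∀ i, M i) → V) : Prop :=
  ∀ p, ContDiffAt ℝ ∞ (F ∘ coordMap (n := n) p) (coordCenter p)

theorem range_prodModel : Set.range (prodModel n) = Set.univ :=
  Set.range_eq_univ.2 fun y => ⟨y, rfl⟩

theorem smoothInCharts_of_contMDiff {F : (∀ i, M i) → V}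
    (hF : ContMDiff (prodModel n) 𝓘(ℝ, V) ∞ F) : SmoothInCharts n F := by
  intro p
  have h := (contMDiffAt_iff.1 (hF p)).2
  rw [range_prodModel, contDiffWithinAt_univ] at h
  exact h

theorem SmoothInCharts.eventually_differentiableAt {F : (∀ i, M i) → V} (hF : SmoothInCharts n F)
    (p : ∀ i, M i) :
    ∀ᶠ y in 𝓝 (coordCenter p), DifferentiableAt ℝ (F ∘ coordMap (n := n) p) y := by
  have hF2 : ContDiffAt ℝ 2 (F ∘ coordMap (n := n) p) (coordCenter p) :=
    contDiffAt_infty.1 (hF p) 2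
  exact (hF2.eventually (by simp)).mono fun z hz => hz.differentiableAt (by norm_num)

theorem prodDeriv_apply {N : ℕ} {f : (∀ i, M i) → Euc N}
    (hf : ContMDiff (prodModel n) 𝓘(ℝ, Euc N) ∞ f) (p : ∀ i, M i)
    (X : ∀ i, TangentSpace (𝓡 (n i)) (p i)) :
    prodDeriv f p X = fderiv ℝ (f ∘ coordMap (n := n) p) (coordCenter p) X := by
  have h : HasFDerivWithinAt (f ∘ coordMap (n := n) p)
      (show (∀ i, Euc (n i)) →L[ℝ] Euc N from mfderiv (prodModel n) 𝓘(ℝ, Euc N) f p)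
      (Set.range (prodModel n)) (coordCenter p) :=
    ((hf p).mdifferentiableAt (by simp)).hasMFDerivAt.2
  rw [range_prodModel, hasFDerivWithinAt_univ] at h
  exact congrArg (fun D : (∀ i, Euc (n i)) →L[ℝ] Euc N => D X) h.fderiv.symm

theorem fderiv_comp_coordMap_single {F : (∀ i, M i) → V} {p : ∀ i, M i} {y : ∀ i, Euc (n i)}
    (hF : DifferentiableAt ℝ (F ∘ coordMap (n := n) p) y) (i : Fin k) (a : Euc (n i)) :
    fderiv ℝ (F ∘ coordMap (n := n) p) y (Pi.single i a) =
      fderiv ℝ (slice F (coordMap p y) i ∘ (extChartAt (𝓡 (n i)) (p i)).symm) (y i) a := by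
  rw [slice_comp_extChartAt_symm, (hasFDerivAt_comp_update hF i).fderiv]
  rfl

theorem chartDeriv_slice {F : (∀ i, M i) → V} (hF : SmoothInCharts n F) (p : ∀ i, M i) (i : Fin k)
    (X : Euc (n i)) :
    chartDeriv (n i) (slice F p i) (p i) X =
      fderiv ℝ (F ∘ coordMap (n := n) p) (coordCenter p) (Pi.single i X) := by
  rw [fderiv_comp_coordMap_single ((hF p).differentiableAt (by simp)), coordMap_coordCenter]
  rfl

theorem contMDiff_slice {F : (∀ i, M i) → V} (hF : SmoothInCharts n F) (p : ∀ i, M i) (i : Fin k) :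
    ContMDiff (𝓡 (n i)) 𝓘(ℝ, V) ∞ (slice F p i) := by
  intro x
  set q := Function.update p i x
  have hqx : q i = x := Function.update_self i x p
  have hlocal : slice F q i =ᶠ[𝓝 (q i)]
      ((F ∘ coordMap (n := n) q) ∘ Function.update (coordCenter q) i) ∘
        extChartAt (𝓡 (n i)) (q i) := by
    filter_upwards [extChartAt_source_mem_nhds (I := 𝓡 (n i)) (q i)] with y hy
    rw [Function.comp_apply, Function.comp_apply, Function.comp_apply,
      coordMap_update_coordCenter hy, slice]
  have hcoord : ContDiffAt ℝ ∞ ((F ∘ coordMap (n := n) q) ∘ Function.update (coordCenter q) i)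
      (coordCenter (n := n) q i) := by
    refine ContDiffAt.comp _ ?_ (contDiff_update ∞ (coordCenter q) i).contDiffAt
    rw [Function.update_eq_self]
    exact hF q
  have hq : ContMDiffAt (𝓡 (n i)) 𝓘(ℝ, V) ∞ (slice F q i) (q i) :=
    (hcoord.contMDiffAt.comp (q i) contMDiffAt_extChartAt).congr_of_eventuallyEq hlocal
  rwa [slice_update, hqx] at hq

theorem mdifferentiableAt_slice {F : (∀ i, M i) → V} (hF : SmoothInCharts n F) (p : ∀ i, M i)
    (i : Fin k) (x : M i) : MDifferentiableAt (𝓡 (n i)) 𝓘(ℝ, V) (slice F p i) x :=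
  (contMDiff_slice hF p i).mdifferentiableAt (by simp)

theorem fderiv_comp_coordMap [∀ i, IsManifold (𝓡 (n i)) ∞ (M i)] {F : (∀ i, M i) → V}
    (hF : SmoothInCharts n F) {p : ∀ i, M i} {y : ∀ i, Euc (n i)}
    (hy : ∀ i, y i ∈ (extChartAt (𝓡 (n i)) (p i)).target)
    (hd : DifferentiableAt ℝ (F ∘ coordMap (n := n) p) y) (i : Fin k) (a : Euc (n i)) :
    fderiv ℝ (F ∘ coordMap (n := n) p) y (Pi.single i a) =
      chartDeriv (n i) (slice F (coordMap p y) i) (coordMap p y i)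
        (chartFrame (n i) (p i) (y i) a) := by
  rw [fderiv_comp_coordMap_single hd,
    fderiv_comp_extChartAt_symm (hy i) (mdifferentiableAt_slice hF _ i _)]
  rfl

end ProductCharts

section Splitting

variable {k : ℕ} {n : Fin k → ℕ} {M : Fin k → Type*} [∀ i, TopologicalSpace (M i)]
  [∀ i, ChartedSpace (Euc (n i)) (M i)] {V : Type*} [NormedAddCommGroup V] [NormedSpace ℝ V]

/-- All mixed second derivatives vanish at the centres of the product charts. -/
def MixedDerivZero (n : Fin k → ℕ) [∀ i, ChartedSpace (Euc (n i)) (M i)]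
    (F : (∀ i, M i) → V) : Prop :=
  ∀ (p : ∀ i, M i) (i j : Fin k), i ≠ j → ∀ (a : Euc (n i)) (b : Euc (n j)),
    fderiv ℝ (fderiv ℝ (F ∘ coordMap (n := n) p)) (coordCenter p) (Pi.single i a)
      (Pi.single j b) = 0

theorem eventually_chartDeriv_slice_update {F : (∀ i, M i) → V} (hF : SmoothInCharts n F)
    (p : ∀ i, M i) {i j : Fin k} (hij : i ≠ j) (X : Euc (n i)) :
    ∀ᶠ y in 𝓝 (p j), chartDeriv (n i) (slice F (Function.update p j y) i) (p i) X =
      fderiv ℝ (F ∘ coordMap (n := n) p)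
        (Function.update (coordCenter p) j (extChartAt (𝓡 (n j)) (p j) y)) (Pi.single i X) := by
  have hcont : ContinuousAt
      (fun y => Function.update (coordCenter (n := n) p) j (extChartAt (𝓡 (n j)) (p j) y)) (p j) :=
    continuousAt_const.update j (continuousAt_extChartAt (p j))
  have hcenter : Function.update (coordCenter (n := n) p) j (extChartAt (𝓡 (n j)) (p j) (p j)) =
      coordCenter p := Function.update_eq_self j _
  have hdiff := hF.eventually_differentiableAt p
  rw [← hcenter] at hdiff
  filter_upwards [hcont.eventually hdiff, extChartAt_source_mem_nhds (I := 𝓡 (n j)) (p j)]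
    with y hy hys
  rw [fderiv_comp_coordMap_single hy, coordMap_update_coordCenter hys, Function.update_of_ne hij]
  rfl

theorem hasMFDerivAt_chartDeriv_slice {F : (∀ i, M i) → V} (hF : SmoothInCharts n F)
    (hmix : MixedDerivZero n F) (p : ∀ i, M i) {i j : Fin k} (hij : i ≠ j) (X : Euc (n i)) :
    HasMFDerivAt (𝓡 (n j)) 𝓘(ℝ, V)
      (fun y => chartDeriv (n i) (slice F (Function.update p j y) i) (p i) X) (p j) 0 := by
  refine (hasMFDerivAt_comp_extChartAt_zero (K := fun z => fderiv ℝ (F ∘ coordMap (n := n) p)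
    (Function.update (coordCenter p) j z) (Pi.single i X)) ?_).congr_of_eventuallyEq
    (eventually_chartDeriv_slice_update hF p hij X)
  have hU := hasFDerivAt_fderiv_apply (contDiffAt_infty.1 (hF p) 2) (Pi.single i X)
  refine (hasFDerivAt_comp_update hU.differentiableAt j).congr_fderiv ?_
  ext1 b
  rw [hU.fderiv]
  exact hmix p j i hij.symm b X

variable [∀ i, IsManifold (𝓡 (n i)) ∞ (M i)] [∀ i, ConnectedSpace (M i)]

theorem chartDeriv_slice_update_eq {F : (∀ i, M i) → V} (hF : SmoothInCharts n F)
    (hmix : MixedDerivZero n F) (p : ∀ i, M i) {i j : Fin k} (hij : i ≠ j)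
    (X : Euc (n i)) (y : M j) :
    chartDeriv (n i) (slice F (Function.update p j y) i) (p i) X =
      chartDeriv (n i) (slice F p i) (p i) X := by
  have : IsManifold (𝓡 (n j)) 1 (M j) := IsManifold.of_le (n := ∞) (by simp)
  have hconst : ∀ y₀, HasMFDerivAt (𝓡 (n j)) 𝓘(ℝ, V)
      (fun y => chartDeriv (n i) (slice F (Function.update p j y) i) (p i) X) y₀ 0 := fun y₀ => by
    have h := hasMFDerivAt_chartDeriv_slice hF hmix (Function.update p j y₀) hij X
    have hfun : (fun y => chartDeriv (n i)
        (slice F (Function.update (Function.update p j y₀) j y) i) (Function.update p j y₀ i) X) =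
        fun y => chartDeriv (n i) (slice F (Function.update p j y) i) (p i) X := by
      simp only [Function.update_idem, Function.update_of_ne hij]
    rwa [hfun, Function.update_self] at h
  simpa only [Function.update_eq_self] using eq_of_hasMFDerivAt_zero hconst y (p j)

theorem slice_update_sub_slice_eq {F : (∀ i, M i) → V} (hF : SmoothInCharts n F)
    (hmix : MixedDerivZero n F) (p : ∀ i, M i) {i j : Fin k} (hij : i ≠ j) (y : M j)
    (x x' : M i) :
    slice F (Function.update p j y) i x - slice F p i x =
      slice F (Function.update p j y) i x' - slice F p i x' := by
  have : IsManifold (𝓡 (n i)) 1 (M i) := IsManifold.of_le (n := ∞) (by simp)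
  refine eq_of_hasMFDerivAt_zero (I := 𝓡 (n i))
    (g := fun x => slice F (Function.update p j y) i x - slice F p i x) (fun z => ?_) x x'
  have hsub := (hasMFDerivAt_chartDeriv
    (mdifferentiableAt_slice hF (Function.update p j y) i z)).sub
    (hasMFDerivAt_chartDeriv (mdifferentiableAt_slice hF p i z))
  refine hsub.congr_mfderiv (ContinuousLinearMap.ext fun X => sub_eq_zero.2 ?_)
  have hX := chartDeriv_slice_update_eq hF hmix (Function.update p i z) hij X y
  rwa [Function.update_comm hij, slice_update, slice_update, Function.update_self] at hX

theorem slice_piecewise_sub_slice_piecewise {F : (∀ i, M i) → V} (hF : SmoothInCharts n F)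
    (hmix : MixedDerivZero n F) (o p : ∀ i, M i) (s : Finset (Fin k)) (i : Fin k) (x x' : M i) :
    slice F (s.piecewise p o) i x - slice F (s.piecewise p o) i x' =
      slice F o i x - slice F o i x' := by
  induction s using Finset.induction_on with
  | empty => simp
  | insert j s hj ih =>
    rw [Finset.piecewise_insert, ← ih]
    by_cases hij : i = j
    · subst hij
      rw [slice_update]
    · rw [sub_eq_sub_iff_sub_eq_sub]
      exact slice_update_sub_slice_eq hF hmix (s.piecewise p o) hij (p j) x x'

theorem eq_add_sum_slice {F : (∀ i, M i) → V} (hF : SmoothInCharts n F)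
    (hmix : MixedDerivZero n F) (o p : ∀ i, M i) :
    F p = F o + ∑ i, (slice F o i (p i) - F o) := by
  suffices h : ∀ s : Finset (Fin k),
      F (s.piecewise p o) = F o + ∑ i ∈ s, (slice F o i (p i) - F o) by
    simpa using h Finset.univ
  intro s
  induction s using Finset.induction_on with
  | empty => simp
  | insert j s hj ih =>
    have hstep := slice_piecewise_sub_slice_piecewise hF hmix o p s j (p j) (o j)
    have hbase : slice F (s.piecewise p o) j (o j) = F (s.piecewise p o) := by
      simpa only [Finset.piecewise_eq_of_notMem s p o hj] using slice_self F (s.piecewise p o) j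
    rw [hbase, slice_self, sub_eq_iff_eq_add, ih] at hstep
    rw [Finset.piecewise_insert, Finset.sum_insert hj]
    exact hstep.trans (by abel)

end Splitting

section Isometric

/-- The metric at `x`, with the tangent space identified with `ℝⁿ`. -/
noncomputable def metricAt {n : ℕ} {M : Type*} [TopologicalSpace M] [ChartedSpace (Euc n) M]
    [IsManifold (𝓡 n) ∞ M] (g : RiemMetric n M) (x : M) (X Y : Euc n) : ℝ :=
  g.inner x X Y

theorem metricAt_pos {n : ℕ} {M : Type*} [TopologicalSpace M] [ChartedSpace (Euc n) M]
    [IsManifold (𝓡 n) ∞ M] (g : RiemMetric n M) (x : M) {X : Euc n} (hX : X ≠ 0) :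
    0 < metricAt g x X X :=
  g.pos x X hX

theorem metricAt_zero_right {n : ℕ} {M : Type*} [TopologicalSpace M] [ChartedSpace (Euc n) M]
    [IsManifold (𝓡 n) ∞ M] (g : RiemMetric n M) (x : M) (X : Euc n) : metricAt g x X 0 = 0 :=
  map_zero (g.inner x (show TangentSpace (𝓡 n) x from X))

theorem bilin_sum_single {ι : Type*} [Fintype ι] [DecidableEq ι] {E : ι → Type*}
    [∀ i, NormedAddCommGroup (E i)] [∀ i, NormedSpace ℝ (E i)] {V : Type*} [NormedAddCommGroup V]
    [NormedSpace ℝ V] (B : V →L[ℝ] V →L[ℝ] ℝ) (T : (∀ i, E i) →L[ℝ] V)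
    (h : ∀ i j, i ≠ j → ∀ a b, B (T (Pi.single i a)) (T (Pi.single j b)) = 0) (v : ∀ i, E i) :
    B (T v) (T v) = ∑ i, B (T (Pi.single i (v i))) (T (Pi.single i (v i))) := by
  conv_lhs => rw [← Finset.univ_sum_single v]
  simp only [map_sum, _root_.sum_apply]
  exact Finset.sum_congr rfl fun i _ =>
    Finset.sum_eq_single_of_mem i (Finset.mem_univ i) fun j _ hj => h _ _ hj _ _

theorem exists_ne_zero_of_two_le {m : ℕ} (hm : 2 ≤ m) (T : Euc m →ₗ[ℝ] ℝ) :
    ∃ e : Euc m, e ≠ 0 ∧ T e = 0 := by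
  have hker : LinearMap.ker T ≠ ⊥ := LinearMap.ker_ne_bot_of_finrank_lt (by simp; omega)
  obtain ⟨e, he, hne⟩ := Submodule.exists_mem_ne_zero_of_ne_bot hker
  exact ⟨e, hne, he⟩

theorem exists_ne_ne_or_two_le {ι : Type*} [Fintype ι] {n : ι → ℕ}
    (hn3 : 3 ≤ ∑ i, n i) {i j : ι} (hij : i ≠ j) :
    (∃ l, l ≠ i ∧ l ≠ j) ∨ 2 ≤ n i ∨ 2 ≤ n j := by
  classical
  by_contra! hcon
  obtain ⟨hpair, hi, hj⟩ := hcon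
  have huniv : Finset.univ = {i, j} := by
    ext l
    by_cases hl : l = i
    · simp [hl]
    · simp [hpair l hl]
  rw [huniv, Finset.sum_pair hij] at hn3
  omega

variable {k : ℕ} {n : Fin k → ℕ} {M : Fin k → Type*} [∀ i, TopologicalSpace (M i)]
  [∀ i, ChartedSpace (Euc (n i)) (M i)] [∀ i, IsManifold (𝓡 (n i)) ∞ (M i)]
  {V : Type*} [NormedAddCommGroup V] [NormedSpace ℝ V]

/-- `F` is an isometric immersion of the Riemannian product into the vector space `V` with scalar
product `B`, in terms of the restrictions of `F` to the factors. -/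
structure IsProductIsometry (B : V →L[ℝ] V →L[ℝ] ℝ) (g : ∀ i, RiemMetric (n i) (M i))
    (F : (∀ i, M i) → V) : Prop where
  smooth : SmoothInCharts n F
  orth : ∀ p i j, i ≠ j → ∀ (X : Euc (n i)) (Y : Euc (n j)),
    B (chartDeriv (n i) (slice F p i) (p i) X) (chartDeriv (n j) (slice F p j) (p j) Y) = 0
  diag : ∀ p i (X Y : Euc (n i)),
    B (chartDeriv (n i) (slice F p i) (p i) X) (chartDeriv (n i) (slice F p i) (p i) Y) =
      metricAt (g i) (p i) X Y

namespace IsProductIsometry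

variable {B : V →L[ℝ] V →L[ℝ] ℝ} {g : ∀ i, RiemMetric (n i) (M i)} {F : (∀ i, M i) → V}
  (hF : IsProductIsometry B g F)
include hF

theorem inducesProductMetricAt (p : ∀ i, M i) :
    InducesProductMetricAt B (F ∘ coordMap (n := n) p) (coordCenter p) where
  orth := by
    filter_upwards [hF.smooth.eventually_differentiableAt p, eventually_mem_extChartAt_target p]
      with y hd hy i j hij a b
    rw [fderiv_comp_coordMap hF.smooth hy hd, fderiv_comp_coordMap hF.smooth hy hd]
    exact hF.orth _ i j hij _ _
  diag i := by
    refine ⟨fun z a b => metricAt (g i) ((extChartAt (𝓡 (n i)) (p i)).symm z)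
      (chartFrame (n i) (p i) z a) (chartFrame (n i) (p i) z b), ?_⟩
    filter_upwards [hF.smooth.eventually_differentiableAt p, eventually_mem_extChartAt_target p]
      with y hd hy a b
    rw [fderiv_comp_coordMap hF.smooth hy hd, fderiv_comp_coordMap hF.smooth hy hd]
    exact hF.diag _ i _ _

theorem bilin_fderiv_self_pos (p : ∀ i, M i) {v : ∀ i, Euc (n i)} (hv : v ≠ 0) :
    0 < B (fderiv ℝ (F ∘ coordMap (n := n) p) (coordCenter p) v)
      (fderiv ℝ (F ∘ coordMap (n := n) p) (coordCenter p) v) := by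
  rw [bilin_sum_single B _ (hF.inducesProductMetricAt p).orth.self_of_nhds]
  simp only [← chartDeriv_slice hF.smooth, hF.diag]
  obtain ⟨l, hl⟩ := Function.ne_iff.1 hv
  refine Finset.sum_pos' (fun l _ => ?_) ⟨l, Finset.mem_univ l, metricAt_pos _ _ hl⟩
  rcases eq_or_ne (v l) 0 with h | h
  · rw [h, metricAt_zero_right]
  · exact (metricAt_pos _ _ h).le

theorem mixedDerivZero (hB : ∀ x y, B x y = B y x) (hn : ∀ i, 1 ≤ n i) (hn3 : 3 ≤ ∑ i, n i)
    (hnull : ∀ p, B (F p) (F p) = 0)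
    (mix : ∀ (p : ∀ i, M i) (i j : Fin k), i ≠ j → ∀ (a : Euc (n i)) (b : Euc (n j)),
      ∃ (s : ℝ) (Z : ∀ i, Euc (n i)),
      fderiv ℝ (fderiv ℝ (F ∘ coordMap (n := n) p)) (coordCenter p) (Pi.single i a)
        (Pi.single j b) = s • F p + fderiv ℝ (F ∘ coordMap (n := n) p) (coordCenter p) Z) :
    MixedDerivZero n F := by
  intro p i j hij a b
  have hbase : (F ∘ coordMap (n := n) p) (coordCenter p) = F p :=
    congrArg F (coordMap_coordCenter p)
  have hkernel : ∀ i, 2 ≤ n i → ∀ a : Euc (n i), ∃ e : Euc (n i), e ≠ 0 ∧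
      B (fderiv ℝ (F ∘ coordMap (n := n) p) (coordCenter p) (Pi.single i a))
        (fderiv ℝ (F ∘ coordMap (n := n) p) (coordCenter p) (Pi.single i e)) = 0 := fun i hi a =>
    exists_ne_zero_of_two_le hi
      (((B (fderiv ℝ (F ∘ coordMap (n := n) p) (coordCenter p) (Pi.single i a))).comp
        (fderiv ℝ (F ∘ coordMap (n := n) p) (coordCenter p))).comp
        (ContinuousLinearMap.single ℝ (fun i => Euc (n i)) i)).toLinearMap
  refine (hF.inducesProductMetricAt p).mixed_fderiv_eq_zero hB
    (Eventually.of_forall fun y => hnull _) (fun v hv => hF.bilin_fderiv_self_pos p hv)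
    (fun i j hij a b => hbase.symm ▸ mix p i j hij a b) (contDiffAt_infty.1 (hF.smooth p) 3) hij
    ?_ a b
  rcases exists_ne_ne_or_two_le hn3 hij with ⟨l, hli, hlj⟩ | hi | hj
  · have : Nonempty (Fin (n l)) := ⟨⟨0, hn l⟩⟩
    exact Or.inl ⟨l, hli, hlj, inferInstance⟩
  · exact Or.inr (Or.inl (hkernel i hi))
  · exact Or.inr (Or.inr (hkernel j hj))

end IsProductIsometry

end Isometric

section Lorentz

variable {d : ℕ}

/-- The Lorentz product as a continuous bilinear form. -/
noncomputable def lorForm (d : ℕ) : Mink d →L[ℝ] Mink d →L[ℝ] ℝ :=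
  (show Euc d →L[ℝ] Euc d →L[ℝ] ℝ from innerSL ℝ).bilinearComp
      (ContinuousLinearMap.fst ℝ (Euc d) ℝ) (ContinuousLinearMap.fst ℝ (Euc d) ℝ) -
    (ContinuousLinearMap.mul ℝ ℝ).bilinearComp (ContinuousLinearMap.snd ℝ (Euc d) ℝ)
      (ContinuousLinearMap.snd ℝ (Euc d) ℝ)

theorem lorForm_apply (X Y : Mink d) : lorForm d X Y = lor X Y := rfl

theorem lor_self (X : Mink d) : lor X X = ‖X.1‖ ^ 2 - X.2 ^ 2 := by
  rw [lor, real_inner_self_eq_norm_sq, sq X.2]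

theorem lor_comm (X Y : Mink d) : lor X Y = lor Y X := by
  rw [lor, lor, real_inner_comm, mul_comm]

@[simp] theorem lor_add_left (X Y Z : Mink d) : lor (X + Y) Z = lor X Z + lor Y Z := by
  simp [← lorForm_apply]

@[simp] theorem lor_add_right (X Y Z : Mink d) : lor X (Y + Z) = lor X Y + lor X Z := by
  simp [← lorForm_apply]

@[simp] theorem lor_sub_left (X Y Z : Mink d) : lor (X - Y) Z = lor X Z - lor Y Z := by
  simp [← lorForm_apply]

@[simp] theorem lor_sub_right (X Y Z : Mink d) : lor X (Y - Z) = lor X Y - lor X Z := by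
  simp [← lorForm_apply]

@[simp] theorem lor_smul_left (a : ℝ) (X Y : Mink d) : lor (a • X) Y = a * lor X Y := by
  simp [← lorForm_apply]

@[simp] theorem lor_smul_right (a : ℝ) (X Y : Mink d) : lor X (a • Y) = a * lor X Y := by
  simp [← lorForm_apply]

@[simp] theorem lor_zero_left (Y : Mink d) : lor 0 Y = 0 := by
  simp [← lorForm_apply]

@[simp] theorem lor_zero_right (Y : Mink d) : lor Y 0 = 0 := by
  simp [← lorForm_apply]

theorem lor_sum_left {ι : Type*} (s : Finset ι) (X : ι → Mink d) (Y : Mink d) :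
    lor (∑ i ∈ s, X i) Y = ∑ i ∈ s, lor (X i) Y := by
  simp [← lorForm_apply]

theorem lor_sum_right {ι : Type*} (s : Finset ι) (X : ι → Mink d) (Y : Mink d) :
    lor Y (∑ i ∈ s, X i) = ∑ i ∈ s, lor Y (X i) := by
  simp [← lorForm_apply]

theorem eq_zero_of_snd_eq_zero {X : Mink d} (hX : lor X X ≤ 0) (h : X.2 = 0) : X = 0 := by
  rw [lor_self, h] at hX
  exact Prod.ext (norm_eq_zero.1 (by nlinarith [norm_nonneg X.1])) h

theorem eq_zero_of_lor_eq_zero {X : Mink d} (h : ∀ Y, lor X Y = 0) : X = 0 := by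
  have hconj : ‖X.1‖ ^ 2 + X.2 ^ 2 = 0 := by
    have hX := h (X.1, -X.2)
    rw [lor, real_inner_self_eq_norm_sq] at hX
    linarith
  have hsnd : X.2 = 0 := by nlinarith [sq_nonneg ‖X.1‖, sq_nonneg X.2]
  exact eq_zero_of_snd_eq_zero (h X).le hsnd

theorem lor_self_pos_of_timelike {v x : Mink d} (hv : lor v v < 0) (hvx : lor v x = 0)
    (hx : x ≠ 0) : 0 < lor x x := by
  by_contra! hcon
  have hcauchy : (v.2 * x.2) ^ 2 ≤ (‖v.1‖ * ‖x.1‖) ^ 2 := by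
    rw [← sub_eq_zero.1 hvx, ← sq_abs (inner ℝ v.1 x.1)]
    gcongr
    exact abs_real_inner_le_norm v.1 x.1
  rw [lor_self] at hv
  have hsnd : x.2 = 0 := by
    by_contra hne
    have hcon' := lor_self x ▸ hcon
    nlinarith [mul_pos (sq_pos_of_ne_zero hne) (neg_pos.2 hv),
      mul_le_mul_of_nonneg_left hcon' (sq_nonneg ‖v.1‖)]
  exact hx (eq_zero_of_snd_eq_zero hcon hsnd)

theorem exists_eq_smul_of_null {z x : Mink d} (hz : lor z z = 0) (hz0 : z ≠ 0) (hx : lor x x = 0)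
    (hzx : lor z x = 0) : ∃ a : ℝ, x = a • z := by
  have hsnd : z.2 ≠ 0 := fun h => hz0 (eq_zero_of_snd_eq_zero hz.le h)
  refine ⟨x.2 / z.2, sub_eq_zero.1 (eq_zero_of_snd_eq_zero ?_ ?_)⟩
  · simp [hz, hx, hzx, lor_comm x z]
  · simp [hsnd]

theorem lor_eq_zero_of_null {S : Submodule ℝ (Mink d)} (hS : ∀ x ∈ S, 0 ≤ lor x x) {z : Mink d}
    (hz : z ∈ S) (hz0 : lor z z = 0) {x : Mink d} (hx : x ∈ S) : lor z x = 0 := by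
  by_contra hne
  have hneg : lor (x + (-(lor x x + 1) / (2 * lor z x)) • z)
      (x + (-(lor x x + 1) / (2 * lor z x)) • z) = -1 := by
    simp only [lor_add_left, lor_add_right, lor_smul_left, lor_smul_right, hz0, lor_comm x z]
    field_simp
    ring
  linarith [hS _ (S.add_mem hx (S.smul_mem (-(lor x x + 1) / (2 * lor z x)) hz))]

/-- The adjoint of a linear map `ℝ^m → 𝕃^{d+1}`, with respect to the scalar product of `ℝ^m` and
the Lorentz product. -/
noncomputable def lorAdjoint {m : ℕ} (K : Euc m →ₗ[ℝ] Mink d) : Mink d →L[ℝ] Euc m :=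
  LinearMap.toContinuousLinearMap
    { toFun := fun Z =>
        (InnerProductSpace.toDual ℝ (Euc m)).symm ((lorForm d Z).comp K.toContinuousLinearMap)
      map_add' := fun X Y => by simp
      map_smul' := fun a X => by simp }

theorem inner_lorAdjoint {m : ℕ} (K : Euc m →ₗ[ℝ] Mink d) (Z : Mink d) (x : Euc m) :
    inner ℝ (lorAdjoint K Z) x = lor Z (K x) :=
  InnerProductSpace.toDual_symm_apply

theorem lorAdjoint_apply_self {m : ℕ} {K : Euc m →ₗ[ℝ] Mink d}
    (hK : ∀ x y, lor (K x) (K y) = inner ℝ x y) (x : Euc m) : lorAdjoint K (K x) = x :=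
  ext_inner_right ℝ fun y => by rw [inner_lorAdjoint, hK]

theorem lorAdjoint_eq_zero {m : ℕ} {K : Euc m →ₗ[ℝ] Mink d} {Z : Mink d}
    (h : ∀ x, lor (K x) Z = 0) : lorAdjoint K Z = 0 :=
  ext_inner_right ℝ fun y => by rw [inner_lorAdjoint, lor_comm, h, inner_zero_left]

end Lorentz

section LightCone

variable {N : ℕ}

theorem ConeTriple.decomp (τ : ConeTriple N) (Z : Mink (N + 1)) :
    Z = lor Z τ.w • τ.p₀ + lor Z τ.p₀ • τ.w + τ.A (lorAdjoint τ.A Z) := by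
  let Φ : (ℝ × ℝ) × Euc N →ₗ[ℝ] Mink (N + 1) :=
    ((LinearMap.toSpanSingleton ℝ _ τ.p₀).coprod (LinearMap.toSpanSingleton ℝ _ τ.w)).coprod τ.A
  have hΦ : ∀ c, Φ c = c.1.1 • τ.p₀ + c.1.2 • τ.w + τ.A c.2 := fun c => by simp [Φ]
  have hleft : Function.LeftInverse (fun Z => ((lor Z τ.w, lor Z τ.p₀), lorAdjoint τ.A Z)) Φ := by
    rintro ⟨⟨a, b⟩, x⟩
    have hA : lorAdjoint τ.A (a • τ.p₀ + b • τ.w) = 0 :=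
      lorAdjoint_eq_zero fun y => by simp [τ.A_p₀, τ.A_w]
    simp only [hΦ, map_add (lorAdjoint τ.A) (a • τ.p₀ + b • τ.w), hA,
      lorAdjoint_apply_self τ.A_isom, lor_add_left, lor_smul_left, τ.p₀_w, τ.w_null, τ.p₀_null,
      lor_comm τ.w τ.p₀, τ.A_p₀, τ.A_w, mul_one, mul_zero, add_zero, zero_add]
  have hdim : Module.finrank ℝ ((ℝ × ℝ) × Euc N) = Module.finrank ℝ (Mink (N + 1)) := by
    simp; ring
  obtain ⟨c, rfl⟩ := (LinearMap.injective_iff_surjective_of_finrank_eq_finrank hdim).1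
    hleft.injective Z
  exact (congrArg Φ (hleft c)).symm.trans (hΦ _)

theorem ConeTriple.lor_eq_of_decomp (τ : ConeTriple N) (Z Y : Mink (N + 1)) :
    lor Z Y = lor Z τ.w * lor Y τ.p₀ + lor Z τ.p₀ * lor Y τ.w +
      inner ℝ (lorAdjoint τ.A Z) (lorAdjoint τ.A Y) := by
  conv_lhs => rw [τ.decomp Z]
  simp only [lor_add_left, lor_smul_left]
  rw [lor_comm (τ.A _) Y, ← inner_lorAdjoint, lor_comm τ.p₀ Y, lor_comm τ.w Y, real_inner_comm]

theorem ConeTriple.lor_embed_w (τ : ConeTriple N) (x : Euc N) : lor (τ.embed x) τ.w = 1 := by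
  simp [ConeTriple.embed, τ.p₀_w, τ.A_w, τ.w_null]

theorem ConeTriple.lor_embed_embed (τ : ConeTriple N) (x y : Euc N) :
    lor (τ.embed x) (τ.embed y) = -(‖x - y‖ ^ 2 / 2) := by
  simp only [ConeTriple.embed, lor_add_left, lor_add_right, lor_sub_left, lor_sub_right,
    lor_smul_left, lor_smul_right, τ.p₀_null, τ.w_null, τ.p₀_w, τ.A_isom, τ.A_p₀, τ.A_w,
    lor_comm τ.p₀ (τ.A _), lor_comm τ.w (τ.A _), lor_comm τ.w τ.p₀, norm_sub_sq_real]
  ring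

theorem ConeTriple.lorAdjoint_embed (τ : ConeTriple N) (x : Euc N) :
    lorAdjoint τ.A (τ.embed x) = x := by
  simp [ConeTriple.embed, lorAdjoint_eq_zero τ.A_p₀, lorAdjoint_eq_zero τ.A_w,
    lorAdjoint_apply_self τ.A_isom]

theorem ConeTriple.embed_lorAdjoint (τ : ConeTriple N) {Y : Mink (N + 1)} (hnull : lor Y Y = 0)
    (hw : lor Y τ.w = 1) : τ.embed (lorAdjoint τ.A Y) = Y := by
  have hp₀ : lor Y τ.p₀ = -(‖lorAdjoint τ.A Y‖ ^ 2 / 2) := by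
    have h := τ.lor_eq_of_decomp Y Y
    rw [hnull, hw, real_inner_self_eq_norm_sq] at h
    linarith
  conv_rhs => rw [τ.decomp Y, hw, hp₀]
  rw [ConeTriple.embed]
  module

/-- `x ↦ (x, 0)`. -/
noncomputable def appendZero (N : ℕ) : Euc N →ₗ[ℝ] Euc (N + 1) where
  toFun x := WithLp.toLp 2 (Fin.snoc (α := fun _ => ℝ) (fun i => x i) 0)
  map_add' x y := by
    ext i
    refine Fin.lastCases ?_ (fun j => ?_) i <;> simp
  map_smul' a x := by
    ext i
    refine Fin.lastCases ?_ (fun j => ?_) i <;> simp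

theorem inner_appendZero (x y : Euc N) :
    inner ℝ (appendZero N x) (appendZero N y) = inner ℝ x y := by
  simp [PiLp.inner_apply, Fin.sum_univ_castSucc, appendZero]

theorem nonempty_coneTriple (N : ℕ) : Nonempty (ConeTriple N) := by
  let e : Euc (N + 1) := EuclideanSpace.single (Fin.last N) 1
  have he : inner ℝ e e = (1 : ℝ) := by simp [e]
  have hAe : ∀ x, inner ℝ (appendZero N x) e = (0 : ℝ) := fun x => by
    simp [e, appendZero, EuclideanSpace.inner_single_right]
  exact ⟨{
    p₀ := ((1 / 2 : ℝ) • e, 1 / 2)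
    w := (e, -1)
    A := (LinearMap.inl ℝ (Euc (N + 1)) ℝ).comp (appendZero N)
    p₀_null := by simp only [lor, inner_smul_left, inner_smul_right, he]; simp
    w_null := by simp only [lor, he]; simp
    p₀_w := by simp only [lor, inner_smul_left, he]; norm_num
    A_isom := fun x y => by simp [lor, inner_appendZero]
    A_p₀ := fun x => by simp [lor, inner_smul_right, hAe]
    A_w := fun x => by simp [lor, hAe] }⟩

end LightCone

section Lift

variable {N : ℕ} {V : Type*} [NormedAddCommGroup V] [NormedSpace ℝ V]

/-- The differential of `τ.embed` at `u`. -/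
noncomputable def ConeTriple.dEmbed (τ : ConeTriple N) (u : Euc N) : Euc N →L[ℝ] Mink (N + 1) :=
  LinearMap.toContinuousLinearMap τ.A - (innerSL ℝ u).smulRight τ.w

theorem ConeTriple.dEmbed_apply (τ : ConeTriple N) (u x : Euc N) :
    τ.dEmbed u x = τ.A x - inner ℝ u x • τ.w := rfl

theorem ConeTriple.lor_embed_dEmbed (τ : ConeTriple N) (u x : Euc N) :
    lor (τ.embed u) (τ.dEmbed u x) = 0 := by
  simp only [ConeTriple.dEmbed_apply, ConeTriple.embed, lor_add_left, lor_sub_left, lor_sub_right,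
    lor_smul_left, lor_smul_right, τ.w_null, τ.p₀_w, τ.A_isom, τ.A_p₀, τ.A_w,
    lor_comm τ.p₀ (τ.A _), lor_comm τ.w (τ.A _)]
  ring

theorem ConeTriple.lor_dEmbed_dEmbed (τ : ConeTriple N) (u x y : Euc N) :
    lor (τ.dEmbed u x) (τ.dEmbed u y) = inner ℝ x y := by
  simp only [ConeTriple.dEmbed_apply, lor_sub_left, lor_sub_right, lor_smul_left, lor_smul_right,
    τ.w_null, τ.A_isom, τ.A_w, lor_comm τ.w (τ.A _)]
  ring

theorem ConeTriple.contDiff_embed (τ : ConeTriple N) {m : WithTop ℕ∞} :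
    ContDiff ℝ m τ.embed := by
  have hA : ContDiff ℝ m τ.A := (LinearMap.toContinuousLinearMap τ.A).contDiff
  exact (contDiff_const.add hA).sub (((contDiff_norm_sq ℝ).div_const 2).smul contDiff_const)

theorem ConeTriple.hasFDerivAt_embed (τ : ConeTriple N) (u : Euc N) :
    HasFDerivAt τ.embed (τ.dEmbed u) u := by
  have hA : HasFDerivAt τ.A (LinearMap.toContinuousLinearMap τ.A) u :=
    (LinearMap.toContinuousLinearMap τ.A).hasFDerivAt
  have hsq := ((hasStrictFDerivAt_norm_sq u).hasFDerivAt.mul_const (2⁻¹ : ℝ)).smul_const τ.w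
  refine ((hA.const_add τ.p₀).sub hsq).congr_fderiv (ContinuousLinearMap.ext fun x => ?_)
  simp [ConeTriple.dEmbed_apply]

theorem ConeTriple.hasFDerivAt_dEmbed (τ : ConeTriple N) {u x : V → Euc N} {u' x' : V →L[ℝ] Euc N}
    {y : V} (hu : HasFDerivAt u u' y) (hx : HasFDerivAt x x' y) :
    HasFDerivAt (fun z => τ.dEmbed (u z) (x z))
      ((τ.dEmbed (u y)).comp x' - ((innerSL ℝ (x y)).comp u').smulRight τ.w) y := by
  have hA := (LinearMap.toContinuousLinearMap τ.A).hasFDerivAt.comp y hx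
  refine (hA.sub ((hu.inner ℝ hx).smul_const τ.w)).congr_fderiv
    (ContinuousLinearMap.ext fun v => ?_)
  simp only [sub_apply, ContinuousLinearMap.comp_apply, ContinuousLinearMap.smulRight_apply,
    innerSL_apply_apply, fderivInnerCLM_apply, ContinuousLinearMap.prod_apply,
    ConeTriple.dEmbed_apply, LinearMap.coe_toContinuousLinearMap', real_inner_comm (x y)]
  module

theorem ConeTriple.fderiv_lift (τ : ConeTriple N) {ψ : V → ℝ} {u : V → Euc N} {y : V}
    (hψ : DifferentiableAt ℝ ψ y) (hu : DifferentiableAt ℝ u y) (v : V) :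
    fderiv ℝ (fun z => ψ z • τ.embed (u z)) y v =
      fderiv ℝ ψ y v • τ.embed (u y) + ψ y • τ.dEmbed (u y) (fderiv ℝ u y v) := by
  have h := hψ.hasFDerivAt.smul ((τ.hasFDerivAt_embed (u y)).comp y hu.hasFDerivAt)
  refine (congrArg (fun D => D v) h.fderiv).trans ?_
  simp [add_comm]

theorem ConeTriple.lor_fderiv_lift (τ : ConeTriple N) {ψ : V → ℝ} {u : V → Euc N} {y : V}
    (hψ : DifferentiableAt ℝ ψ y) (hu : DifferentiableAt ℝ u y) (v v' : V) :
    lor (fderiv ℝ (fun z => ψ z • τ.embed (u z)) y v)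
      (fderiv ℝ (fun z => ψ z • τ.embed (u z)) y v') =
      ψ y ^ 2 * inner ℝ (fderiv ℝ u y v) (fderiv ℝ u y v') := by
  rw [τ.fderiv_lift hψ hu, τ.fderiv_lift hψ hu]
  simp only [lor_add_left, lor_add_right, lor_smul_left, lor_smul_right, τ.lor_embed_dEmbed,
    lor_comm (τ.dEmbed _ _) (τ.embed _), τ.lor_dEmbed_dEmbed, τ.lor_embed_embed, sub_self,
    norm_zero]
  ring

theorem ConeTriple.fderiv_fderiv_lift (τ : ConeTriple N) {ψ : V → ℝ} {u : V → Euc N} {y : V}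
    (hψ : ContDiffAt ℝ 2 ψ y) (hu : ContDiffAt ℝ 2 u y) (a b : V) :
    fderiv ℝ (fderiv ℝ (fun z => ψ z • τ.embed (u z))) y a b =
      fderiv ℝ (fderiv ℝ ψ) y a b • τ.embed (u y) +
        fderiv ℝ ψ y b • τ.dEmbed (u y) (fderiv ℝ u y a) +
        fderiv ℝ ψ y a • τ.dEmbed (u y) (fderiv ℝ u y b) +
        ψ y • (τ.dEmbed (u y) (fderiv ℝ (fderiv ℝ u) y a b) -
          inner ℝ (fderiv ℝ u y a) (fderiv ℝ u y b) • τ.w) := by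
  have hψ1 := (hψ.differentiableAt (by norm_num)).hasFDerivAt
  have hu1 := (hu.differentiableAt (by norm_num)).hasFDerivAt
  have hlift : (fun z => fderiv ℝ (fun z => ψ z • τ.embed (u z)) z b) =ᶠ[𝓝 y] fun z =>
      fderiv ℝ ψ z b • τ.embed (u z) + ψ z • τ.dEmbed (u z) (fderiv ℝ u z b) := by
    filter_upwards [hψ.eventually (by simp), hu.eventually (by simp)] with z hψz huz
    exact τ.fderiv_lift (hψz.differentiableAt (by norm_num))
      (huz.differentiableAt (by norm_num)) b
  have hleft := hasFDerivAt_fderiv_apply (hψ.smul (τ.contDiff_embed.contDiffAt.comp y hu)) b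
  have hright := ((hasFDerivAt_fderiv_apply hψ b).smul ((τ.hasFDerivAt_embed _).comp y hu1)).add
    (hψ1.smul (τ.hasFDerivAt_dEmbed hu1 (hasFDerivAt_fderiv_apply hu b)))
  refine (congrArg (fun D => D a) (hleft.unique (hright.congr_of_eventuallyEq hlift))).trans ?_
  simp only [add_apply, smul_apply, sub_apply, ContinuousLinearMap.comp_apply,
    ContinuousLinearMap.smulRight_apply, ContinuousLinearMap.flip_apply, innerSL_apply_apply,
    Function.comp_apply, real_inner_comm (fderiv ℝ u y a)]
  module

theorem ConeTriple.exists_fderiv_fderiv_lift_eq (τ : ConeTriple N) {ψ : V → ℝ} {u : V → Euc N}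
    {y : V} (hψ : ContDiffAt ℝ 2 ψ y) (hu : ContDiffAt ℝ 2 u y) (hψ0 : ψ y ≠ 0) {a b Z : V}
    (hab : inner ℝ (fderiv ℝ u y a) (fderiv ℝ u y b) = 0)
    (hZ : fderiv ℝ (fderiv ℝ u) y a b = fderiv ℝ u y Z) :
    ∃ (s : ℝ) (Y : V), fderiv ℝ (fderiv ℝ (fun z => ψ z • τ.embed (u z))) y a b =
      s • (ψ y • τ.embed (u y)) + fderiv ℝ (fun z => ψ z • τ.embed (u z)) y Y := by
  set Y := (ψ y)⁻¹ • (fderiv ℝ ψ y b • a + fderiv ℝ ψ y a • b + ψ y • Z)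
  have hY : ψ y • τ.dEmbed (u y) (fderiv ℝ u y Y) =
      fderiv ℝ ψ y b • τ.dEmbed (u y) (fderiv ℝ u y a) +
        fderiv ℝ ψ y a • τ.dEmbed (u y) (fderiv ℝ u y b) +
        ψ y • τ.dEmbed (u y) (fderiv ℝ u y Z) := by
    simp only [← map_smul, ← map_add, Y, smul_inv_smul₀ hψ0]
  refine ⟨(fderiv ℝ (fderiv ℝ ψ) y a b - fderiv ℝ ψ y Y) / ψ y, Y, ?_⟩
  rw [τ.fderiv_fderiv_lift hψ hu, hab, hZ, τ.fderiv_lift (hψ.differentiableAt (by norm_num))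
    (hu.differentiableAt (by norm_num)), hY, smul_smul, div_mul_cancel₀ _ hψ0]
  module

end Lift

section Adapted

variable {k N : ℕ} {n : Fin k → ℕ} {M : Fin k → Type*} [∀ i, TopologicalSpace (M i)]
  [∀ i, ChartedSpace (Euc (n i)) (M i)] {f : (∀ i, M i) → Euc N}

theorem eq_single_of_mem_productNet {p : ∀ i, M i} {i : Fin k}
    {X : ∀ i, TangentSpace (𝓡 (n i)) (p i)} (hX : X ∈ productNet p i) :
    X = Pi.single i (X i) := by
  funext l
  rcases eq_or_ne l i with rfl | hl
  · rw [Pi.single_eq_same]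
  · rw [Pi.single_eq_of_ne hl]
    exact hX l hl

theorem single_mem_productNet (p : ∀ i, M i) (i : Fin k) (X : TangentSpace (𝓡 (n i)) (p i)) :
    Pi.single i X ∈ productNet (n := n) p i :=
  fun _ hl => dif_neg hl

theorem secondFundamentalForm_mem_normalSpace (p : ∀ i, M i)
    (X Y : ∀ i, TangentSpace (𝓡 (n i)) (p i)) :
    secondFundamentalForm f p X Y ∈ normalSpace (n := n) f p :=
  Submodule.starProjection_apply_mem _ _

theorem exists_fderiv_fderiv_eq_of_secondFundamentalForm_eq_zero
    (hf : ContMDiff (prodModel n) 𝓘(ℝ, Euc N) ∞ f) {p : ∀ i, M i} {X Y : ∀ i, Euc (n i)}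
    (hXY : secondFundamentalForm (n := n) f p X Y = 0) :
    ∃ Z, fderiv ℝ (fderiv ℝ (f ∘ coordMap (n := n) p)) (coordCenter p) X Y =
      fderiv ℝ (f ∘ coordMap (n := n) p) (coordCenter p) Z := by
  have hmem : fderiv ℝ (fderiv ℝ (f ∘ coordMap (n := n) p)) (coordCenter p) X Y ∈
      (normalSpace (n := n) f p)ᗮ := (Submodule.starProjection_apply_eq_zero_iff _).1 hXY
  rw [normalSpace, Submodule.orthogonal_orthogonal] at hmem
  obtain ⟨Z, hZ⟩ := hmem
  exact ⟨Z, by rw [← hZ, prodDeriv_apply hf]⟩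

-- For the normal vector `ξ = α(X, Y)` adaptedness gives `‖α(X, Y)‖² = ⟨A_ξ X, Y⟩ = 0`.
theorem secondFundamentalForm_single_single_eq_zero (hadapted : IsAdaptedToProductNet n f)
    {p : ∀ i, M i} {i j : Fin k}
    (horth : ∀ (X : TangentSpace (𝓡 (n i)) (p i)) (Y : TangentSpace (𝓡 (n j)) (p j)),
      inner ℝ (prodDeriv f p (Pi.single i X)) (prodDeriv f p (Pi.single j Y)) = 0)
    (X : TangentSpace (𝓡 (n i)) (p i)) (Y : TangentSpace (𝓡 (n j)) (p j)) :
    secondFundamentalForm f p (Pi.single i X) (Pi.single j Y) = 0 := by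
  obtain ⟨Z, hZ, hshape⟩ := hadapted p i _
    (secondFundamentalForm_mem_normalSpace p (Pi.single i X) (Pi.single j Y)) _
    (single_mem_productNet p i X)
  rw [← inner_self_eq_zero (𝕜 := ℝ), ← hshape, eq_single_of_mem_productNet hZ]
  exact horth (Z i) Y

end Adapted

section Conformal

variable {k N : ℕ} {n : Fin k → ℕ} {M : Fin k → Type*} [∀ i, TopologicalSpace (M i)]
  [∀ i, ChartedSpace (Euc (n i)) (M i)] [∀ i, IsManifold (𝓡 (n i)) ∞ (M i)]
  {g : ∀ i, RiemMetric (n i) (M i)}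

theorem metricAt_zero_left {n : ℕ} {M : Type*} [TopologicalSpace M] [ChartedSpace (Euc n) M]
    [IsManifold (𝓡 n) ∞ M] (g : RiemMetric n M) (x : M) (X : Euc n) : metricAt g x 0 X = 0 :=
  congrArg (fun T : TangentSpace (𝓡 n) x →L[ℝ] ℝ => T X) (map_zero (g.inner x))

theorem prodMetric_single_left (p : ∀ i, M i) (i : Fin k) (X : Euc (n i)) (v : ∀ i, Euc (n i)) :
    prodMetric g p (Pi.single i X : ∀ i, Euc (n i)) v = metricAt (g i) (p i) X (v i) := by
  change ∑ l, metricAt (g l) (p l) ((Pi.single i X : ∀ i, Euc (n i)) l) (v l) = _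
  rw [Finset.sum_eq_single_of_mem i (Finset.mem_univ i), Pi.single_eq_same]
  intro l _ hl
  rw [Pi.single_eq_of_ne hl, metricAt_zero_left]

/-- `f` is a conformal immersion of the Riemannian product with conformal factor `φ`. -/
structure IsConformalWithFactor (g : ∀ i, RiemMetric (n i) (M i)) (f : (∀ i, M i) → Euc N)
    (φ : (∀ i, M i) → ℝ) : Prop where
  contMDiff : ContMDiff (prodModel n) 𝓘(ℝ, Euc N) ∞ f
  contMDiff_factor : ContMDiff (prodModel n) 𝓘(ℝ, ℝ) ∞ φ
  factor_pos : ∀ p, 0 < φ p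
  inner_prodDeriv : ∀ (p : ∀ i, M i) (X Y : ∀ i, TangentSpace (𝓡 (n i)) (p i)),
    inner ℝ (prodDeriv f p X) (prodDeriv f p Y) = φ p ^ 2 * prodMetric g p X Y

/-- The lift `φ⁻¹ • E ∘ f` to the light cone of a conformal map `f` with conformal factor `φ`, which
is isometric. -/
noncomputable def ConeTriple.lift {P : Type*} (τ : ConeTriple N) (f : P → Euc N) (φ : P → ℝ)
    (p : P) : Mink (N + 1) :=
  (φ p)⁻¹ • τ.embed (f p)

theorem ConeTriple.lor_lift_self {P : Type*} (τ : ConeTriple N) (f : P → Euc N) (φ : P → ℝ)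
    (p : P) : lor (τ.lift f φ p) (τ.lift f φ p) = 0 := by
  simp [ConeTriple.lift, τ.lor_embed_embed]

namespace IsConformalWithFactor

variable {f : (∀ i, M i) → Euc N} {φ : (∀ i, M i) → ℝ} (hf : IsConformalWithFactor g f φ)
include hf

theorem inner_fderiv (p : ∀ i, M i) (v v' : ∀ i, Euc (n i)) :
    inner ℝ (fderiv ℝ (f ∘ coordMap (n := n) p) (coordCenter p) v)
      (fderiv ℝ (f ∘ coordMap (n := n) p) (coordCenter p) v') = φ p ^ 2 * prodMetric g p v v' :=
  (congrArg₂ (fun x y : Euc N => inner ℝ x y) (prodDeriv_apply hf.contMDiff p v).symm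
    (prodDeriv_apply hf.contMDiff p v').symm).trans (hf.inner_prodDeriv p v v')

theorem inner_fderiv_single_single (p : ∀ i, M i) {i j : Fin k} (hij : i ≠ j) (X : Euc (n i))
    (Y : Euc (n j)) :
    inner ℝ (fderiv ℝ (f ∘ coordMap (n := n) p) (coordCenter p) (Pi.single i X))
      (fderiv ℝ (f ∘ coordMap (n := n) p) (coordCenter p) (Pi.single j Y)) = 0 := by
  rw [hf.inner_fderiv, prodMetric_single_left, Pi.single_eq_of_ne hij, metricAt_zero_right,
    mul_zero]

theorem contDiffAt_inv_factor (p : ∀ i, M i) :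
    ContDiffAt ℝ ∞ (fun y => (φ (coordMap (n := n) p y))⁻¹) (coordCenter p) :=
  (smoothInCharts_of_contMDiff hf.contMDiff_factor p).inv (hf.factor_pos _).ne'

variable (τ : ConeTriple N)

theorem smoothInCharts_lift : SmoothInCharts n (τ.lift f φ) := fun p =>
  (hf.contDiffAt_inv_factor p).smul
    (τ.contDiff_embed.contDiffAt.comp _ (smoothInCharts_of_contMDiff hf.contMDiff p))

theorem lor_fderiv_lift (p : ∀ i, M i) (v v' : ∀ i, Euc (n i)) :
    lor (fderiv ℝ (τ.lift f φ ∘ coordMap (n := n) p) (coordCenter p) v)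
      (fderiv ℝ (τ.lift f φ ∘ coordMap (n := n) p) (coordCenter p) v') = prodMetric g p v v' := by
  refine (τ.lor_fderiv_lift ((hf.contDiffAt_inv_factor p).differentiableAt (by simp))
    ((smoothInCharts_of_contMDiff hf.contMDiff p).differentiableAt (by simp)) v v').trans ?_
  rw [hf.inner_fderiv, coordMap_coordCenter, ← mul_assoc, ← mul_pow,
    inv_mul_cancel₀ (hf.factor_pos p).ne', one_pow, one_mul]

theorem isProductIsometry_lift : IsProductIsometry (lorForm (N + 1)) g (τ.lift f φ) := by
  have hs := hf.smoothInCharts_lift τ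
  refine ⟨hs, fun p i j hij X Y => ?_, fun p i X Y => ?_⟩
  · rw [chartDeriv_slice hs, chartDeriv_slice hs, lorForm_apply, hf.lor_fderiv_lift,
      prodMetric_single_left, Pi.single_eq_of_ne hij, metricAt_zero_right]
  · rw [chartDeriv_slice hs, chartDeriv_slice hs, lorForm_apply, hf.lor_fderiv_lift,
      prodMetric_single_left, Pi.single_eq_same]

theorem secondFundamentalForm_single_single (hadapted : IsAdaptedToProductNet n f)
    (p : ∀ i, M i) {i j : Fin k} (hij : i ≠ j) (a : Euc (n i)) (b : Euc (n j)) :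
    secondFundamentalForm (n := n) f p (Pi.single i a : ∀ i, Euc (n i))
      (Pi.single j b : ∀ i, Euc (n i)) = 0 :=
  secondFundamentalForm_single_single_eq_zero hadapted (fun X Y => by
    rw [prodDeriv_apply hf.contMDiff, prodDeriv_apply hf.contMDiff]
    exact hf.inner_fderiv_single_single p hij X Y) a b

theorem mixedDerivZero_lift (hn : ∀ i, 1 ≤ n i) (hn3 : 3 ≤ ∑ i, n i)
    (hadapted : IsAdaptedToProductNet n f) : MixedDerivZero n (τ.lift f φ) := by
  refine (hf.isProductIsometry_lift τ).mixedDerivZero lor_comm hn hn3 (τ.lor_lift_self f φ)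
    fun p i j hij a b => ?_
  obtain ⟨Z, hZ⟩ := exists_fderiv_fderiv_eq_of_secondFundamentalForm_eq_zero hf.contMDiff
    (hf.secondFundamentalForm_single_single hadapted p hij a b)
  obtain ⟨s, Y, hY⟩ := τ.exists_fderiv_fderiv_lift_eq
    (contDiffAt_infty.1 (hf.contDiffAt_inv_factor p) 2)
    (contDiffAt_infty.1 (smoothInCharts_of_contMDiff hf.contMDiff p) 2)
    (inv_ne_zero (hf.factor_pos _).ne') (hf.inner_fderiv_single_single p hij a b) hZ
  refine ⟨s, Y, hY.trans ?_⟩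
  rw [Function.comp_apply, coordMap_coordCenter]
  rfl

end IsConformalWithFactor

end Conformal

section Immersion

variable {n : ℕ} {M : Type*} [TopologicalSpace M] [ChartedSpace (Euc n) M]
  {V W : Type*} [NormedAddCommGroup V] [NormedSpace ℝ V]
  [NormedAddCommGroup W] [NormedSpace ℝ W]

theorem hasFDerivAt_chartDeriv {G : M → V} {x : M} (hG : MDifferentiableAt (𝓡 n) 𝓘(ℝ, V) G x) :
    HasFDerivAt (G ∘ (extChartAt (𝓡 n) x).symm) (chartDeriv n G x) (extChartAt (𝓡 n) x x) := by
  have h : HasFDerivWithinAt (G ∘ (extChartAt (𝓡 n) x).symm) (chartDeriv n G x)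
      (Set.range (𝓡 n)) (extChartAt (𝓡 n) x x) := (hasMFDerivAt_chartDeriv hG).2
  rwa [ModelWithCorners.range_eq_univ, hasFDerivWithinAt_univ] at h

theorem chartDeriv_const (v : V) (x : M) : chartDeriv n (fun _ => v) x = 0 :=
  fderiv_const_apply v

theorem chartDeriv_clm_add {G : M → V} {x : M} (hG : MDifferentiableAt (𝓡 n) 𝓘(ℝ, V) G x)
    (T : V →L[ℝ] W) (c : W) (X : Euc n) :
    chartDeriv n (fun y => T (G y) + c) x X = T (chartDeriv n G x X) :=
  congrArg (fun D : Euc n →L[ℝ] W => D X)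
    ((T.hasFDerivAt.comp _ (hasFDerivAt_chartDeriv hG)).add_const c).fderiv

theorem chartDeriv_add_const {G : M → V} {x : M} (hG : MDifferentiableAt (𝓡 n) 𝓘(ℝ, V) G x)
    (c : V) : chartDeriv n (fun y => G y + c) x = chartDeriv n G x :=
  ((hasFDerivAt_chartDeriv hG).add_const c).fderiv

theorem chartDeriv_clm {G : M → V} {x : M} (hG : MDifferentiableAt (𝓡 n) 𝓘(ℝ, V) G x)
    (T : V →L[ℝ] W) (X : Euc n) :
    chartDeriv n (fun y => T (G y)) x X = T (chartDeriv n G x X) := by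
  simpa only [add_zero] using chartDeriv_clm_add hG T 0 X

theorem contMDiff_clm_add {G : M → V} (hG : ContMDiff (𝓡 n) 𝓘(ℝ, V) ∞ G)
    (T : V →L[ℝ] W) (c : W) : ContMDiff (𝓡 n) 𝓘(ℝ, W) ∞ fun y => T (G y) + c :=
  ContDiff.comp_contMDiff (g := fun v => T v + c) (T.contDiff.add contDiff_const) hG

theorem inner_chartDeriv_eq_zero {E : Type*} [NormedAddCommGroup E] [InnerProductSpace ℝ E]
    {G : M → E} {x : M} (hG : MDifferentiableAt (𝓡 n) 𝓘(ℝ, E) G x) {ρ : ℝ}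
    (hρ : ∀ y, inner ℝ (G y) (G y) = ρ) (X : Euc n) : inner ℝ (G x) (chartDeriv n G x X) = 0 := by
  have hd := hasFDerivAt_chartDeriv hG
  have hconst : (fun z => inner ℝ ((G ∘ (extChartAt (𝓡 n) x).symm) z)
      ((G ∘ (extChartAt (𝓡 n) x).symm) z)) = fun _ => ρ := funext fun z => hρ _
  have hder := hd.inner ℝ hd
  rw [hconst] at hder
  have hX := congrArg (fun D : Euc n →L[ℝ] ℝ => D X) (hder.unique (hasFDerivAt_const _ _))
  simp only [ContinuousLinearMap.comp_apply, ContinuousLinearMap.prod_apply,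
    fderivInnerCLM_apply, Function.comp_apply, extChartAt_to_inv, zero_apply] at hX
  rw [real_inner_comm (G x)] at hX
  linarith

variable [IsManifold (𝓡 n) ∞ M]

theorem eq_of_chartDeriv_eq_zero [PreconnectedSpace M] {G : M → V}
    (hG : ∀ x, MDifferentiableAt (𝓡 n) 𝓘(ℝ, V) G x) (h : ∀ x X, chartDeriv n G x X = 0)
    (x y : M) : G x = G y := by
  have : IsManifold (𝓡 n) 1 M := IsManifold.of_le (n := ∞) (by simp)
  exact eq_of_hasMFDerivAt_zero (fun z => (hasMFDerivAt_chartDeriv (hG z)).congr_mfderiv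
    (ContinuousLinearMap.ext (h z))) x y

namespace IsIsometricImmersion

variable {g : RiemMetric n M} {B : V → V → ℝ} {B' : W → W → ℝ} {G : M → V}

theorem of_chartDeriv (hG : ContMDiff (𝓡 n) 𝓘(ℝ, V) ∞ G)
    (h : ∀ x X Y, B (chartDeriv n G x X) (chartDeriv n G x Y) = metricAt g x X Y) :
    IsIsometricImmersion g B G := by
  refine ⟨hG, fun p u v => ?_⟩
  have hd := (hG p).mdifferentiableAt (by simp)
  exact (congrArg₂ B (mfderiv_apply_eq_chartDeriv hd u) (mfderiv_apply_eq_chartDeriv hd v)).trans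
    (h p u v)

variable (hG : IsIsometricImmersion g B G)
include hG

theorem mdifferentiableAt (x : M) : MDifferentiableAt (𝓡 n) 𝓘(ℝ, V) G x :=
  (hG.1 x).mdifferentiableAt (by simp)

theorem chartDeriv_chartDeriv (x : M) (X Y : Euc n) :
    B (chartDeriv n G x X) (chartDeriv n G x Y) = metricAt g x X Y :=
  (congrArg₂ B (mfderiv_apply_eq_chartDeriv (hG.mdifferentiableAt x) X).symm
    (mfderiv_apply_eq_chartDeriv (hG.mdifferentiableAt x) Y).symm).trans (hG.2 x X Y)

theorem clm_add (T : V →L[ℝ] W)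
    (hT : ∀ x X Y, B' (T (chartDeriv n G x X)) (T (chartDeriv n G x Y)) =
      B (chartDeriv n G x X) (chartDeriv n G x Y)) (c : W) :
    IsIsometricImmersion g B' fun x => T (G x) + c := by
  refine of_chartDeriv (contMDiff_clm_add hG.1 T c) fun x X Y => ?_
  rw [chartDeriv_clm_add (hG.mdifferentiableAt x), chartDeriv_clm_add (hG.mdifferentiableAt x), hT,
    hG.chartDeriv_chartDeriv]

theorem leftInverse_add {K : W →L[ℝ] V} (hK : ∀ x y, B (K x) (K y) = B' x y) (T : V →L[ℝ] W)
    (hKT : ∀ x, K (T (G x)) = G x) (c : W) :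
    IsIsometricImmersion g B' fun x => T (G x) + c := by
  have hder : ∀ x X, K (T (chartDeriv n G x X)) = chartDeriv n G x X := fun x X => by
    rw [← ContinuousLinearMap.comp_apply, ← chartDeriv_clm (hG.mdifferentiableAt x)]
    simp only [ContinuousLinearMap.comp_apply, hKT]
  exact hG.clm_add T (fun x X Y => by rw [← hK, hder, hder]) c

theorem exists_chartDeriv_pos (hn : 1 ≤ n) (x : M) :
    ∃ X, 0 < B (chartDeriv n G x X) (chartDeriv n G x X) := by
  have : Nonempty (Fin n) := ⟨⟨0, hn⟩⟩
  obtain ⟨X, hX⟩ := exists_ne (0 : Euc n)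
  exact ⟨X, by rw [hG.chartDeriv_chartDeriv]; exact metricAt_pos g x hX⟩

end IsIsometricImmersion

theorem two_le_of_inner_eq_zero {m : ℕ} {x y : Euc m} (hx : x ≠ 0) (hy : y ≠ 0)
    (hxy : inner ℝ x y = 0) : 2 ≤ m := by
  have h : LinearIndependent ℝ ![x, y] := by
    refine linearIndependent_of_ne_zero_of_inner_eq_zero ?_ ?_
    · intro i; fin_cases i <;> simp [hx, hy]
    · intro i j hij
      fin_cases i <;> fin_cases j <;> simp_all [real_inner_comm]
  simpa using h.fintype_card_le_finrank

theorem IsIsometricImmersion.pos_and_two_le_of_inner_self_eq {g : RiemMetric n M} {m : ℕ}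
    {h : M → Euc m} (hh : IsIsometricImmersion g (inner ℝ) h) (hn : 1 ≤ n) (x : M) {ρ : ℝ}
    (hρ : ∀ y, inner ℝ (h y) (h y) = ρ) : 0 < ρ ∧ 2 ≤ m := by
  obtain ⟨X, hX⟩ := hh.exists_chartDeriv_pos hn x
  have hX0 : chartDeriv n h x X ≠ 0 := fun h0 => by simp [h0] at hX
  have hx0 : h x ≠ 0 := by
    intro h0
    have hρ0 : ρ = 0 := by rw [← hρ x, h0, inner_zero_left]
    have hzero : h = fun _ => 0 := funext fun y => inner_self_eq_zero.1 ((hρ y).trans hρ0)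
    rw [hzero, chartDeriv_const] at hX0
    exact hX0 rfl
  exact ⟨hρ x ▸ real_inner_self_pos.2 hx0, two_le_of_inner_eq_zero hx0 hX0
    (inner_chartDeriv_eq_zero (hh.mdifferentiableAt x) hρ X)⟩

end Immersion

section Extrinsic

variable {ι : Type} {d : ℕ}

theorem sum_apply_update {ι A : Type*} [Fintype ι] [DecidableEq ι] [AddCommMonoid A] {X : ι → Type*}
    (φ : ∀ i, X i → A) (p : ∀ i, X i) (i : ι) (x : X i) :
    ∑ l, φ l (Function.update p i x l) = φ i x + ∑ l ∈ Finset.univ \ {i}, φ l (p l) := by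
  simp only [Function.apply_update, Finset.sum_update_of_mem (Finset.mem_univ i)]

theorem exists_linearIsometry_range (S : Submodule ℝ (Euc d)) :
    ∃ (m : ℕ) (L : Euc m →ₗᵢ[ℝ] Euc d), LinearMap.range L.toLinearMap = S := by
  refine ⟨Module.finrank ℝ S,
    S.subtypeₗᵢ.comp (stdOrthonormalBasis ℝ S).repr.symm.toLinearIsometry, ?_⟩
  ext x
  constructor
  · rintro ⟨y, rfl⟩
    exact ((stdOrthonormalBasis ℝ S).repr.symm y).2
  · intro hx
    exact ⟨(stdOrthonormalBasis ℝ S).repr ⟨x, hx⟩, by simp⟩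

theorem inner_adjoint_isometry {m : ℕ} (L : Euc m →ₗᵢ[ℝ] Euc d) (y : Euc d) (x : Euc m) :
    inner ℝ (L.toContinuousLinearMap.adjoint y) x = inner ℝ y (L x) :=
  ContinuousLinearMap.adjoint_inner_left _ _ _

theorem adjoint_isometry_apply {m : ℕ} (L : Euc m →ₗᵢ[ℝ] Euc d) (x : Euc m) :
    L.toContinuousLinearMap.adjoint (L x) = x :=
  ext_inner_right ℝ fun y => by rw [inner_adjoint_isometry, L.inner_map_map]

variable [Fintype ι]

theorem inner_sub_sum_adjoint_eq_zero {m : ι → ℕ} {L : ∀ i, Euc (m i) →ₗᵢ[ℝ] Euc d}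
    (horth : ∀ i j, i ≠ j → ∀ x y, inner ℝ (L i x) (L j y) = 0) (b : Euc d) (i : ι)
    (x : Euc (m i)) :
    inner ℝ (L i x) (b - ∑ j, L j ((L j).toContinuousLinearMap.adjoint b)) = 0 := by
  rw [inner_sub_right, inner_sum,
    Finset.sum_eq_single_of_mem i (Finset.mem_univ i) fun j _ hj => horth i j hj.symm _ _,
    (L i).inner_map_map, real_inner_comm _ x, inner_adjoint_isometry, real_inner_comm, sub_self]

theorem ExtrinsicProduct.inner_map_self (Ψ : ExtrinsicProduct ι d) (x : ∀ i, Euc (Ψ.m i)) :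
    inner ℝ (Ψ.map x) (Ψ.map x) = ∑ i, inner ℝ (x i) (x i) + inner ℝ Ψ.v Ψ.v := by
  have hv : inner ℝ (∑ i, Ψ.L i (x i)) Ψ.v = 0 := by
    rw [sum_inner]
    exact Finset.sum_eq_zero fun i _ => Ψ.v_orth i _
  have hsum : inner ℝ (∑ i, Ψ.L i (x i)) (∑ i, Ψ.L i (x i)) = ∑ i, inner ℝ (x i) (x i) := by
    rw [sum_inner]
    refine Finset.sum_congr rfl fun i _ => ?_
    rw [inner_sum,
      Finset.sum_eq_single_of_mem i (Finset.mem_univ i) fun j _ hj => Ψ.orth i j hj.symm _ _,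
      (Ψ.L i).inner_map_map]
  rw [ExtrinsicProduct.map, real_inner_add_add_self, hsum, hv]
  ring

variable {n : ι → ℕ} {M : ι → Type*} [∀ i, TopologicalSpace (M i)]
  [∀ i, ChartedSpace (Euc (n i)) (M i)] [∀ i, IsManifold (𝓡 (n i)) ∞ (M i)]
  {g : ∀ i, RiemMetric (n i) (M i)}

theorem exists_extrinsicProduct_univ {H : ∀ i, M i → Euc d}
    (hH : ∀ i, IsIsometricImmersion (g i) (inner ℝ) (H i))
    (horth : ∀ i j, i ≠ j → ∀ x y, inner ℝ (H i x) (H j y) = 0) (b : Euc d) :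
    ∃ (Ψ : ExtrinsicProduct ι d) (h : ∀ i, M i → Euc (Ψ.m i)), (∀ i, Ψ.N i = Set.univ) ∧
      (∀ i, IsIsometricImmersion (g i) (inner ℝ) (h i)) ∧
      ∀ p : ∀ i, M i, Ψ.map (fun i => h i (p i)) = ∑ i, H i (p i) + b := by
  choose m L hL using fun i => exists_linearIsometry_range (Submodule.span ℝ (Set.range (H i)))
  have hmem : ∀ i x, L i x ∈ Submodule.span ℝ (Set.range (H i)) := fun i x => hL i ▸ ⟨x, rfl⟩
  have hLorth : ∀ i j, i ≠ j → ∀ x y, inner ℝ (L i x) (L j y) = 0 := fun i j hij x y =>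
    Submodule.isOrtho_iff_inner_eq.1 (Submodule.isOrtho_span.2 (by
      rintro _ ⟨q, rfl⟩ _ ⟨r, rfl⟩
      exact horth i j hij q r)) _ (hmem i x) _ (hmem j y)
  have hproj : ∀ i q, L i ((L i).toContinuousLinearMap.adjoint (H i q)) = H i q := fun i q => by
    obtain ⟨y, hy⟩ : H i q ∈ LinearMap.range (L i).toLinearMap :=
      hL i ▸ Submodule.subset_span ⟨q, rfl⟩
    rw [← hy]
    exact congrArg (L i) (adjoint_isometry_apply (L i) y)
  refine ⟨⟨m, L, hLorth, b - ∑ i, L i ((L i).toContinuousLinearMap.adjoint b),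
    inner_sub_sum_adjoint_eq_zero hLorth b, fun _ => Set.univ, fun _ => Or.inl rfl⟩,
    fun i x => (L i).toContinuousLinearMap.adjoint (H i x) +
      (L i).toContinuousLinearMap.adjoint b, fun _ => rfl, fun i => ?_, fun p => ?_⟩
  · exact (hH i).leftInverse_add (K := (L i).toContinuousLinearMap) (L i).inner_map_map _
      (hproj i) _
  · simp only [ExtrinsicProduct.map, map_add, Finset.sum_add_distrib, hproj]
    abel

theorem exists_extrinsicProduct_isSpherical [∀ i, Nonempty (M i)] (hn : ∀ i, 1 ≤ n i)
    {H : ∀ i, M i → Euc d}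
    (hH : ∀ i, IsIsometricImmersion (g i) (inner ℝ) (H i))
    (horth : ∀ i j, i ≠ j → ∀ x y, inner ℝ (H i x) (H j y) = 0) (b : Euc d) {c : ℝ}
    (hc : ∀ p : ∀ i, M i, ∑ i, H i (p i) + b ∈ sphereCurv d c) :
    ∃ (Ψ : ExtrinsicProduct ι d) (h : ∀ i, M i → Euc (Ψ.m i)), Ψ.IsSpherical c ∧
      (∀ i, IsIsometricImmersion (g i) (inner ℝ) (h i) ∧ ∀ q, h i q ∈ Ψ.N i) ∧
      ∀ p : ∀ i, M i, Ψ.map (fun i => h i (p i)) = ∑ i, H i (p i) + b := by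
  classical
  obtain ⟨Ψ, h, -, hh, hmap⟩ := exists_extrinsicProduct_univ hH horth b
  let o : ∀ i, M i := fun i => Classical.arbitrary (M i)
  have hsum : ∀ p : ∀ i, M i,
      ∑ i, inner ℝ (h i (p i)) (h i (p i)) + inner ℝ Ψ.v Ψ.v = 1 / c := fun p => by
    rw [← Ψ.inner_map_self, hmap]
    exact hc p
  set ρ : ι → ℝ := fun i => inner ℝ (h i (o i)) (h i (o i))
  have hconst : ∀ i x, inner ℝ (h i x) (h i x) = ρ i := fun i x => by
    have hx := (hsum (Function.update o i x)).trans (hsum (Function.update o i (o i))).symm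
    rw [sum_apply_update (fun i y => inner ℝ (h i y) (h i y)) o i x,
      sum_apply_update (fun i y => inner ℝ (h i y) (h i y)) o i (o i)] at hx
    linarith
  have hpos := fun i => (hh i).pos_and_two_le_of_inner_self_eq (hn i) (o i) (hconst i)
  have hspheres : ∀ i, 2 ≤ Ψ.m i ∧ ∃ c' : ℝ, 0 < c' ∧
      sphereCurv (Ψ.m i) (1 / ρ i) = sphereCurv (Ψ.m i) c' := fun i =>
    ⟨(hpos i).2, _, one_div_pos.2 (hpos i).1, rfl⟩
  let Ψ' : ExtrinsicProduct ι d :=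
    { Ψ with
      N := fun i => sphereCurv (Ψ.m i) (1 / ρ i)
      N_eq := fun i => Or.inr (hspheres i) }
  refine ⟨Ψ', h, ⟨hspheres, fun x hx => ?_⟩, fun i => ⟨hh i, fun q => ?_⟩, hmap⟩
  · have hx' : ∀ i, inner ℝ (x i) (x i) = ρ i := fun i => (hx i).trans (one_div_one_div _)
    change inner ℝ (Ψ'.map x) (Ψ'.map x) = 1 / c
    rw [Ψ'.inner_map_self, ← hsum o, Finset.sum_congr rfl fun i _ => hx' i]
  · exact (hconst i q).trans (one_div_one_div _).symm

end Extrinsic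

section LorentzSubspaces

variable {d m l : ℕ}

theorem exists_lor_orthonormal_basis {S : Submodule ℝ (Mink d)}
    (hS : ∀ x ∈ S, x ≠ 0 → 0 < lor x x) :
    ∃ b : Module.Basis (Fin (Module.finrank ℝ S)) ℝ S,
      ∀ i j, lor (b i : Mink d) (b j) = if i = j then 1 else 0 := by
  let B : LinearMap.BilinForm ℝ S :=
    LinearMap.mk₂ ℝ (fun x y : S => lor (x : Mink d) (y : Mink d)) (by simp) (by simp) (by simp)
      (by simp)
  obtain ⟨v, hv⟩ := LinearMap.BilinForm.exists_orthogonal_basis (B := B) ⟨fun x y => lor_comm _ _⟩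
  have hpos : ∀ i, 0 < lor (v i : Mink d) (v i) := fun i =>
    hS _ (v i).2 (by simpa using v.ne_zero i)
  have hunit : ∀ i, IsUnit (√(lor (v i : Mink d) (v i)))⁻¹ := fun i =>
    (inv_ne_zero (Real.sqrt_pos.2 (hpos i)).ne').isUnit
  refine ⟨v.isUnitSMul hunit, fun i j => ?_⟩
  simp only [Module.Basis.isUnitSMul_apply, Submodule.coe_smul, lor_smul_left, lor_smul_right]
  split_ifs with hij
  · rw [← hij, ← mul_assoc, ← mul_inv, Real.mul_self_sqrt (hpos i).le, inv_mul_cancel₀ (hpos i).ne']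
  · rw [show lor (v i : Mink d) (v j) = 0 from hv hij, mul_zero, mul_zero]

theorem exists_isometry_of_posDef (S : Submodule ℝ (Mink d))
    (hS : ∀ x ∈ S, x ≠ 0 → 0 < lor x x) :
    ∃ (m : ℕ) (K : Euc m →ₗ[ℝ] Mink d), (∀ x y, lor (K x) (K y) = inner ℝ x y) ∧
      LinearMap.range K = S := by
  obtain ⟨b, hb⟩ := exists_lor_orthonormal_basis hS
  let e : Euc (Module.finrank ℝ S) ≃ₗ[ℝ] S := (WithLp.linearEquiv 2 ℝ _).trans b.equivFun.symm
  have he : ∀ x, (e x : Mink d) = ∑ i, x i • (b i : Mink d) := fun x => by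
    simp [e, Module.Basis.equivFun_symm_apply]
  refine ⟨_, S.subtype.comp e.toLinearMap, fun x y => ?_, ?_⟩
  · simp [he, lor_sum_left, lor_sum_right, hb, PiLp.inner_apply, mul_comm]
  · rw [LinearMap.range_comp, LinearEquiv.range, Submodule.map_top, Submodule.range_subtype]

theorem apply_lorAdjoint_of_mem {K : Euc m →ₗ[ℝ] Mink d}
    (hK : ∀ x y, lor (K x) (K y) = inner ℝ x y) {Z : Mink d} (hZ : Z ∈ LinearMap.range K) :
    K (lorAdjoint K Z) = Z := by
  obtain ⟨y, rfl⟩ := hZ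
  rw [lorAdjoint_apply_self hK]

/-- The orthogonal complement with respect to the Lorentz product. -/
def lorOrth (S : Submodule ℝ (Mink d)) : Submodule ℝ (Mink d) where
  carrier := {x | ∀ y ∈ S, lor x y = 0}
  add_mem' := fun hx hx' y hy => by rw [lor_add_left, hx y hy, hx' y hy, add_zero]
  zero_mem' := fun y _ => lor_zero_left y
  smul_mem' := fun a x hx y hy => by rw [lor_smul_left, hx y hy, mul_zero]

theorem mem_lorOrth {S : Submodule ℝ (Mink d)} {x : Mink d} :
    x ∈ lorOrth S ↔ ∀ y ∈ S, lor x y = 0 := Iff.rfl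

theorem mem_lorOrth_singleton {u x : Mink d} :
    x ∈ lorOrth (Submodule.span ℝ {u}) ↔ lor x u = 0 := by
  refine ⟨fun h => h u (Submodule.mem_span_singleton_self u), fun h y hy => ?_⟩
  obtain ⟨a, rfl⟩ := Submodule.mem_span_singleton.1 hy
  rw [lor_smul_right, h, mul_zero]

theorem lor_self_pos_of_mem_lorOrth {S : Submodule ℝ (Mink d)} {v : Mink d} (hv : v ∈ S)
    (hvv : lor v v < 0) {x : Mink d} (hx : x ∈ lorOrth S) (hx0 : x ≠ 0) : 0 < lor x x :=
  lor_self_pos_of_timelike hvv (lor_comm v x ▸ hx v hv) hx0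

theorem exists_sub_mem_lorOrth {S : Submodule ℝ (Mink d)} (hS : ∀ x ∈ S, x ≠ 0 → 0 < lor x x)
    (Z : Mink d) : ∃ x ∈ S, Z - x ∈ lorOrth S := by
  obtain ⟨m, K, hK, rfl⟩ := exists_isometry_of_posDef S hS
  refine ⟨K (lorAdjoint K Z), ⟨_, rfl⟩, ?_⟩
  rintro _ ⟨x, rfl⟩
  rw [lor_sub_left, hK, inner_lorAdjoint, sub_self]

theorem lor_self_pos_of_mem_iSup {ι : Type*} {S : ι → Submodule ℝ (Mink d)}
    (horth : ∀ i j, i ≠ j → ∀ x ∈ S i, ∀ y ∈ S j, lor x y = 0)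
    (hS : ∀ i, ∀ x ∈ S i, x ≠ 0 → 0 < lor x x) {x : Mink d} (hx : x ∈ ⨆ i, S i) (hx0 : x ≠ 0) :
    0 < lor x x := by
  obtain ⟨y, hy, rfl⟩ := (Submodule.mem_iSup_iff_exists_finsupp S x).1 hx
  rw [Finsupp.sum] at hx0 ⊢
  have hsum : lor (∑ i ∈ y.support, y i) (∑ i ∈ y.support, y i) =
      ∑ i ∈ y.support, lor (y i) (y i) := by
    rw [lor_sum_left]
    refine Finset.sum_congr rfl fun i hi => ?_
    rw [lor_sum_right]
    exact Finset.sum_eq_single_of_mem i hi fun j _ hj => horth i j hj.symm _ (hy i) _ (hy j)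
  rw [hsum]
  exact Finset.sum_pos (fun i hi => hS i _ (hy i) (Finsupp.mem_support_iff.1 hi))
    (Finset.nonempty_of_sum_ne_zero hx0)

theorem exists_smul_lor_self_eq_neg_one {v : Mink d} (hv : lor v v < 0) :
    ∃ a : ℝ, 0 < a ∧ lor (a • v) (a • v) = -1 := by
  refine ⟨(√(-lor v v))⁻¹, inv_pos.2 (Real.sqrt_pos.2 (neg_pos.2 hv)), ?_⟩
  rw [lor_smul_left, lor_smul_right, ← mul_assoc, ← mul_inv, Real.mul_self_sqrt (by linarith),
    inv_neg, neg_mul, inv_mul_cancel₀ hv.ne]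

theorem exists_mink_isometry_range (S : Submodule ℝ (Mink d)) {v : Mink d} (hv : v ∈ S)
    (hvv : lor v v < 0) :
    ∃ (m : ℕ) (C : Mink m →ₗ[ℝ] Mink d), (∀ X Y, lor (C X) (C Y) = lor X Y) ∧
      LinearMap.range C = S := by
  obtain ⟨a, -, huu⟩ := exists_smul_lor_self_eq_neg_one hvv
  set u := a • v
  have huS : u ∈ S := S.smul_mem a hv
  obtain ⟨m, K, hK, hKr⟩ := exists_isometry_of_posDef (S ⊓ lorOrth (Submodule.span ℝ {u}))
    fun x hx => lor_self_pos_of_mem_lorOrth (Submodule.mem_span_singleton_self u) (by linarith) hx.2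
  have hKm : ∀ x, K x ∈ S ⊓ lorOrth (Submodule.span ℝ {u}) := fun x => hKr ▸ ⟨x, rfl⟩
  have hKu : ∀ x, lor (K x) u = 0 := fun x => mem_lorOrth_singleton.1 (hKm x).2
  have hC : ∀ X, K.coprod (LinearMap.toSpanSingleton ℝ _ u) X = K X.1 + X.2 • u := fun X => by simp
  refine ⟨m, K.coprod (LinearMap.toSpanSingleton ℝ _ u), fun X Y => ?_,
    le_antisymm ?_ fun Z hZ => ?_⟩
  · simp only [hC, lor_add_left, lor_add_right, lor_smul_left, lor_smul_right, hK, hKu, huu,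
      lor_comm u (K _)]
    rw [lor]
    ring
  · rintro _ ⟨X, rfl⟩
    exact hC X ▸ S.add_mem (hKm _).1 (S.smul_mem _ huS)
  · have horth : Z + lor Z u • u ∈ LinearMap.range K := hKr ▸
      ⟨S.add_mem hZ (S.smul_mem _ huS), mem_lorOrth_singleton.2 (by simp [huu])⟩
    obtain ⟨x, hx⟩ := horth
    exact ⟨(x, -lor Z u), by rw [hC, hx]; module⟩

/-- The adjoint of a linear map of Lorentz spaces, with respect to the Lorentz products. -/
noncomputable def minkAdjoint (C : Mink m →ₗ[ℝ] Mink d) : Mink d →L[ℝ] Mink m :=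
  (lorAdjoint (C.comp (LinearMap.inl ℝ (Euc m) ℝ))).prod (-lorForm d (C (0, 1)))

theorem lor_minkAdjoint (C : Mink m →ₗ[ℝ] Mink d) (Z : Mink d) (X : Mink m) :
    lor (minkAdjoint C Z) X = lor Z (C X) := by
  have hX : X = LinearMap.inl ℝ (Euc m) ℝ X.1 + X.2 • ((0, 1) : Mink m) := by ext <;> simp
  conv_rhs => rw [hX, map_add, map_smul, lor_add_right, lor_smul_right, lor_comm Z (C (0, 1))]
  simp only [lor, minkAdjoint, ContinuousLinearMap.prod_apply, neg_apply, inner_lorAdjoint,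
    LinearMap.comp_apply, lorForm_apply]
  ring

theorem minkAdjoint_apply_self {C : Mink m →ₗ[ℝ] Mink d}
    (hC : ∀ X Y, lor (C X) (C Y) = lor X Y) (X : Mink m) : minkAdjoint C (C X) = X :=
  sub_eq_zero.1 <| eq_zero_of_lor_eq_zero fun Y => by
    rw [lor_sub_left, lor_minkAdjoint, hC, sub_self]

variable {C : Mink m →ₗ[ℝ] Mink d} {D : Euc l →ₗ[ℝ] Mink d}

theorem lor_eq_zero_of_range_eq_lorOrth (hr : LinearMap.range D = lorOrth (LinearMap.range C))
    (X : Mink m) (y : Euc l) : lor (C X) (D y) = 0 := by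
  rw [lor_comm]
  exact mem_lorOrth.1 (hr ▸ ⟨y, rfl⟩ : D y ∈ lorOrth (LinearMap.range C)) _ ⟨X, rfl⟩

theorem eq_add_of_range_eq_lorOrth (hC : ∀ X Y, lor (C X) (C Y) = lor X Y)
    (hD : ∀ x y, lor (D x) (D y) = inner ℝ x y)
    (hr : LinearMap.range D = lorOrth (LinearMap.range C)) (Z : Mink d) :
    Z = C (minkAdjoint C Z) + D (lorAdjoint D Z) := by
  have hmem : Z - C (minkAdjoint C Z) ∈ LinearMap.range D := by
    rw [hr]
    rintro _ ⟨X, rfl⟩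
    rw [lor_sub_left, hC, lor_minkAdjoint, sub_self]
  have hDC : lorAdjoint D (C (minkAdjoint C Z)) = 0 := lorAdjoint_eq_zero fun x => by
    rw [lor_comm, lor_eq_zero_of_range_eq_lorOrth hr]
  have hD' := apply_lorAdjoint_of_mem hD hmem
  rw [map_sub, hDC, sub_zero] at hD'
  rw [hD', add_sub_cancel]

theorem add_eq_of_range_eq_lorOrth (hC : ∀ X Y, lor (C X) (C Y) = lor X Y)
    (hD : ∀ x y, lor (D x) (D y) = inner ℝ x y)
    (hr : LinearMap.range D = lorOrth (LinearMap.range C)) : m + l = d := by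
  have horth := lor_eq_zero_of_range_eq_lorOrth hr
  have hinj : Function.Injective (C.coprod D) := by
    rw [← LinearMap.ker_eq_bot, LinearMap.ker_eq_bot']
    rintro ⟨X, y⟩ h
    rw [LinearMap.coprod_apply] at h
    have hX := minkAdjoint_apply_self hC X
    have hy := lorAdjoint_apply_self hD y
    have hCD : minkAdjoint C (D y) = 0 := eq_zero_of_lor_eq_zero fun X => by
      rw [lor_minkAdjoint, lor_comm, horth]
    rw [eq_neg_of_add_eq_zero_left h, map_neg, hCD, neg_zero] at hX
    rw [eq_neg_of_add_eq_zero_right h, map_neg,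
      lorAdjoint_eq_zero fun x => lor_comm _ _ ▸ horth X x, neg_zero] at hy
    rw [← hX, ← hy, Prod.mk_zero_zero]
  have hsurj : Function.Surjective (C.coprod D) := fun Z =>
    ⟨(minkAdjoint C Z, lorAdjoint D Z), (eq_add_of_range_eq_lorOrth hC hD hr Z).symm⟩
  have hdim := (LinearEquiv.ofBijective _ ⟨hinj, hsurj⟩).finrank_eq
  simp only [Module.finrank_prod, finrank_euclideanSpace_fin, Module.finrank_self] at hdim
  lia

/-- The reflection of the Lorentz space in the hyperplane orthogonal to `s`, which is required not
to be light-like. -/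
noncomputable def lorReflection (s : Mink d) : Mink d →L[ℝ] Mink d :=
  ContinuousLinearMap.id ℝ _ - ((2 / lor s s) • lorForm d s).smulRight s

theorem lorReflection_apply (s Z : Mink d) :
    lorReflection s Z = Z - (2 / lor s s * lor s Z) • s := rfl

theorem lor_lorReflection {s : Mink d} (hs : lor s s ≠ 0) (X Y : Mink d) :
    lor (lorReflection s X) (lorReflection s Y) = lor X Y := by
  simp only [lorReflection_apply, lor_sub_left, lor_sub_right, lor_smul_left, lor_smul_right,
    lor_comm X s]
  field_simp
  ring

theorem exists_isometry_apply_eq {u : Mink d} (huu : lor u u = -1) :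
    ∃ R : Mink d →L[ℝ] Mink d, (∀ X Y, lor (R X) (R Y) = lor X Y) ∧ R u = (0, 1) := by
  have hself : lor u u = ‖u.1‖ ^ 2 - u.2 ^ 2 := lor_self u
  have hs : lor (u - (0, 1)) (u - (0, 1)) = 2 * (u.2 - 1) := by
    rw [lor_self, Prod.fst_sub, Prod.snd_sub, sub_zero]
    linarith
  by_cases h1 : u.2 = 1
  · have hfst : u.1 = 0 := norm_eq_zero.1 (by nlinarith)
    exact ⟨ContinuousLinearMap.id ℝ _, fun _ _ => rfl, Prod.ext hfst h1⟩
  · have hs0 : lor (u - (0, 1)) (u - (0, 1)) ≠ 0 := hs ▸ mul_ne_zero two_ne_zero (sub_ne_zero.2 h1)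
    have hsu : lor (u - (0, 1)) u = u.2 - 1 := by
      rw [lor_sub_left, huu, lor, inner_zero_left]
      ring
    refine ⟨lorReflection (u - (0, 1)), lor_lorReflection hs0, ?_⟩
    rw [lorReflection_apply, hs, hsu, show 2 / (2 * (u.2 - 1)) * (u.2 - 1) = 1 by
      field_simp [sub_ne_zero.2 h1], one_smul, sub_sub_cancel]

end LorentzSubspaces

namespace ConeTriple

variable {N : ℕ}

/-- The image of a cone triple under a linear isometry of the Lorentz space. -/
def map (τ : ConeTriple N) {R : Mink (N + 1) →L[ℝ] Mink (N + 1)}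
    (hR : ∀ X Y, lor (R X) (R Y) = lor X Y) : ConeTriple N where
  p₀ := R τ.p₀
  w := R τ.w
  A := R.toLinearMap.comp τ.A
  p₀_null := (hR _ _).trans τ.p₀_null
  w_null := (hR _ _).trans τ.w_null
  p₀_w := (hR _ _).trans τ.p₀_w
  A_isom x y := (hR _ _).trans (τ.A_isom x y)
  A_p₀ x := (hR _ _).trans (τ.A_p₀ x)
  A_w x := (hR _ _).trans (τ.A_w x)

theorem embed_map (τ : ConeTriple N) {R : Mink (N + 1) →L[ℝ] Mink (N + 1)}
    (hR : ∀ X Y, lor (R X) (R Y) = lor X Y) (x : Euc N) :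
    (τ.map hR).embed x = R (τ.embed x) := by
  rw [embed, embed, map_sub, map_add, map_smul]
  rfl

theorem w_ne_zero (τ : ConeTriple N) : τ.w ≠ 0 := fun h =>
  zero_ne_one ((lor_zero_right τ.p₀).symm.trans (h ▸ τ.p₀_w))

theorem w_snd_ne_zero (τ : ConeTriple N) : τ.w.2 ≠ 0 := fun h =>
  τ.w_ne_zero (eq_zero_of_snd_eq_zero τ.w_null.le h)

/-- The point `e` of the unit sphere for which `(e, 1)` is proportional to `w`: the pole of the
stereographic projection `(x, 1) ↦ y` defined by `(x, 1) ∈ ℝ (τ.embed y)`. -/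
noncomputable def pole (τ : ConeTriple N) : Euc (N + 1) := τ.w.2⁻¹ • τ.w.1

theorem w_eq (τ : ConeTriple N) : τ.w = τ.w.2 • (τ.pole, 1) := by
  refine Prod.ext ?_ (mul_one _).symm
  rw [Prod.smul_fst, pole, smul_inv_smul₀ τ.w_snd_ne_zero]

theorem norm_pole (τ : ConeTriple N) : ‖τ.pole‖ = 1 := by
  have hnull := lor_self τ.w
  rw [τ.w_null, eq_comm, sub_eq_zero, ← sq_abs τ.w.2, sq_eq_sq₀ (norm_nonneg _) (abs_nonneg _)]
    at hnull
  rw [pole, norm_smul, norm_inv, Real.norm_eq_abs, hnull,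
    inv_mul_cancel₀ (abs_ne_zero.2 τ.w_snd_ne_zero)]

theorem inner_pole_self (τ : ConeTriple N) : inner ℝ τ.pole τ.pole = (1 : ℝ) := by
  rw [real_inner_self_eq_norm_sq, norm_pole, one_pow]

/-- The projection of `𝕃^{N+2}` onto `ℝ^{N+1}` along `w`. -/
noncomputable def proj (τ : ConeTriple N) : Mink (N + 1) →ₗ[ℝ] Euc (N + 1) :=
  LinearMap.fst ℝ _ ℝ - (LinearMap.snd ℝ _ ℝ).smulRight τ.pole

theorem proj_apply (τ : ConeTriple N) (Z : Mink (N + 1)) : τ.proj Z = Z.1 - Z.2 • τ.pole := rfl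

theorem proj_w (τ : ConeTriple N) : τ.proj τ.w = 0 := by
  rw [τ.w_eq, map_smul, proj_apply, one_smul, sub_self, smul_zero]

theorem lor_w (τ : ConeTriple N) (Z : Mink (N + 1)) :
    lor Z τ.w = τ.w.2 * inner ℝ (τ.proj Z) τ.pole := by
  conv_lhs => rw [τ.w_eq]
  rw [lor_smul_right, lor, proj_apply, inner_sub_left, real_inner_smul_left, inner_pole_self]

theorem inner_proj_proj (τ : ConeTriple N) {X Y : Mink (N + 1)} (hX : lor X τ.w = 0)
    (hY : lor Y τ.w = 0) : inner ℝ (τ.proj X) (τ.proj Y) = lor X Y := by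
  have hpole : ∀ Z : Mink (N + 1), lor Z τ.w = 0 → inner ℝ Z.1 τ.pole = Z.2 := fun Z hZ => by
    rw [lor_w, mul_eq_zero, or_iff_right τ.w_snd_ne_zero, proj_apply, inner_sub_left,
      real_inner_smul_left, inner_pole_self] at hZ
    linarith
  simp only [proj_apply, lor, inner_sub_left, inner_sub_right, real_inner_smul_left,
    real_inner_smul_right, inner_pole_self, hpole X hX, real_inner_comm Y.1 τ.pole, hpole Y hY]
  ring

theorem exists_affineIsometry (τ : ConeTriple N) :
    ∃ J : Euc N →ᵃⁱ[ℝ] Euc (N + 1), ∀ y, J y = τ.pole + τ.proj (τ.embed y) := by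
  let L : Euc N →ₗᵢ[ℝ] Euc (N + 1) := (τ.proj.comp τ.A).isometryOfInner fun x y =>
    (τ.inner_proj_proj (τ.A_w x) (τ.A_w y)).trans (τ.A_isom x y)
  refine ⟨(AffineIsometryEquiv.constVAdd ℝ (Euc (N + 1))
    (τ.pole + τ.proj τ.p₀)).toAffineIsometry.comp L.toAffineIsometry, fun y => ?_⟩
  rw [embed, map_sub, map_add, map_smul, proj_w, smul_zero, sub_zero, ← add_assoc]
  rfl

theorem range_pole_add_proj_embed (τ : ConeTriple N) :
    Set.range (fun y => τ.pole + τ.proj (τ.embed y)) =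
      {y | inner ℝ y τ.pole = 1 + τ.w.2⁻¹} := by
  have hinner : ∀ Z, inner ℝ (τ.pole + τ.proj Z) τ.pole = 1 + τ.w.2⁻¹ * lor Z τ.w := fun Z => by
    rw [inner_add_left, inner_pole_self, lor_w, inv_mul_cancel_left₀ τ.w_snd_ne_zero]
  refine Set.Subset.antisymm ?_ fun y hy => ?_
  · rintro _ ⟨x, rfl⟩
    exact (hinner _).trans (by rw [lor_embed_w, mul_one])
  · have hproj : τ.pole + τ.proj (y - τ.pole, 0) = y := by rw [proj_apply]; simp
    have hw : lor (y - τ.pole, 0) τ.w = 1 := by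
      have h := hinner (y - τ.pole, 0)
      rw [hproj, hy.out, add_right_inj] at h
      exact ((mul_eq_left₀ (inv_ne_zero τ.w_snd_ne_zero)).1 h.symm)
    have hdecomp := congrArg τ.proj (τ.decomp (y - τ.pole, 0))
    refine ⟨lorAdjoint τ.A (y - τ.pole, 0), ?_⟩
    rw [map_add, map_add, map_smul, map_smul, hw, one_smul, proj_w, smul_zero, add_zero] at hdecomp
    change τ.pole + τ.proj (τ.embed _) = y
    rw [embed, map_sub, map_add, map_smul, proj_w, smul_zero, sub_zero, ← hdecomp, hproj]

theorem lor_mk_one_w (τ : ConeTriple N) (x : Euc (N + 1)) :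
    lor (x, 1) τ.w = τ.w.2 * (inner ℝ x τ.pole - 1) := by
  rw [lor_w, proj_apply, one_smul, inner_sub_left, inner_pole_self]

theorem exists_stereographic (τ : ConeTriple N) :
    ∃ (e : Euc (N + 1)) (P : Euc (N + 1) → Euc N), IsStereographicProjection e P ∧
      ∀ x y (r : ℝ), r ≠ 0 → (x, 1) = r • τ.embed y → x ≠ e ∧ P x = y := by
  obtain ⟨J, hJ⟩ := τ.exists_affineIsometry
  have hrange : Set.range J = {y | inner ℝ y τ.pole = 1 + τ.w.2⁻¹} := by
    rw [← range_pole_add_proj_embed, funext hJ]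
  refine ⟨τ.pole, fun x => lorAdjoint τ.A ((lor (x, 1) τ.w)⁻¹ • (x, 1)),
    ⟨τ.norm_pole, 1 + τ.w.2⁻¹, J, by simpa using τ.w_snd_ne_zero, hrange, fun x hx hxe => ?_⟩,
    fun x y r hr h => ?_⟩
  · have hxw : lor (x, 1) τ.w ≠ 0 := by
      rw [lor_mk_one_w]
      refine mul_ne_zero τ.w_snd_ne_zero fun h => hxe ?_
      exact (inner_eq_one_iff_of_norm_eq_one (𝕜 := ℝ) hx τ.norm_pole).1 (by linarith)
    refine ⟨(lor (x, 1) τ.w)⁻¹, ?_⟩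
    rw [hJ, τ.embed_lorAdjoint _ (by rw [lor_smul_left, inv_mul_cancel₀ hxw]), map_smul, proj_apply,
      one_smul, AffineMap.lineMap_apply, vsub_eq_sub, vadd_eq_add]
    · exact add_comm _ _
    rw [lor_smul_left, lor_smul_right, lor_self, hx]
    simp
  · have hxw : lor (x, 1) τ.w = r := by rw [h, lor_smul_left, lor_embed_w, mul_one]
    refine ⟨fun hxe => hr ?_, ?_⟩
    · rw [← hxw, lor_mk_one_w, hxe, inner_pole_self, sub_self, mul_zero]
    · change lorAdjoint τ.A _ = y
      rw [hxw, h, inv_smul_smul₀ hr, lorAdjoint_embed]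

/-- The vector of square length `1` whose reflection is the inversion in the unit sphere with
center `q`. -/
noncomputable def inversionNormal (τ : ConeTriple N) (q : Euc N) : Mink (N + 1) :=
  τ.embed q + (1 / 2 : ℝ) • τ.w

theorem lor_inversionNormal_self (τ : ConeTriple N) (q : Euc N) :
    lor (τ.inversionNormal q) (τ.inversionNormal q) = 1 := by
  simp only [inversionNormal, lor_add_left, lor_add_right, lor_smul_left, lor_smul_right,
    lor_comm τ.w, lor_embed_w, lor_embed_embed, τ.w_null, sub_self, norm_zero]
  norm_num

theorem lor_inversionNormal_embed (τ : ConeTriple N) (q x : Euc N) :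
    lor (τ.inversionNormal q) (τ.embed x) = (1 - ‖x - q‖ ^ 2) / 2 := by
  rw [inversionNormal, lor_add_left, lor_smul_left, lor_comm τ.w, lor_embed_w, lor_embed_embed,
    norm_sub_rev]
  ring

theorem lorReflection_embed_self (τ : ConeTriple N) (q : Euc N) :
    lorReflection (τ.inversionNormal q) (τ.embed q) = -(1 / 2 : ℝ) • τ.w := by
  rw [lorReflection_apply, lor_inversionNormal_self, lor_inversionNormal_embed, sub_self,
    norm_zero, inversionNormal]
  module

theorem lorReflection_embed (τ : ConeTriple N) {q x : Euc N} (hx : x ≠ q) :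
    lorReflection (τ.inversionNormal q) (τ.embed x) =
      ‖x - q‖ ^ 2 • τ.embed (EuclideanGeometry.inversion q 1 x) := by
  have hs : lor (τ.inversionNormal q) (τ.inversionNormal q) ≠ 0 := by
    rw [lor_inversionNormal_self]
    exact one_ne_zero
  have hnorm : ‖x - q‖ ≠ 0 := norm_ne_zero_iff.2 (sub_ne_zero.2 hx)
  set Y := (‖x - q‖ ^ 2)⁻¹ • lorReflection (τ.inversionNormal q) (τ.embed x) with hY
  have hnull : lor Y Y = 0 := by
    rw [hY, lor_smul_left, lor_smul_right, lor_lorReflection hs, lor_embed_embed]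
    simp
  have happly : lorReflection (τ.inversionNormal q) (τ.embed x) =
      τ.embed x + (‖x - q‖ ^ 2 - 1) • τ.inversionNormal q := by
    rw [lorReflection_apply, lor_inversionNormal_self, lor_inversionNormal_embed]
    module
  have hw : lor Y τ.w = 1 := by
    rw [hY, happly, inversionNormal, lor_smul_left, lor_add_left, lor_smul_left, lor_add_left,
      lor_smul_left, lor_embed_w, lor_embed_w, τ.w_null]
    field_simp
    ring
  have hadj : lorAdjoint τ.A Y = EuclideanGeometry.inversion q 1 x := by
    rw [hY, happly, inversionNormal, map_smul, map_add, map_smul, map_add, map_smul,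
      lorAdjoint_embed, lorAdjoint_embed, lorAdjoint_eq_zero τ.A_w, EuclideanGeometry.inversion,
      dist_eq_norm, vsub_eq_sub, vadd_eq_add, div_pow, one_pow, one_div]
    rw [← sub_eq_zero]
    match_scalars <;> field_simp <;> ring
  rw [← hadj, embed_lorAdjoint τ hnull hw, hY, smul_inv_smul₀ (pow_ne_zero 2 hnorm)]

end ConeTriple

section ChartDerivLor

variable {n d : ℕ} {M : Type*} [TopologicalSpace M] [ChartedSpace (Euc n) M]
  {G : M → Mink d}

theorem lor_chartDeriv_eq_zero (hG : ∀ x, MDifferentiableAt (𝓡 n) 𝓘(ℝ, Mink d) G x) {Z : Mink d}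
    (h : ∀ x, lor Z (G x) = 0) (x : M) (X : Euc n) : lor Z (chartDeriv n G x X) = 0 := by
  have hzero : (fun x => lorForm d Z (G x)) = fun _ => 0 := funext h
  rw [← lorForm_apply, ← chartDeriv_clm (hG x), hzero, chartDeriv_const]
  rfl

variable [IsManifold (𝓡 n) ∞ M]

theorem lor_eq_zero_of_lor_chartDeriv_eq_zero [PreconnectedSpace M]
    (hG : ∀ x, MDifferentiableAt (𝓡 n) 𝓘(ℝ, Mink d) G x) {x₀ : M} (hx₀ : G x₀ = 0) {Z : Mink d}
    (h : ∀ x X, lor Z (chartDeriv n G x X) = 0) (x : M) : lor Z (G x) = 0 := by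
  have hconst := eq_of_chartDeriv_eq_zero (G := fun x => lorForm d Z (G x))
    (fun x => ((lorForm d Z).differentiableAt.comp_mdifferentiableAt (hG x)))
    (fun x X => by rw [chartDeriv_clm (hG x)]; exact h x X) x x₀
  simpa [hx₀, lorForm_apply] using hconst

theorem IsIsometricImmersion.exists_lor_ne_zero {g : RiemMetric n M}
    (hG : IsIsometricImmersion g lor G) (hn : 1 ≤ n) (x₀ : M) : ∃ x y, lor (G x) (G y) ≠ 0 := by
  by_contra! hzero
  obtain ⟨X, hX⟩ := hG.exists_chartDeriv_pos hn x₀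
  refine hX.ne' (lor_chartDeriv_eq_zero hG.mdifferentiableAt (fun y => ?_) x₀ X)
  rw [lor_comm]
  exact lor_chartDeriv_eq_zero hG.mdifferentiableAt (hzero y) x₀ X

end ChartDerivLor

section SplitLift

variable {k N : ℕ} {n : Fin k → ℕ} {M : Fin k → Type*} [∀ i, TopologicalSpace (M i)]
  [∀ i, ChartedSpace (Euc (n i)) (M i)] [∀ i, IsManifold (𝓡 (n i)) ∞ (M i)]

/-- `F` is a lift of `f` to the light cone of `𝕃^{N+2}` which is the sum of a constant vector and
of isometric immersions `G i` of the factors with mutually orthogonal values; these are normalized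
to vanish at the base points `o i`. -/
structure IsSplitLift (τ : ConeTriple N) (g : ∀ i, RiemMetric (n i) (M i))
    (f : (∀ i, M i) → Euc N) (F : (∀ i, M i) → Mink (N + 1)) (G : ∀ i, M i → Mink (N + 1))
    (o : ∀ i, M i) : Prop where
  isom : ∀ i, IsIsometricImmersion (g i) lor (G i)
  orth : ∀ i j, i ≠ j → ∀ x y, lor (G i x) (G j y) = 0
  base : ∀ i, G i (o i) = 0
  split : ∀ p, F p = F o + ∑ i, G i (p i)
  lift : ∀ p, ∃ r : ℝ, 0 < r ∧ F p = r • τ.embed (f p)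

theorem slice_eq_add_const {V : Type*} [NormedAddCommGroup V] [NormedSpace ℝ V]
    [∀ i, ConnectedSpace (M i)] {F : (∀ i, M i) → V}
    (hF : SmoothInCharts n F) (hmix : MixedDerivZero n F) (o p : ∀ i, M i) (i : Fin k) :
    ∃ c, slice F p i = fun x => slice F o i x + c := by
  refine ⟨∑ l ∈ Finset.univ \ {i}, (slice F o l (p l) - F o), funext fun x => ?_⟩
  rw [slice, eq_add_sum_slice hF hmix o, sum_apply_update (fun l y => slice F o l y - F o)]
  abel

theorem exists_isSplitLift [∀ i, ConnectedSpace (M i)] (τ : ConeTriple N) (hn : ∀ i, 1 ≤ n i)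
    (hn3 : 3 ≤ ∑ i, n i) {g : ∀ i, RiemMetric (n i) (M i)} {f : (∀ i, M i) → Euc N}
    (hf : IsConformalImmersion g f) (hadapted : IsAdaptedToProductNet n f) (o : ∀ i, M i) :
    ∃ F G, IsSplitLift τ g f F G o := by
  obtain ⟨hf, φ, hφ, hφ0, hconf⟩ := hf
  have hconf : IsConformalWithFactor g f φ := ⟨hf, hφ, hφ0, hconf⟩
  set F := τ.lift f φ
  have hiso := hconf.isProductIsometry_lift τ
  have hmix := hconf.mixedDerivZero_lift τ hn hn3 hadapted
  set G : ∀ i, M i → Mink (N + 1) := fun i x => slice F o i x - F o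
  have hG : ∀ i, ContMDiff (𝓡 (n i)) 𝓘(ℝ, Mink (N + 1)) ∞ (G i) := fun i =>
    (contMDiff_slice hiso.smooth o i).sub contMDiff_const
  have hGd := fun i x => (hG i x).mdifferentiableAt (by simp)
  have hbase : ∀ i, G i (o i) = 0 := fun i => by simp [G, slice_self]
  have hder : ∀ p i, chartDeriv (n i) (slice F p i) (p i) = chartDeriv (n i) (G i) (p i) := by
    intro p i
    obtain ⟨c, hc⟩ := slice_eq_add_const hiso.smooth hmix o p i
    have hc' : slice F p i = fun x => G i x + (F o + c) := by
      rw [hc]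
      exact funext fun x => by rw [← add_assoc, sub_add_cancel]
    rw [hc', chartDeriv_add_const (hGd i _)]
  refine ⟨F, G, fun i => .of_chartDeriv (hG i) fun x X Y => ?_, fun i j hij x y => ?_, hbase,
    eq_add_sum_slice hiso.smooth hmix o, fun p => ⟨_, inv_pos.2 (hφ0 p), rfl⟩⟩
  · have hdiag := hiso.diag (Function.update o i x) i X Y
    rwa [hder, Function.update_self] at hdiag
  · have horth : ∀ x y X Y, lor (chartDeriv (n i) (G i) x X) (chartDeriv (n j) (G j) y Y) = 0 := by
      intro x y X Y
      have horth := hiso.orth (Function.update (Function.update o i x) j y) i j hij X Y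
      rwa [hder, hder, Function.update_self, Function.update_of_ne hij, Function.update_self]
        at horth
    refine lor_eq_zero_of_lor_chartDeriv_eq_zero (hGd j) (hbase j) (fun y Y => ?_) y
    rw [lor_comm]
    refine lor_eq_zero_of_lor_chartDeriv_eq_zero (hGd i) (hbase i) (fun x X => ?_) x
    rw [lor_comm, horth]

namespace IsSplitLift

variable {τ : ConeTriple N} {g : ∀ i, RiemMetric (n i) (M i)} {f : (∀ i, M i) → Euc N}
  {F : (∀ i, M i) → Mink (N + 1)} {G : ∀ i, M i → Mink (N + 1)} {o : ∀ i, M i}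
  (h : IsSplitLift τ g f F G o)
include h

theorem lor_self (p : ∀ i, M i) : lor (F p) (F p) = 0 := by
  obtain ⟨r, -, hr⟩ := h.lift p
  rw [hr, lor_smul_left, lor_smul_right, τ.lor_embed_embed, sub_self, norm_zero]
  ring

theorem apply_update (p : ∀ i, M i) (i : Fin k) (x : M i) :
    F (Function.update p i x) = F p + (G i x - G i (p i)) := by
  have hp := sum_apply_update G p i (p i)
  rw [Function.update_eq_self] at hp
  rw [h.split, h.split p, sum_apply_update G, hp]
  abel

theorem apply_update_base (i : Fin k) (x : M i) : F (Function.update o i x) = F o + G i x := by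
  rw [h.apply_update, h.base, sub_zero]

theorem orth_span {i j : Fin k} (hij : i ≠ j) {x y : Mink (N + 1)}
    (hx : x ∈ Submodule.span ℝ (Set.range (G i))) (hy : y ∈ Submodule.span ℝ (Set.range (G j))) :
    lor x y = 0 := by
  induction hx, hy using Submodule.span_induction₂ with
  | mem_mem x y hx hy =>
    obtain ⟨x, rfl⟩ := hx
    obtain ⟨y, rfl⟩ := hy
    exact h.orth i j hij x y
  | zero_left y _ => exact lor_zero_left y
  | zero_right x _ => exact lor_zero_right x
  | add_left x y z _ _ _ hx hy => rw [lor_add_left, hx, hy, add_zero]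
  | add_right x y z _ _ _ hy hz => rw [lor_add_right, hy, hz, add_zero]
  | smul_left r x y _ _ hxy => rw [lor_smul_left, hxy, mul_zero]
  | smul_right r x y _ _ hxy => rw [lor_smul_right, hxy, mul_zero]

theorem lor_eq_of_orth {z : Mink (N + 1)} (hz : ∀ i x, lor z (G i x) = 0) (p : ∀ i, M i) :
    lor z (F p) = lor z (F o) := by
  rw [h.split, lor_add_right, lor_sum_right, Finset.sum_eq_zero fun i _ => hz i _, add_zero]

theorem map {τ' : ConeTriple N} {f' : (∀ i, M i) → Euc N} {R : Mink (N + 1) →L[ℝ] Mink (N + 1)}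
    (hR : ∀ X Y, lor (R X) (R Y) = lor X Y)
    (hf' : ∀ p, ∃ r : ℝ, 0 < r ∧ R (τ.embed (f p)) = r • τ'.embed (f' p)) :
    IsSplitLift τ' g f' (fun p => R (F p)) (fun i x => R (G i x)) o where
  isom i := by simpa using (h.isom i).clm_add (B' := lor) R (fun _ _ _ => hR _ _) 0
  orth i j hij x y := (hR _ _).trans (h.orth i j hij x y)
  base i := by rw [h.base, map_zero]
  split p := by rw [h.split, map_add, map_sum]
  lift p := by
    obtain ⟨r, hr, hrF⟩ := h.lift p
    obtain ⟨r', hr', hrf'⟩ := hf' p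
    exact ⟨r * r', mul_pos hr hr', by rw [hrF, map_smul, hrf', mul_smul]⟩

end IsSplitLift

theorem mem_span_range {d : ℕ} {ι : Type*} (G : ι → Mink d) (x : ι) :
    G x ∈ Submodule.span ℝ (Set.range G) :=
  Submodule.subset_span ⟨x, rfl⟩

end SplitLift

section Sphere

theorem mem_sphereCurv_one_div_sq {d : ℕ} {R : ℝ} (hR : 0 < R) {x : Euc d} :
    x ∈ sphereCurv d (1 / R ^ 2) ↔ ‖x‖ = R := by
  rw [sphereCurv, Set.mem_ofPred_eq, one_div_one_div, real_inner_self_eq_norm_sq,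
    sq_eq_sq₀ (norm_nonneg x) hR.le]

theorem homothety_zero_apply {d : ℕ} (r : ℝ) (x : Euc d) :
    AffineMap.homothety (0 : Euc d) r x = r • x := by
  simp [AffineMap.homothety_apply]

theorem homothety_image_sphereCurv (d : ℕ) {R : ℝ} (hR : 0 < R) :
    AffineMap.homothety (0 : Euc d) R⁻¹ '' sphereCurv d (1 / R ^ 2) = Metric.sphere 0 1 := by
  have hsphere : sphereCurv d (1 / R ^ 2) = Metric.sphere 0 R := by
    ext x
    rw [mem_sphereCurv_one_div_sq hR, mem_sphere_zero_iff_norm]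
  have hhom : ⇑(AffineMap.homothety (0 : Euc d) R⁻¹) = fun x => R⁻¹ • x :=
    funext (homothety_zero_apply R⁻¹)
  rw [hsphere, hhom, Set.image_smul, smul_sphere' (inv_ne_zero hR.ne'), smul_zero, norm_inv,
    Real.norm_of_nonneg hR.le, inv_mul_cancel₀ hR.ne']

variable {k N : ℕ} {n : Fin k → ℕ} {M : Fin k → Type*} [∀ i, TopologicalSpace (M i)]
  [∀ i, ChartedSpace (Euc (n i)) (M i)] [∀ i, IsManifold (𝓡 (n i)) ∞ (M i)]
  {τ : ConeTriple N} {g : ∀ i, RiemMetric (n i) (M i)} {f : (∀ i, M i) → Euc N}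
  {F : (∀ i, M i) → Mink (N + 1)} {G : ∀ i, M i → Mink (N + 1)} {o : ∀ i, M i}

namespace IsSplitLift

theorem caseSphere_of_snd_eq (h : IsSplitLift τ g f F G o) (hn : ∀ i, 1 ≤ n i) {R : ℝ}
    (hR : 0 < R) (hF : ∀ p, (F p).2 = R) : CaseSphere g f := by
  have hsnd : ∀ i x, (G i x).2 = 0 := fun i x => by
    simpa [hF] using congrArg Prod.snd (h.apply_update_base i x)
  have hiso : ∀ i, IsIsometricImmersion (g i) (inner ℝ) fun x => (G i x).1 := fun i => by
    simpa using (h.isom i).leftInverse_add (K := ContinuousLinearMap.inl ℝ (Euc (N + 1)) ℝ)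
      (B' := inner ℝ) (fun x y => by simp [lor]) (ContinuousLinearMap.fst ℝ (Euc (N + 1)) ℝ)
      (fun x => Prod.ext rfl (hsnd i x).symm) 0
  have horth : ∀ i j, i ≠ j → ∀ x y, inner ℝ (G i x).1 (G j y).1 = 0 := fun i j hij x y => by
    simpa [lor, hsnd] using h.orth i j hij x y
  have hsum : ∀ p : ∀ i, M i, ∑ i, (G i (p i)).1 + (F o).1 = (F p).1 := fun p => by
    rw [h.split p, Prod.fst_add, Prod.fst_sum]
    exact add_comm _ _
  have hsphere : ∀ p, ‖(F p).1‖ = R := fun p => by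
    have hnull := h.lor_self p
    rwa [_root_.lor_self, hF, sub_eq_zero, sq_eq_sq₀ (norm_nonneg _) hR.le] at hnull
  have : ∀ i, Nonempty (M i) := fun i => ⟨o i⟩
  obtain ⟨Ψ, H, hΨ, hH, hmap⟩ := exists_extrinsicProduct_isSpherical hn hiso horth (F o).1
    (c := 1 / R ^ 2) fun p => (mem_sphereCurv_one_div_sq hR).2 (hsum p ▸ hsphere p)
  obtain ⟨e, P, hP, hPe⟩ := τ.exists_stereographic
  refine ⟨1 / R ^ 2, Ψ, H, 0, R⁻¹, e, P, by positivity, hΨ, hH, inv_pos.2 hR,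
    homothety_image_sphereCurv _ hR, hP, fun p => ?_⟩
  obtain ⟨r, hr, hrF⟩ := h.lift p
  rw [hmap, hsum, homothety_zero_apply]
  have hlift : (R⁻¹ • (F p).1, 1) = (R⁻¹ * r) • τ.embed (f p) := by
    rw [mul_smul, ← hrF]
    exact Prod.ext rfl (by rw [Prod.smul_snd, hF, smul_eq_mul, inv_mul_cancel₀ hR.ne'])
  exact (hPe _ (f p) _ (by positivity) hlift).imp_right Eq.symm

theorem exists_timelike_orth (h : IsSplitLift τ g f F G o) (hn : ∀ i, 1 ≤ n i) (i₀ : Fin k)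
    (hpos : ∀ i, ∀ x ∈ Submodule.span ℝ (Set.range (G i)), x ≠ 0 → 0 < lor x x) :
    ∃ v, lor v v < 0 ∧ lor v (F o) < 0 ∧ ∀ i x, lor v (G i x) = 0 := by
  set W := ⨆ i, Submodule.span ℝ (Set.range (G i))
  have hW : ∀ x ∈ W, x ≠ 0 → 0 < lor x x := fun x hx hx0 =>
    lor_self_pos_of_mem_iSup (fun i j hij x hx y hy => h.orth_span hij hx hy) hpos hx hx0
  have hGW : ∀ i x, G i x ∈ W := fun i x => Submodule.mem_iSup_of_mem i (mem_span_range (G i) x)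
  obtain ⟨y, hy, hv⟩ := exists_sub_mem_lorOrth hW (F o)
  set v := F o - y
  have hFv : ∀ p, F p - v ∈ W := fun p => by
    rw [h.split, show F o + ∑ i, G i (p i) - v = y + ∑ i, G i (p i) by simp only [v]; abel]
    exact W.add_mem hy (W.sum_mem fun i _ => hGW i _)
  have hvF : ∀ p, lor v (F p) = lor v v := fun p => by
    rw [← sub_eq_zero, ← lor_sub_right, hv _ (hFv p)]
  have hself : ∀ p, lor (F p - v) (F p - v) = -lor v v := fun p => by
    rw [lor_sub_left, hv _ (hFv p), lor_sub_right, h.lor_self, lor_comm (F p) v, hvF]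
    ring
  have hvv : lor v v < 0 := by
    by_contra! hnonneg
    have hconst : ∀ p, F p = v := fun p => by
      by_contra hne
      linarith [hW _ (hFv p) (sub_ne_zero.2 hne), hself p]
    obtain ⟨x, z, hxz⟩ := (h.isom i₀).exists_lor_ne_zero (hn i₀) (o i₀)
    have hx := h.apply_update_base i₀ x
    rw [hconst, hconst, left_eq_add] at hx
    exact hxz (by rw [hx, lor_zero_left])
  exact ⟨v, hvv, (hvF o).trans_lt hvv, fun i x => hv _ (hGW i x)⟩

theorem caseSphere (h : IsSplitLift τ g f F G o) (hn : ∀ i, 1 ≤ n i) (i₀ : Fin k)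
    (hpos : ∀ i, ∀ x ∈ Submodule.span ℝ (Set.range (G i)), x ≠ 0 → 0 < lor x x) :
    CaseSphere g f := by
  obtain ⟨v, hvv, hvo, hvG⟩ := h.exists_timelike_orth hn i₀ hpos
  obtain ⟨a, ha, huu⟩ := exists_smul_lor_self_eq_neg_one hvv
  obtain ⟨R, hR, hRu⟩ := exists_isometry_apply_eq huu
  have hmap := h.map (τ' := τ.map hR) (f' := f) hR fun p =>
    ⟨1, one_pos, by rw [one_smul, τ.embed_map]⟩
  refine hmap.caseSphere_of_snd_eq hn (R := -(a * lor v (F o)))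
    (neg_pos.2 (mul_neg_of_pos_of_neg ha hvo)) fun p => ?_
  have hlor : lor (0, 1) (R (F p)) = a * lor v (F o) := by
    rw [← hRu, hR, lor_smul_left, h.lor_eq_of_orth hvG]
  rw [← hlor, lor, inner_zero_left]
  ring

end IsSplitLift

end Sphere

section Flat

variable {k N : ℕ} {n : Fin k → ℕ} {M : Fin k → Type*} [∀ i, TopologicalSpace (M i)]
  [∀ i, ChartedSpace (Euc (n i)) (M i)] [∀ i, IsManifold (𝓡 (n i)) ∞ (M i)]
  {τ : ConeTriple N} {g : ∀ i, RiemMetric (n i) (M i)} {f : (∀ i, M i) → Euc N}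
  {F : (∀ i, M i) → Mink (N + 1)} {G : ∀ i, M i → Mink (N + 1)} {o : ∀ i, M i}

namespace IsSplitLift

theorem exists_homothety_of_lor_w_eq_zero (h : IsSplitLift τ g f F G o)
    (hw : ∀ i x, lor τ.w (G i x) = 0) :
    ∃ (Ψ : ExtrinsicProduct (Fin k) N) (H : ∀ i, M i → Euc (Ψ.m i)) (r : ℝ),
      (∀ i, IsIsometricImmersion (g i) (inner ℝ) (H i) ∧ ∀ q, H i q ∈ Ψ.N i) ∧ 0 < r ∧
        ∀ p, f p = AffineMap.homothety 0 r (Ψ.map fun i => H i (p i)) := by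
  have hA : ∀ {Z Y : Mink (N + 1)}, lor τ.w Z = 0 → lor τ.w Y = 0 →
      inner ℝ (lorAdjoint τ.A Z) (lorAdjoint τ.A Y) = lor Z Y := fun {Z Y} hZ hY => by
    rw [τ.lor_eq_of_decomp, lor_comm Z τ.w, lor_comm Y τ.w, hZ, hY]
    ring
  have hder := fun i => lor_chartDeriv_eq_zero (h.isom i).mdifferentiableAt (hw i)
  have hiso : ∀ i, IsIsometricImmersion (g i) (inner ℝ) fun x => lorAdjoint τ.A (G i x) :=
    fun i => by
      simpa using (h.isom i).clm_add (B' := inner ℝ) (lorAdjoint τ.A)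
        (fun x X Y => hA (hder i x X) (hder i x Y)) 0
  obtain ⟨Ψ, H, hN, hH, hmap⟩ := exists_extrinsicProduct_univ hiso
    (fun i j hij x y => (hA (hw i x) (hw j y)).trans (h.orth i j hij x y)) (lorAdjoint τ.A (F o))
  have hmapF : ∀ p : ∀ i, M i, Ψ.map (fun i => H i (p i)) = lorAdjoint τ.A (F p) := fun p => by
    rw [hmap, h.split p, map_add, map_sum, add_comm]
  have hr : ∀ {p : ∀ i, M i} {r : ℝ}, F p = r • τ.embed (f p) → lor τ.w (F o) = r :=
    fun {p r} hrF => by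
      rw [← h.lor_eq_of_orth hw p, hrF, lor_smul_right, lor_comm, τ.lor_embed_w, mul_one]
  obtain ⟨r₀, hr₀, hr₀F⟩ := h.lift o
  refine ⟨Ψ, H, (lor τ.w (F o))⁻¹, fun i => ⟨hH i, fun q => hN i ▸ Set.mem_univ _⟩,
    inv_pos.2 (hr hr₀F ▸ hr₀), fun p => ?_⟩
  obtain ⟨r, hrpos, hrF⟩ := h.lift p
  rw [homothety_zero_apply, hmapF, hr hrF, hrF, map_smul, τ.lorAdjoint_embed,
    inv_smul_smul₀ hrpos.ne']

theorem lor_ne_zero_of_null (h : IsSplitLift τ g f F G o) {j : Fin k} (hn : 1 ≤ n j)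
    {z : Mink (N + 1)} (hz0 : z ≠ 0) (hzz : lor z z = 0) (hzG : ∀ i x, lor z (G i x) = 0)
    (p : ∀ i, M i) : lor z (F p) ≠ 0 := by
  rw [h.lor_eq_of_orth hzG]
  intro hzF
  have hmul : ∀ p, ∃ a : ℝ, F p = a • z := fun p =>
    exists_eq_smul_of_null hzz hz0 (h.lor_self p) ((h.lor_eq_of_orth hzG p).trans hzF)
  have hmulG : ∀ x, ∃ a : ℝ, G j x = a • z := fun x => by
    obtain ⟨a, ha⟩ := hmul (Function.update o j x)
    obtain ⟨b, hb⟩ := hmul o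
    exact ⟨a - b, by rw [sub_smul, ← ha, ← hb, h.apply_update_base, add_sub_cancel_left]⟩
  obtain ⟨x, y, hxy⟩ := (h.isom j).exists_lor_ne_zero hn (o j)
  obtain ⟨a, ha⟩ := hmulG x
  exact hxy (by rw [ha, lor_smul_left, hzG, mul_zero])

theorem caseFlat_of_lor_embed_eq_zero (h : IsSplitLift τ g f F G o) {q : Euc N}
    (hq : ∀ i x, lor (τ.embed q) (G i x) = 0) (hqF : ∀ p, lor (τ.embed q) (F p) ≠ 0) :
    CaseFlat g f := by
  have hfq : ∀ p, f p ≠ q := fun p hpq => by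
    obtain ⟨r, -, hrF⟩ := h.lift p
    refine hqF p ?_
    rw [hrF, hpq, lor_smul_right, τ.lor_embed_embed, sub_self, norm_zero]
    ring
  have hR : ∀ X Y, lor (lorReflection (τ.inversionNormal q) X)
      (lorReflection (τ.inversionNormal q) Y) = lor X Y :=
    lor_lorReflection (by rw [τ.lor_inversionNormal_self]; exact one_ne_zero)
  obtain ⟨Ψ, H, r, hH, hr, hmap⟩ := (h.map (τ' := τ) hR fun p =>
    ⟨_, pow_pos (norm_pos_iff.2 (sub_ne_zero.2 (hfq p))) 2,
      τ.lorReflection_embed (hfq p)⟩).exists_homothety_of_lor_w_eq_zero fun i x => by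
        have hRq := hR (τ.embed q) (G i x)
        rw [τ.lorReflection_embed_self, hq, lor_smul_left] at hRq
        exact (mul_eq_zero.1 hRq).resolve_left (by norm_num)
  refine ⟨Ψ, H, 0, r, hH, hr, Or.inr ⟨q, fun p => ⟨fun hpq => hfq p ?_, ?_⟩⟩⟩
  · rwa [← hmap, EuclideanGeometry.inversion_eq_center one_ne_zero] at hpq
  · rw [← hmap, EuclideanGeometry.inversion_inversion _ one_ne_zero]

theorem caseFlat (h : IsSplitLift τ g f F G o) (hn : ∀ i, 1 ≤ n i)
    (hnonneg : ∀ i, ∀ x ∈ Submodule.span ℝ (Set.range (G i)), 0 ≤ lor x x) {j : Fin k}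
    {z : Mink (N + 1)} (hz : z ∈ Submodule.span ℝ (Set.range (G j))) (hz0 : z ≠ 0)
    (hzz : lor z z = 0) : CaseFlat g f := by
  have hzG : ∀ i x, lor z (G i x) = 0 := fun i x => by
    rcases eq_or_ne j i with rfl | hij
    · exact lor_eq_zero_of_null (hnonneg j) hz hzz (mem_span_range (G j) x)
    · exact h.orth_span hij hz (mem_span_range (G i) x)
  have hzF := h.lor_ne_zero_of_null (hn j) hz0 hzz hzG
  by_cases hw : lor z τ.w = 0
  · obtain ⟨a, ha⟩ := exists_eq_smul_of_null hzz hz0 τ.w_null hw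
    obtain ⟨Ψ, H, r, hH, hr, hmap⟩ := h.exists_homothety_of_lor_w_eq_zero fun i x => by
      rw [ha, lor_smul_left, hzG, mul_zero]
    exact ⟨Ψ, H, 0, r, hH, hr, Or.inl hmap⟩
  · have hq : τ.embed (lorAdjoint τ.A ((lor z τ.w)⁻¹ • z)) = (lor z τ.w)⁻¹ • z :=
      τ.embed_lorAdjoint (by rw [lor_smul_left, lor_smul_right, hzz, mul_zero, mul_zero])
        (by rw [lor_smul_left, inv_mul_cancel₀ hw])
    refine h.caseFlat_of_lor_embed_eq_zero (q := lorAdjoint τ.A ((lor z τ.w)⁻¹ • z))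
      (fun i x => ?_) fun p => ?_
    · rw [hq, lor_smul_left, hzG, mul_zero]
    · rw [hq, lor_smul_left]
      exact mul_ne_zero (inv_ne_zero hw) (hzF p)

end IsSplitLift

end Flat

section Theta

namespace ExtrinsicProduct.IsSpherical

variable {ι : Type} [Fintype ι] {d : ℕ} {Ψ : ExtrinsicProduct ι d} {c : ℝ}

theorem two_le (hΨ : Ψ.IsSpherical c) (i : ι) : 2 ≤ d := by
  have hdim := LinearMap.finrank_le_finrank_of_injective (f := (Ψ.L i).toLinearMap)
    (Ψ.L i).injective
  rw [finrank_euclideanSpace_fin, finrank_euclideanSpace_fin] at hdim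
  exact (hΨ.1 i).1.trans hdim

theorem curv_pos [Nonempty ι] (hΨ : Ψ.IsSpherical c) {x : ∀ i, Euc (Ψ.m i)}
    (hx : ∀ i, x i ∈ Ψ.N i) : 0 < c := by
  have hpos : ∀ i, 0 < inner ℝ (x i) (x i) := fun i => by
    obtain ⟨-, c', hc', hN⟩ := hΨ.1 i
    have hxi : x i ∈ sphereCurv (Ψ.m i) c' := hN ▸ hx i
    exact (one_div_pos.2 hc').trans_eq (Eq.symm hxi)
  have hmap : inner ℝ (Ψ.map x) (Ψ.map x) = 1 / c := hΨ.2 x hx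
  rw [← one_div_pos, ← hmap, Ψ.inner_map_self]
  exact add_pos_of_pos_of_nonneg (Finset.sum_pos (fun i _ => hpos i) Finset.univ_nonempty)
    real_inner_self_nonneg

end ExtrinsicProduct.IsSpherical

section Hyperbolic

variable {n m : ℕ} {M : Type*} [TopologicalSpace M] [ChartedSpace (Euc n) M]
  [IsManifold (𝓡 n) ∞ M] {g : RiemMetric n M} {X : M → Mink m}

theorem IsIsometricImmersion.one_le_of_lor (hX : IsIsometricImmersion g lor X) (hn : 1 ≤ n)
    (x : M) : 1 ≤ m := by
  obtain ⟨u, hu⟩ := hX.exists_chartDeriv_pos hn x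
  by_contra! hm
  obtain rfl : m = 0 := by lia
  rw [lor_self, Subsingleton.elim (chartDeriv n X x u).1 0, norm_zero] at hu
  nlinarith [sq_nonneg (chartDeriv n X x u).2]

theorem forall_pos_or_forall_neg {α : Type*} [TopologicalSpace α] [PreconnectedSpace α] {s : α → ℝ}
    (hs : Continuous s) (h0 : ∀ x, s x ≠ 0) : (∀ x, 0 < s x) ∨ ∀ x, s x < 0 := by
  by_contra! hcon
  obtain ⟨⟨x, hx⟩, y, hy⟩ := hcon
  obtain ⟨z, hz⟩ := mem_range_of_exists_le_of_exists_ge hs ⟨x, hx⟩ ⟨y, hy⟩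
  exact h0 z hz

theorem exists_sign_smul_mem_hypCurv [PreconnectedSpace M] (hX : Continuous X) {c : ℝ}
    (hc : 0 < c) (hlor : ∀ x, lor (X x) (X x) = -1 / c) :
    ∃ ε : ℝ, ε * ε = 1 ∧ ∀ x, ε • X x ∈ hypCurv m c := by
  have hsnd : ∀ x, (X x).2 ≠ 0 := fun x h0 => by
    have hx := hlor x
    rw [lor_self, h0, neg_div] at hx
    nlinarith [sq_nonneg ‖(X x).1‖, one_div_pos.2 hc]
  rcases forall_pos_or_forall_neg (continuous_snd.comp hX) hsnd with hpos | hneg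
  · exact ⟨1, one_mul 1, fun x => by rw [one_smul]; exact ⟨hlor x, hpos x⟩⟩
  · refine ⟨-1, by norm_num, fun x => ⟨?_, ?_⟩⟩
    · rw [lor_smul_left, lor_smul_right, hlor]
      ring
    · rw [Prod.smul_snd, smul_eq_mul, neg_one_mul]
      exact neg_pos.2 (hneg x)

end Hyperbolic

/-- The map `Θ` of the orthogonal decomposition of `𝕃^{N+2}` given by `C` and `D`. -/
noncomputable def thetaMap {N m l : ℕ} (τ : ConeTriple N) (C : Mink m →ₗ[ℝ] Mink (N + 1))
    (D : Euc l →ₗ[ℝ] Mink (N + 1)) (Z : Mink m × Euc l) : Euc N :=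
  lorAdjoint τ.A ((lor (C Z.1 + D Z.2) τ.w)⁻¹ • (C Z.1 + D Z.2))

section ThetaMap

variable {N m l : ℕ} (τ : ConeTriple N) {C : Mink m →ₗ[ℝ] Mink (N + 1)}

theorem thetaMap_eq_of_add_eq_smul {D : Euc l →ₗ[ℝ] Mink (N + 1)} {Z : Mink m × Euc l} {r : ℝ}
    {y : Euc N} (hr : r ≠ 0) (hZ : C Z.1 + D Z.2 = r • τ.embed y) : thetaMap τ C D Z = y := by
  rw [thetaMap, hZ, lor_smul_left, τ.lor_embed_w, mul_one, inv_smul_smul₀ hr, τ.lorAdjoint_embed]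

theorem isTheta_thetaMap {D : Euc (l + 1) →ₗ[ℝ] Mink (N + 1)}
    (hC : ∀ X Y, lor (C X) (C Y) = lor X Y) (hD : ∀ x y, lor (D x) (D y) = inner ℝ x y)
    (hCD : ∀ X y, lor (C X) (D y) = 0) (c : ℝ) :
    IsTheta c {Z | Z.1 ∈ hypCurv m c ∧ Z.2 ∈ sphereCurv (l + 1) c ∧ lor (C Z.1 + D Z.2) τ.w ≠ 0}
      (thetaMap τ C D) := by
  refine ⟨τ, C, D, hC, hD, hCD, rfl, fun Z ⟨⟨hX, _⟩, hY, hw⟩ => τ.embed_lorAdjoint ?_ ?_⟩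
  · have hnull : lor (C Z.1 + D Z.2) (C Z.1 + D Z.2) = 0 := by
      rw [lor_add_left, lor_add_right, lor_add_right, hC, hD, lor_comm (D _), hCD, hX,
        show inner ℝ Z.2 Z.2 = 1 / c from hY]
      ring
    rw [lor_smul_left, lor_smul_right, hnull, mul_zero, mul_zero]
  · rw [lor_smul_left, inv_mul_cancel₀ hw]

end ThetaMap

variable {k N : ℕ} {n : Fin k → ℕ} {M : Fin k → Type*} [∀ i, TopologicalSpace (M i)]
  [∀ i, ChartedSpace (Euc (n i)) (M i)] [∀ i, IsManifold (𝓡 (n i)) ∞ (M i)]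
  {τ : ConeTriple N} {g : ∀ i, RiemMetric (n i) (M i)} {f : (∀ i, M i) → Euc N}
  {F : (∀ i, M i) → Mink (N + 1)} {G : ∀ i, M i → Mink (N + 1)} {o : ∀ i, M i}

theorem caseTheta_of_lift {j : Fin k} {m l : ℕ} {c : ℝ} (hm : 1 ≤ m) (hl : 1 ≤ l) (hml : m + l = N)
    (hc : 0 < c) {C : Mink m →ₗ[ℝ] Mink (N + 1)} {D : Euc (l + 1) →ₗ[ℝ] Mink (N + 1)}
    (hC : ∀ X Y, lor (C X) (C Y) = lor X Y) (hD : ∀ x y, lor (D x) (D y) = inner ℝ x y)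
    (hCD : ∀ X y, lor (C X) (D y) = 0)
    {Ψ : ExtrinsicProduct {i : Fin k // i ≠ j} (l + 1)} (hΨ : Ψ.IsSpherical c)
    {hj : M j → Mink m} (hhj : IsIsometricImmersion (g j) lor hj ∧ ∀ q, hj q ∈ hypCurv m c)
    {H : ∀ i : {i : Fin k // i ≠ j}, M i → Euc (Ψ.m i)}
    (hH : ∀ i : {i : Fin k // i ≠ j},
      IsIsometricImmersion (g i) (inner ℝ) (H i) ∧ ∀ q, H i q ∈ Ψ.N i)
    (hlift : ∀ p, ∃ r : ℝ, 0 < r ∧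
      C (hj (p j)) + D (Ψ.map fun i => H i (p i)) = r • τ.embed (f p)) :
    CaseTheta g f j := by
  refine ⟨m, l, c, Ψ, hj, H, _, _, hm, hl, hml, hc, hΨ, hhj, hH, isTheta_thetaMap τ hC hD hCD c,
    fun p => ?_⟩
  obtain ⟨r, hr, hrF⟩ := hlift p
  refine ⟨⟨hhj.2 _, hΨ.2 _ fun i => (hH i).2 _, ?_⟩, (thetaMap_eq_of_add_eq_smul τ hr.ne' hrF).symm⟩
  rw [hrF, lor_smul_left, τ.lor_embed_w, mul_one]
  exact hr.ne'

namespace IsSplitLift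

variable {j : Fin k} {m l : ℕ} {C : Mink m →ₗ[ℝ] Mink (N + 1)} {D : Euc l →ₗ[ℝ] Mink (N + 1)}

theorem eq_add_of_apply_adjoint (h : IsSplitLift τ g f F G o)
    (hC : ∀ x, C (minkAdjoint C (G j x)) = G j x)
    (hD : ∀ i, i ≠ j → ∀ x, D (lorAdjoint D (G i x)) = G i x)
    (ho : F o = C (minkAdjoint C (F o)) + D (lorAdjoint D (F o))) (p : ∀ i, M i) :
    F p = C (minkAdjoint C (G j (p j)) + minkAdjoint C (F o)) +
      D (∑ i : {i : Fin k // i ≠ j}, lorAdjoint D (G i (p i)) + lorAdjoint D (F o)) := by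
  have hsum : ∑ i : {i : Fin k // i ≠ j}, D (lorAdjoint D (G i (p i))) =
      ∑ i : {i : Fin k // i ≠ j}, G i (p i) := Finset.sum_congr rfl fun i _ => hD i i.2 _
  rw [map_add, map_add, map_sum, hC, hsum, h.split p, Fintype.sum_eq_add_sum_subtype_ne _ j]
  nth_rw 1 [ho]
  abel

theorem lor_self_add_inner_self_eq_zero (h : IsSplitLift τ g f F G o)
    (hC : ∀ X Y, lor (C X) (C Y) = lor X Y) (hD : ∀ x y, lor (D x) (D y) = inner ℝ x y)
    (hCD : ∀ X y, lor (C X) (D y) = 0) {X : M j → Mink m}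
    {Y : (∀ i : {i : Fin k // i ≠ j}, M i) → Euc l}
    (hF : ∀ p, F p = C (X (p j)) + D (Y fun i => p i)) (x : M j)
    (y : ∀ i : {i : Fin k // i ≠ j}, M i) : lor (X x) (X x) + inner ℝ (Y y) (Y y) = 0 := by
  have hp := h.lor_self ((Equiv.piSplitAt j M).symm (x, y))
  have hj : (Equiv.piSplitAt j M).symm (x, y) j = x := by simp
  have hi : ∀ i : {i : Fin k // i ≠ j}, (Equiv.piSplitAt j M).symm (x, y) i = y i := fun i =>
    dif_neg i.2
  rw [hF, hj] at hp
  simp only [hi] at hp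
  rwa [lor_add_left, lor_add_right, lor_add_right, hC, hD, lor_comm (D _), hCD, add_zero,
    zero_add] at hp

theorem exists_hyperbolic_add_spherical (h : IsSplitLift τ g f F G o) (hn : ∀ i, 1 ≤ n i)
    (hC : ∀ X Y, lor (C X) (C Y) = lor X Y) (hD : ∀ x y, lor (D x) (D y) = inner ℝ x y)
    (hCr : LinearMap.range C = Submodule.span ℝ (Set.range (G j)))
    (hDr : LinearMap.range D = lorOrth (LinearMap.range C)) :
    ∃ (c : ℝ) (Ψ : ExtrinsicProduct {i : Fin k // i ≠ j} l) (hj : M j → Mink m)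
      (H : ∀ i : {i : Fin k // i ≠ j}, M i → Euc (Ψ.m i)), Ψ.IsSpherical c ∧
      IsIsometricImmersion (g j) lor hj ∧ (∀ q, lor (hj q) (hj q) = -1 / c) ∧
      (∀ i : {i : Fin k // i ≠ j},
        IsIsometricImmersion (g i) (inner ℝ) (H i) ∧ ∀ q, H i q ∈ Ψ.N i) ∧
      ∀ p, F p = C (hj (p j)) + D (Ψ.map fun i => H i (p i)) := by
  have hCG : ∀ x, C (minkAdjoint C (G j x)) = G j x := fun x => by
    obtain ⟨X, hX⟩ : G j x ∈ LinearMap.range C := hCr ▸ mem_span_range (G j) x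
    rw [← hX, minkAdjoint_apply_self hC]
  have hDG : ∀ i, i ≠ j → ∀ x, D (lorAdjoint D (G i x)) = G i x := fun i hi x =>
    apply_lorAdjoint_of_mem hD <| by
      rw [hDr, hCr]
      exact fun y hy => h.orth_span hi (mem_span_range (G i) x) hy
  have hF := h.eq_add_of_apply_adjoint hCG hDG (eq_add_of_range_eq_lorOrth hC hD hDr _)
  set X : M j → Mink m := fun x => minkAdjoint C (G j x) + minkAdjoint C (F o)
  set Y : (∀ i : {i : Fin k // i ≠ j}, M i) → Euc l := fun y =>
    ∑ i : {i : Fin k // i ≠ j}, lorAdjoint D (G i (y i)) + lorAdjoint D (F o)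
  have hnull := h.lor_self_add_inner_self_eq_zero (X := X) (Y := Y) hC hD
    (lor_eq_zero_of_range_eq_lorOrth hDr) hF
  have : ∀ i, Nonempty (M i) := fun i => ⟨o i⟩
  set κ : ℝ := -lor (X (o j)) (X (o j))
  have hY : ∀ y, inner ℝ (Y y) (Y y) = κ := fun y => by linarith [hnull (o j) y]
  have hX : ∀ x, lor (X x) (X x) = -κ := fun x => by
    linarith [hnull x fun i => o i, hY fun i => o i]
  obtain ⟨Ψ, H, hΨ, hH, hmap⟩ := exists_extrinsicProduct_isSpherical
    (ι := {i : Fin k // i ≠ j}) (n := fun i => n i) (M := fun i => M i) (g := fun i => g i)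
    (H := fun i x => lorAdjoint D (G i x)) (fun i => hn i)
    (fun i => by
      simpa using (h.isom i).leftInverse_add (K := LinearMap.toContinuousLinearMap D)
        (B' := inner ℝ) hD (lorAdjoint D) (hDG i i.2) 0)
    (fun i i' hii x y => by
      rw [← hD, hDG i i.2, hDG i' i'.2, h.orth i i' (Subtype.coe_ne_coe.2 hii)])
    (lorAdjoint D (F o)) (c := 1 / κ) fun y => (hY y).trans (one_div_one_div κ).symm
  refine ⟨1 / κ, Ψ, X, H, hΨ, ?_, fun q => ?_, hH, fun p => ?_⟩
  · exact (h.isom j).leftInverse_add (K := LinearMap.toContinuousLinearMap C) (B' := lor) hC _ hCG _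
  · rw [hX, neg_div, one_div_one_div]
  · rw [hF, hmap fun i => p i]

theorem caseTheta [∀ i, ConnectedSpace (M i)] (h : IsSplitLift τ g f F G o) (hk : 2 ≤ k)
    (hn : ∀ i, 1 ≤ n i) {v : Mink (N + 1)} (hv : v ∈ Submodule.span ℝ (Set.range (G j)))
    (hvv : lor v v < 0) : CaseTheta g f j := by
  obtain ⟨m, C, hC, hCr⟩ := exists_mink_isometry_range _ hv hvv
  obtain ⟨l, D, hD, hDr⟩ := exists_isometry_of_posDef (lorOrth (LinearMap.range C))
    fun x hx hx0 => lor_self_pos_of_mem_lorOrth (hCr ▸ hv) hvv hx hx0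
  have horth := lor_eq_zero_of_range_eq_lorOrth hDr
  obtain ⟨c, Ψ, X, H, hΨ, hX, hXc, hH, hF⟩ := h.exists_hyperbolic_add_spherical hn hC hD hCr hDr
  have : Nontrivial (Fin k) := Fin.nontrivial_iff_two_le.2 hk
  have : Nonempty {i : Fin k // i ≠ j} := nonempty_subtype.2 (exists_ne j)
  have hc : 0 < c := hΨ.curv_pos fun i => (hH i).2 (o i)
  have hl := hΨ.two_le (Classical.arbitrary _)
  have hml := add_eq_of_range_eq_lorOrth hC hD hDr
  obtain ⟨ε, hε, hXε⟩ := exists_sign_smul_mem_hypCurv hX.1.continuous hc hXc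
  obtain ⟨l, rfl⟩ : ∃ l', l = l' + 1 := ⟨l - 1, by lia⟩
  have hεC : ∀ x y, lor ((ε • C) x) ((ε • C) y) = lor x y := fun x y => by
    rw [LinearMap.smul_apply, LinearMap.smul_apply, lor_smul_left, lor_smul_right, hC, ← mul_assoc,
      hε, one_mul]
  have hεX : IsIsometricImmersion (g j) lor fun x => ε • X x := by
    simpa using hX.clm_add (B' := lor) (ε • ContinuousLinearMap.id ℝ (Mink m))
      (fun x u v => by simp [← mul_assoc, hε]) 0
  refine caseTheta_of_lift (τ := τ) (hX.one_le_of_lor (hn j) (o j)) (by lia) (by lia) hc hεC hD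
    (fun x y => ?_) hΨ ⟨hεX, hXε⟩ hH fun p => ?_
  · rw [LinearMap.smul_apply, lor_smul_left, horth, mul_zero]
  · obtain ⟨r, hr, hrF⟩ := h.lift p
    exact ⟨r, hr, by rw [← hrF, hF, LinearMap.smul_apply, map_smul, smul_smul, hε, one_smul]⟩

end IsSplitLift

end Theta

section Uniqueness

section Lift

variable {n N : ℕ} {M : Type*} [TopologicalSpace M] [ChartedSpace (Euc n) M]
  [IsManifold (𝓡 n) ∞ M] {g : RiemMetric n M} {τ τ' : ConeTriple N} {F F' : M → Mink (N + 1)}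
  {r r' : M → ℝ} {u : M → Euc N}

namespace IsIsometricImmersion

theorem sq_mul_inner_chartDeriv_of_lift (hF : IsIsometricImmersion g lor F)
    (hr : ∀ x, F x = r x • τ.embed (u x)) (hr0 : ∀ x, r x ≠ 0) (x : M) (X : Euc n) :
    r x ^ 2 * inner ℝ (chartDeriv n u x X) (chartDeriv n u x X) = metricAt g x X X := by
  have hdF := (hasFDerivAt_chartDeriv (hF.mdifferentiableAt x)).differentiableAt
  have hr_eq : r = fun y => lorForm (N + 1) τ.w (F y) := funext fun y => by
    rw [hr, lorForm_apply, lor_comm, lor_smul_left, τ.lor_embed_w, mul_one]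
  have hu_eq : u = fun y => lorAdjoint τ.A ((r y)⁻¹ • F y) := funext fun y => by
    rw [hr, inv_smul_smul₀ (hr0 y), τ.lorAdjoint_embed]
  have hdr : DifferentiableAt ℝ (r ∘ (extChartAt (𝓡 n) x).symm) (extChartAt (𝓡 n) x x) := by
    rw [hr_eq]
    exact (lorForm (N + 1) τ.w).differentiableAt.comp _ hdF
  have hdu : DifferentiableAt ℝ (u ∘ (extChartAt (𝓡 n) x).symm) (extChartAt (𝓡 n) x x) := by
    rw [hu_eq]
    exact (lorAdjoint τ.A).differentiableAt.comp _ ((hdr.inv (hr0 _)).smul hdF)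
  have hlift : F ∘ (extChartAt (𝓡 n) x).symm = fun y => (r ∘ (extChartAt (𝓡 n) x).symm) y •
      τ.embed ((u ∘ (extChartAt (𝓡 n) x).symm) y) := funext fun y => hr _
  have hlor := τ.lor_fderiv_lift hdr hdu X X
  rw [← hlift, Function.comp_apply, extChartAt_to_inv] at hlor
  exact hlor.symm.trans (hF.chartDeriv_chartDeriv x X X)

theorem sq_eq_sq_of_lift (hF : IsIsometricImmersion g lor F) (hF' : IsIsometricImmersion g lor F')
    (hn : 1 ≤ n) (hr : ∀ x, F x = r x • τ.embed (u x)) (hr0 : ∀ x, r x ≠ 0)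
    (hr' : ∀ x, F' x = r' x • τ'.embed (u x)) (hr0' : ∀ x, r' x ≠ 0) (x : M) :
    r x ^ 2 = r' x ^ 2 := by
  obtain ⟨X, hX⟩ := hF.exists_chartDeriv_pos hn x
  have hu := hF.sq_mul_inner_chartDeriv_of_lift hr hr0 x X
  have hu' := hF'.sq_mul_inner_chartDeriv_of_lift hr' hr0' x X
  rw [hF.chartDeriv_chartDeriv, ← hu] at hX
  exact mul_right_cancel₀ (right_ne_zero_of_mul hX.ne') (hu.trans hu'.symm)

end IsIsometricImmersion

end Lift

theorem lor_le_of_mem_hypCurv {m : ℕ} {c : ℝ} (hc : 0 < c) {X Y : Mink m} (hX : X ∈ hypCurv m c)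
    (hY : Y ∈ hypCurv m c) : lor X Y ≤ -1 / c := by
  obtain ⟨hX, hX0⟩ := hX
  obtain ⟨hY, hY0⟩ := hY
  rw [lor_self, neg_div] at hX hY
  have hc' : 0 < 1 / c := one_div_pos.2 hc
  have hsq : (‖X.1‖ * ‖Y.1‖ + 1 / c) ^ 2 ≤ (X.2 * Y.2) ^ 2 := by
    rw [mul_pow, show X.2 ^ 2 = ‖X.1‖ ^ 2 + 1 / c by linarith,
      show Y.2 ^ 2 = ‖Y.1‖ ^ 2 + 1 / c by linarith]
    nlinarith [mul_nonneg hc'.le (sq_nonneg (‖X.1‖ - ‖Y.1‖))]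
  have hle := (abs_le_of_sq_le_sq' hsq (by positivity)).2
  rw [lor, neg_div]
  linarith [real_inner_le_norm X.1 Y.1]

theorem inner_le_of_mem_sphereCurv {d : ℕ} {c : ℝ} {X Y : Euc d} (hX : X ∈ sphereCurv d c)
    (hY : Y ∈ sphereCurv d c) : inner ℝ X Y ≤ 1 / c := by
  have hX : inner ℝ X X = 1 / c := hX
  have hY : inner ℝ Y Y = 1 / c := hY
  have hsub : (0 : ℝ) ≤ inner ℝ (X - Y) (X - Y) := real_inner_self_nonneg
  rw [real_inner_sub_sub_self, hX, hY] at hsub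
  linarith

theorem lor_self_nonneg_of_mem_span {ι : Type*} {d l : ℕ} {a : ι → Mink d} {b : ι → Euc l}
    (hab : ∀ x y, lor (a x) (a y) = inner ℝ (b x) (b y)) {v : Mink d}
    (hv : v ∈ Submodule.span ℝ (Set.range a)) : 0 ≤ lor v v := by
  obtain ⟨s, rfl⟩ := Finsupp.mem_span_range_iff_exists_finsupp.1 hv
  have hs : lor (s.sum fun x t => t • a x) (s.sum fun x t => t • a x) =
      inner ℝ (s.sum fun x t => t • b x) (s.sum fun x t => t • b x) := by
    simp only [Finsupp.sum, lor_sum_left, lor_sum_right, lor_smul_left, lor_smul_right, sum_inner,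
      inner_sum, inner_smul_left, inner_smul_right, hab, RCLike.conj_to_real]
  exact hs ▸ real_inner_self_nonneg

variable {k N : ℕ} {n : Fin k → ℕ} {M : Fin k → Type*} [∀ i, TopologicalSpace (M i)]
  [∀ i, ChartedSpace (Euc (n i)) (M i)] [∀ i, IsManifold (𝓡 (n i)) ∞ (M i)]
  {τ τ' : ConeTriple N} {g : ∀ i, RiemMetric (n i) (M i)} {f : (∀ i, M i) → Euc N}
  {F F' : (∀ i, M i) → Mink (N + 1)} {G : ∀ i, M i → Mink (N + 1)} {o : ∀ i, M i} {j j' : Fin k}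

/-- The properties of the lift `p ↦ C (f_j (p j)) + D (Ψ (f_i (p i))_{i ≠ j})` of `f` in case (ii)
that determine the factor `j`. As `C` may reverse the time orientation, the factor `r` is allowed to
be negative. -/
structure IsHyperbolicLift (τ : ConeTriple N) (g : ∀ i, RiemMetric (n i) (M i))
    (f : (∀ i, M i) → Euc N) (j : Fin k) (F : (∀ i, M i) → Mink (N + 1)) : Prop where
  lift : ∀ p, ∃ r : ℝ, r ≠ 0 ∧ F p = r • τ.embed (f p)
  isom_update : ∀ p, IsIsometricImmersion (g j) lor fun x => F (Function.update p j x)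
  lor_nonpos : ∀ p q, lor (F p) (F q) ≤ 0
  exists_sub_eq : ∃ (l : ℕ) (D : Euc l →ₗ[ℝ] Mink (N + 1)),
    (∀ x y, lor (D x) (D y) = inner ℝ x y) ∧ ∀ p q, p j = q j → ∃ y, F p - F q = D y

theorem CaseTheta.exists_isHyperbolicLift (hθ : CaseTheta g f j) :
    ∃ τ F, IsHyperbolicLift τ g f j F := by
  obtain ⟨m, l, c, Ψ, X, H, dom, Θ, -, -, -, hc, hΨ, ⟨hX, hXc⟩, hH, hΘ, hf⟩ := hθ
  obtain ⟨τ, C, D, hC, hD, hCD, rfl, hE⟩ := hΘ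
  set S : (∀ i, M i) → Euc (l + 1) := fun p => Ψ.map fun i => H i (p i)
  have hS : ∀ p, S p ∈ sphereCurv (l + 1) c := fun p => hΨ.2 _ fun i => (hH i).2 _
  have hupdate : ∀ p x, S (Function.update p j x) = S p := fun p x =>
    congrArg Ψ.map <| funext fun i => by rw [Function.update_of_ne i.2]
  refine ⟨τ, fun p => C (X (p j)) + D (S p), fun p => ⟨_, (hf p).1.2.2, ?_⟩, fun p => ?_,
    fun p q => ?_, l + 1, D, hD, fun p q hpq => ⟨S p - S q, ?_⟩⟩
  · rw [(hf p).2, hE _ (hf p).1, smul_inv_smul₀ (hf p).1.2.2]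
  · simp only [hupdate, Function.update_self]
    exact hX.clm_add (LinearMap.toContinuousLinearMap C) (fun _ _ _ => hC _ _) (D (S p))
  · rw [lor_add_left, lor_add_right, lor_add_right, hC, hD, lor_comm (D _), hCD, hCD]
    have hle := lor_le_of_mem_hypCurv hc (hXc (p j)) (hXc (q j))
    rw [neg_div] at hle
    linarith [inner_le_of_mem_sphereCurv (hS p) (hS q)]
  · rw [hpq, map_sub, add_sub_add_left_eq_sub]

namespace IsSplitLift

variable (h : IsSplitLift τ g f F G o)
include h

theorem isom_update (p : ∀ i, M i) (i : Fin k) :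
    IsIsometricImmersion (g i) lor fun x => F (Function.update p i x) := by
  have hF : ∀ x, F (Function.update p i x) =
      ContinuousLinearMap.id ℝ _ (G i x) + (F p - G i (p i)) := fun x => by
    rw [h.apply_update, ContinuousLinearMap.id_apply]
    abel
  simp only [hF]
  exact (h.isom i).clm_add _ (fun _ _ _ => rfl) _

-- Both sides are multiples of `-‖f p - f q‖² / 2` with factors that agree up to sign; the signs of
-- the two sides agree as neither of them is positive.
theorem lor_eq_of_isHyperbolicLift (h' : IsHyperbolicLift τ' g f j F') (hn : 1 ≤ n j)
    (p q : ∀ i, M i) : lor (F p) (F q) = lor (F' p) (F' q) := by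
  choose r hr hrF using h.lift
  choose s hs hsF using h'.lift
  have hsq : ∀ p, r p ^ 2 = s p ^ 2 := fun p => by
    have hupd := (h.isom_update p j).sq_eq_sq_of_lift (h'.isom_update p) hn
      (r := fun x => r (Function.update p j x)) (r' := fun x => s (Function.update p j x))
      (u := fun x => f (Function.update p j x)) (fun x => hrF _) (fun x => (hr _).ne')
      (fun x => hsF _) (fun x => hs _) (p j)
    simpa only [Function.update_eq_self] using hupd
  have hnonpos := h'.lor_nonpos p q
  rw [hsF, hsF q, lor_smul_left, lor_smul_right, τ'.lor_embed_embed, ← mul_assoc] at hnonpos ⊢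
  rw [hrF, hrF q, lor_smul_left, lor_smul_right, τ.lor_embed_embed, ← mul_assoc]
  have hprod : (r p * r q) ^ 2 = (s p * s q) ^ 2 := by rw [mul_pow, mul_pow, hsq, hsq]
  rcases sq_eq_sq_iff_eq_or_eq_neg.1 hprod with heq | hneg
  · rw [heq]
  · have hdist : ‖f p - f q‖ ^ 2 / 2 = 0 := by
      nlinarith [mul_pos (hr p) (hr q), sq_nonneg ‖f p - f q‖]
    rw [hdist, neg_zero, mul_zero, mul_zero]

theorem eq_of_caseTheta (hn : ∀ i, 1 ≤ n i) {v : Mink (N + 1)}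
    (hv : v ∈ Submodule.span ℝ (Set.range (G j))) (hvv : lor v v < 0) (hθ : CaseTheta g f j') :
    j' = j := by
  obtain ⟨τ', F', h'⟩ := hθ.exists_isHyperbolicLift
  obtain ⟨l, D, hD, hsub⟩ := h'.exists_sub_eq
  by_contra hj
  choose y hy using fun x => hsub (Function.update o j x) o (Function.update_of_ne hj x o)
  have hG : ∀ x, G j x = F (Function.update o j x) - F o := fun x => by
    rw [h.apply_update_base, add_sub_cancel_left]
  refine hvv.not_ge (lor_self_nonneg_of_mem_span (b := y) (fun x x' => ?_) hv)
  rw [← hD, ← hy, ← hy, hG, hG]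
  simp only [lor_sub_left, lor_sub_right, h.lor_eq_of_isHyperbolicLift h' (hn j')]

end IsSplitLift

end Uniqueness

theorem theorem4p1 {k N : ℕ} (hk : 2 ≤ k) (n : Fin k → ℕ) (hn : ∀ i, 1 ≤ n i)
    (hn3 : 3 ≤ ∑ i, n i) (M : Fin k → Type*) [∀ i, TopologicalSpace (M i)]
    [∀ i, T2Space (M i)] [∀ i, SecondCountableTopology (M i)] [∀ i, ConnectedSpace (M i)]
    [∀ i, ChartedSpace (Euc (n i)) (M i)] [∀ i, IsManifold (𝓡 (n i)) ∞ (M i)]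
    (g : ∀ i, RiemMetric (n i) (M i)) (f : (∀ i, M i) → Euc N)
    (hf : IsConformalImmersion g f) (hadapted : IsAdaptedToProductNet n f) :
    (CaseSphere g f ∨ CaseFlat g f) ∨ ∃! j, CaseTheta g f j := by
  obtain ⟨τ⟩ := nonempty_coneTriple N
  have o : ∀ i, M i := fun i => Classical.arbitrary (M i)
  obtain ⟨F, G, h⟩ := exists_isSplitLift τ hn hn3 hf hadapted o
  by_cases htime : ∃ j, ∃ v ∈ Submodule.span ℝ (Set.range (G j)), lor v v < 0
  · obtain ⟨j, v, hv, hvv⟩ := htime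
    exact Or.inr ⟨j, h.caseTheta hk hn hv hvv, fun j' hj' => h.eq_of_caseTheta hn hv hvv hj'⟩
  push Not at htime
  by_cases hnull : ∃ j, ∃ z ∈ Submodule.span ℝ (Set.range (G j)), z ≠ 0 ∧ lor z z = 0
  · obtain ⟨j, z, hz, hz0, hzz⟩ := hnull
    exact Or.inl (Or.inr (h.caseFlat hn htime hz hz0 hzz))
  push Not at hnull
  exact Or.inl (Or.inl (h.caseSphere hn ⟨0, by lia⟩ fun i x hx hx0 =>
    (htime i x hx).lt_of_ne (hnull i x hx hx0).symm))
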